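/- Let $D^2\subset\mathbb R^2\simeq\mathbb C$ be the open unit disc, $\nabla^\perp=(-\partial_{2},\partial_{1})$, and let $g\in W^{1,p}(D^2,S^1)$ for some $p>1$, where $S^1\subset\mathbb C$ is the unit circle. Let $b_g$ be the unique weak solution of $$\Delta b_g=\operatorname{div}(-i\,g^{-1}\nabla g)\ \text{ in } D^2,\qquad b_g=0\ \text{ on }\partial D^2$$ (that is, $b_g\in W^{1,q}_0(D^2,\mathbb R)$ for some $1<q<\infty$), let $a_g\in W^{1,q}(D^2,\mathbb R)$ be the function with average $0$ on $D^2$ and $\nabla^\perp a_g=-i\,g^{-1}\nabla g-\nabla b_g$, and let $u_g:=\pi^{-1}(e^{a_g}g):D^2\to S^2$ be the $S^2$ lift of $g$, where $\pi:S^2\to\mathbb C$ is the stereographic projection sending the north pole to $0$. The renormalized Dirichlet energy of $g$ is $$\mathcal E(g):=\frac14\int_{D^2}\left(|\nabla u_g|^2+|\nabla b_g|^2\right)dx^2\in[0,\infty],$$ where a Dirichlet integral is $\infty$ if the weak gradient does not exist or is not square integrable. Assume $\mathcal E(g)<\infty$. Then the following three conditions are equivalent: 1. $g$ solves the weak $S^1$-harmonic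 map equation $\operatorname{div}(g^{-1}\nabla g)=0$ in $\mathcal D'(D^2)$; 2. $g$ is critical for $\mathcal E$ under smooth variations in the target: for every $\psi\in C^\infty_c(D^2,\mathbb R)$, $\mathcal E(g e^{it\psi})$ is finite for all $t$ near $0$ and $\frac{d}{dt}\big|_{t=0}\mathcal E(g e^{it\psi})=0$; 3. $b_g=0$ almost everywhere in $D^2$. If moreover $g$ has isolated topological singularities, that is, in $\mathcal D'(D^2)$ $$\operatorname{div}(i\,g^{-1}\nabla^\perp g)=2\pi\sum_{p\in S}d_p\,\delta_p$$ for an at most countable set $S\subset D^2$ of isolated points and integers $d_p$ (the sum converging unconditionally against each test function), then these conditions are also equivalent to 4. $u_g$ is a conformal harmonic map into $S^2$: it agrees almost everywhere with a smooth map $U:D^2\to S^2$ such that $-\Delta U=|\nabla U|^2U$, $|\partial_1U|=|\partial_2U|$ and $\partial_1U\cdot\partial_2U=0$ in $D^2$ (points where $\nabla U=0$ are allowed). -/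

import Mathlib

open MeasureTheory Filter Topology
open scoped ENNReal

noncomputable section

/-- The open unit disc `D²` of the plane `ℝ² ≃ ℂ`. -/
def unitDisc : Set ℂ := Metric.ball 0 1

/-- Lebesgue measure on the disc. -/
def discMeasure : Measure ℂ := volume.restrict unitDisc

/-- The coordinate directions `e₁ = 1`, `e₂ = i` of `ℝ² ≃ ℂ`. -/
def coordDir : Fin 2 → ℂ := ![1, Complex.I]

/-- The classical partial derivative `∂_j f (x)`. -/
def partialD {F : Type*} [NormedAddCommGroup F] [NormedSpace ℝ F]
    (j : Fin 2) (f : ℂ → F) (x : ℂ) : F :=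
  fderiv ℝ f x (coordDir j)

/-- `φ ∈ C^∞_c(D², ℝ)`. -/
structure IsDiscTest (φ : ℂ → ℝ) : Prop where
  smooth : ContDiff ℝ ((⊤ : ℕ∞) : WithTop ℕ∞) φ
  compact : HasCompactSupport φ
  supp : tsupport φ ⊆ unitDisc

/-- `v = (v₀, v₁)` is the weak (distributional) gradient of `u` in `D²`,
both being locally integrable in `D²`. -/
structure HasWeakGrad {F : Type*} [NormedAddCommGroup F] [NormedSpace ℝ F]
    (u : ℂ → F) (v : Fin 2 → ℂ → F) : Prop where
  locInt : LocallyIntegrableOn u unitDisc volume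
  locInt_grad : ∀ j, LocallyIntegrableOn (v j) unitDisc volume
  eqn : ∀ φ : ℂ → ℝ, IsDiscTest φ → ∀ j,
    ∫ x, partialD j φ x • u x ∂discMeasure = - ∫ x, φ x • v j x ∂discMeasure

/-- `u ∈ W^{1,p}(D², F)`. -/
def MemSobolev {F : Type*} [NormedAddCommGroup F] [NormedSpace ℝ F]
    (p : ℝ≥0∞) (u : ℂ → F) : Prop :=
  MemLp u p discMeasure ∧ ∃ v, HasWeakGrad u v ∧ ∀ j, MemLp (v j) p discMeasure

/-- `u ∈ W^{1,p}_0(D², ℝ)`: `u` is a limit in `W^{1,p}` of functions in `C^∞_c(D²)`. -/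
def MemSobolevZero (p : ℝ≥0∞) (u : ℂ → ℝ) : Prop :=
  MemLp u p discMeasure ∧ ∃ v, HasWeakGrad u v ∧ (∀ j, MemLp (v j) p discMeasure) ∧
    ∃ φ : ℕ → ℂ → ℝ, (∀ n, IsDiscTest (φ n)) ∧
      Tendsto (fun n => eLpNorm (fun x => φ n x - u x) p discMeasure) atTop (𝓝 0) ∧
      ∀ j, Tendsto (fun n => eLpNorm (fun x => partialD j (φ n) x - v j x) p discMeasure)
        atTop (𝓝 0)

/-- The Dirichlet integral `∫_{D²} |∇u|²` of the weak gradient of `u`. The weak gradient is unique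
almost everywhere; the value is `∞` if it does not exist. -/
def dirichletIntegral {F : Type*} [NormedAddCommGroup F] [NormedSpace ℝ F]
    (u : ℂ → F) : ℝ≥0∞ :=
  ⨅ (v : Fin 2 → ℂ → F) (_ : HasWeakGrad u v), ∫⁻ x, ∑ j, ‖v j x‖ₑ ^ 2 ∂discMeasure

/-- `b ∈ W^{1,q}_0` is a weak solution of `Δ b = div (-i g⁻¹ ∇g)` in `D²`, `b = 0` on `∂D²`. -/
def SolvesPhaseProblem (q : ℝ≥0∞) (g : ℂ → ℂ) (b : ℂ → ℝ) : Prop :=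
  MemSobolevZero q b ∧ ∃ (vg : Fin 2 → ℂ → ℂ) (vb : Fin 2 → ℂ → ℝ),
    HasWeakGrad g vg ∧ HasWeakGrad b vb ∧
    ∀ φ : ℂ → ℝ, IsDiscTest φ →
      ∫ x, ∑ j, (vb j x : ℂ) * ((partialD j φ x : ℝ) : ℂ) ∂discMeasure =
        ∫ x, ∑ j, (-Complex.I * (g x)⁻¹ * vg j x) * ((partialD j φ x : ℝ) : ℂ) ∂discMeasure

/-- `a ∈ W^{1,q}` has average `0` and `∇^⊥ a = -i g⁻¹ ∇g - ∇b`,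
where `∇^⊥ a = (-∂₂ a, ∂₁ a)`. -/
def IsConjugatePotential (q : ℝ≥0∞) (g : ℂ → ℂ) (b a : ℂ → ℝ) : Prop :=
  MemSobolev q a ∧ ∫ x, a x ∂discMeasure = 0 ∧
    ∃ (vg : Fin 2 → ℂ → ℂ) (va vb : Fin 2 → ℂ → ℝ),
      HasWeakGrad g vg ∧ HasWeakGrad a va ∧ HasWeakGrad b vb ∧
      ∀ᵐ x ∂discMeasure,
        ((-va 1 x : ℝ) : ℂ) = -Complex.I * (g x)⁻¹ * vg 0 x - (vb 0 x : ℂ) ∧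
        ((va 0 x : ℝ) : ℂ) = -Complex.I * (g x)⁻¹ * vg 1 x - (vb 1 x : ℂ)

/-- `(a, b) = (a_g, b_g)` is the Hodge decomposition of `-i g⁻¹ ∇g`. The solution `b` is unique
almost everywhere among all exponents `1 < q < ∞`, hence so is `a`. -/
def IsHodgePair (g : ℂ → ℂ) (a b : ℂ → ℝ) : Prop :=
  ∃ q : ℝ≥0∞, 1 < q ∧ q ≠ ∞ ∧ SolvesPhaseProblem q g b ∧ IsConjugatePotential q g b a

/-- The inverse of the stereographic projection `S² → ℂ` that sends the north pole to `0`. -/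
def invStereo (w : ℂ) : EuclideanSpace ℝ (Fin 3) :=
  !₂[2 * w.re / (1 + ‖w‖ ^ 2), 2 * w.im / (1 + ‖w‖ ^ 2), (1 - ‖w‖ ^ 2) / (1 + ‖w‖ ^ 2)]

/-- The `S²` lift `u_g = π⁻¹(e^{a} g)` of `g`, where `a = a_g`. -/
def sphereLift (g : ℂ → ℂ) (a : ℂ → ℝ) (x : ℂ) : EuclideanSpace ℝ (Fin 3) :=
  invStereo ((Real.exp (a x) : ℂ) * g x)

/-- The renormalized Dirichlet energy `¼ ∫ (|∇u_g|² + |∇b_g|²)`. The infimum is over the pairs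
`(a_g, b_g)`, which are unique almost everywhere. -/
def renormEnergy (g : ℂ → ℂ) : ℝ≥0∞ :=
  ⨅ (a : ℂ → ℝ) (b : ℂ → ℝ) (_ : IsHodgePair g a b),
    (dirichletIntegral (sphereLift g a) + dirichletIntegral b) / 4

/-- `div (g⁻¹ ∇g) = 0` in the sense of distributions on `D²`. -/
def IsWeaklyCircleHarmonic (g : ℂ → ℂ) : Prop :=
  ∃ v : Fin 2 → ℂ → ℂ, HasWeakGrad g v ∧
    ∀ φ : ℂ → ℝ, IsDiscTest φ →
      ∫ x, ∑ j, ((g x)⁻¹ * v j x) * ((partialD j φ x : ℝ) : ℂ) ∂discMeasure = 0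

/-- The variation `g e^{itψ}`. -/
def phaseVariation (g : ℂ → ℂ) (ψ : ℂ → ℝ) (t : ℝ) (x : ℂ) : ℂ :=
  g x * Complex.exp (Complex.I * t * ψ x)

/-- `g` is critical for the renormalized energy under smooth compactly supported variations in
the target: `t ↦ 𝓔(g e^{itψ})` is finite near `0` and has derivative `0` at `t = 0`. -/
def IsCriticalForRenormEnergy (g : ℂ → ℂ) : Prop :=
  ∀ ψ : ℂ → ℝ, IsDiscTest ψ →
    (∀ᶠ t : ℝ in 𝓝 0, renormEnergy (phaseVariation g ψ t) ≠ ∞) ∧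
    HasDerivAt (fun t : ℝ => (renormEnergy (phaseVariation g ψ t)).toReal) 0 0

/-- `g` has isolated topological singularities: in the sense of distributions on `D²`,
`div (i g⁻¹ ∇^⊥ g) = 2π ∑_{p ∈ S} d_p δ_p` for an at most countable set `S ⊆ D²` of isolated
points and integers `d_p`. -/
def HasIsolatedSingularities (g : ℂ → ℂ) : Prop :=
  ∃ (v : Fin 2 → ℂ → ℂ) (S : Set ℂ) (d : S → ℤ), HasWeakGrad g v ∧
    S ⊆ unitDisc ∧ S.Countable ∧ (∀ p ∈ S, ∃ r > 0, S ∩ Metric.ball p r = {p}) ∧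
    ∀ φ : ℂ → ℝ, IsDiscTest φ →
      HasSum (fun p : S => 2 * (Real.pi : ℂ) * (d p : ℂ) * (φ p : ℂ))
        (- ∫ x, Complex.I * (g x)⁻¹ *
          (-v 1 x * ((partialD 0 φ x : ℝ) : ℂ) + v 0 x * ((partialD 1 φ x : ℝ) : ℂ)) ∂discMeasure)

/-- `u` is (almost everywhere equal to) a conformal harmonic map `D² → S²`: a smooth map with
`-Δ U = |∇U|² U`, `|∂₁ U| = |∂₂ U|` and `∂₁ U ⬝ ∂₂ U = 0`. As usual for maps between surfaces,
points where `∇U` vanishes are allowed. -/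
def IsConformalHarmonicToSphere (u : ℂ → EuclideanSpace ℝ (Fin 3)) : Prop :=
  ∃ U : ℂ → EuclideanSpace ℝ (Fin 3), u =ᵐ[discMeasure] U ∧
    ContDiffOn ℝ ((⊤ : ℕ∞) : WithTop ℕ∞) U unitDisc ∧
    ∀ x ∈ unitDisc, ‖U x‖ = 1 ∧
      -(Laplacian.laplacian U x) = (∑ j, ‖partialD j U x‖ ^ 2) • U x ∧
      ‖partialD 0 U x‖ = ‖partialD 1 U x‖ ∧
      inner ℝ (partialD 0 U x) (partialD 1 U x) = 0

end

/-! ### Test functions and weak gradients on open sets -/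

section Basic

/-! Put ω = -i g⁻¹∇g, a real vector field because |g| = 1, so that ω = ∇^⊥a + ∇b. The whole argument
runs through a, b and ω. `HodgeData` packages them with fixed weak gradients, and a pair (a, b)
exists because a finite infimum is not taken over the empty family.

Condition 1. Since ∇^⊥a is divergence free, div(g⁻¹∇g) = iΔb, so g is weakly harmonic exactly when b
is. But b lies in W^{1,1}_0, and there weakly harmonic functions vanish
(`MemSobolevZeroOne.ae_eq_zero`): Weyl's lemma makes b harmonic, the Poisson formula bounds |b(w)|
by averages of |b| over a thin boundary annulus, and a Poincaré inequality bounds these by the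
gradient mass of the annulus, which tends to 0. The same uniqueness makes the pair (a, b) unique, so
the energy can be computed from any pair.

Condition 2. The lift is u = (sech(a) g, -tanh a), whence |∇u|² = sech²(a)(|∇a|² + |ω|²). Replacing
g by g e^{itψ} keeps a and turns b into b + tψ, so the energy is a quadratic polynomial in t with
linear coefficient ½∫(sech²(a) ω + ∇b)·∇ψ. Because sech²(a)∇^⊥a = ∇^⊥ tanh a is divergence free, ω
may be replaced by ∇b: criticality says that (sech²(a) + 1)∇b is divergence free. Testing with b
gives ∫(sech²(a) + 1)|∇b|² = 0. This test is legitimate by `MemSobolevZeroOne.integral_eq_zero`,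
which places ∇b in the L² closure of the gradients of test functions.

Condition 4. Conformality of u is the vanishing of a product of two complex numbers and forces, at
almost every point, ∇b = 0 or ∇b = -2∇^⊥a. Either way |∇b|² = -2∇^⊥a·∇b; multiplied by sech²(a), the
right side integrates to 0. Conversely, if b = 0 the singularity equation reads Δa = 2π∑ d_p δ_p.
Integrality and unconditional convergence make the charges locally finite, so near x₀ one has a = Re
H + d log|x - x₀| with H holomorphic. With f = (x - x₀)^d e^H this says e^a = |f|; then e^a g / f
has zero gradient on the punctured disc, which is connected, so e^a g = c f is meromorphic. The
inverse stereographic projection of a holomorphic function is conformal and harmonic, and a pole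
becomes a zero after the rotation of the sphere that induces z ↦ 1/z. The local maps are glued by
continuity (`exists_glue`). -/

theorem locallyIntegrableOn_congr {Ω : Set ℂ} (hΩ : IsOpen Ω) {F : Type*} [NormedAddCommGroup F]
    {f g : ℂ → F}
    (hf : LocallyIntegrableOn f Ω volume) (h : f =ᵐ[volume.restrict Ω] g) :
    LocallyIntegrableOn g Ω volume := by
  rw [locallyIntegrableOn_iff hΩ.isLocallyClosed] at hf ⊢
  intro K hK hKc
  exact (hf K hK hKc).congr_fun_ae (ae_restrict_of_ae_restrict_of_subset hK h)

variable {F : Type*} [NormedAddCommGroup F] [NormedSpace ℝ F]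

theorem two_le_smooth : (2 : WithTop ℕ∞) ≤ ((⊤ : ℕ∞) : WithTop ℕ∞) :=
  WithTop.coe_le_coe.2 (le_top : (2 : ℕ∞) ≤ ⊤)

/-- `φ ∈ C^∞_c(Ω, ℝ)`. -/
structure IsTest (Ω : Set ℂ) (φ : ℂ → ℝ) : Prop where
  smooth : ContDiff ℝ (⊤ : ℕ∞) φ
  compact : HasCompactSupport φ
  supp : tsupport φ ⊆ Ω

theorem isDiscTest_iff {φ : ℂ → ℝ} : IsDiscTest φ ↔ IsTest unitDisc φ :=
  ⟨fun h => ⟨h.smooth, h.compact, h.supp⟩, fun h => ⟨h.smooth, h.compact, h.supp⟩⟩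

theorem isOpen_unitDisc : IsOpen unitDisc := Metric.isOpen_ball

theorem measurableSet_unitDisc : MeasurableSet unitDisc := isOpen_unitDisc.measurableSet

instance : IsFiniteMeasure discMeasure :=
  ⟨by
    rw [discMeasure, Measure.restrict_apply_univ]
    exact measure_ball_lt_top⟩

theorem norm_coordDir (j : Fin 2) : ‖coordDir j‖ = 1 := by
  fin_cases j <;> simp [coordDir]

theorem contDiff_partialD {f : ℂ → F} (hf : ContDiff ℝ (⊤ : ℕ∞) f) (j : Fin 2) :
    ContDiff ℝ (⊤ : ℕ∞) (partialD j f) :=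
  (hf.fderiv_right (m := (⊤ : ℕ∞)) (by exact_mod_cast le_top)).clm_apply contDiff_const

theorem contDiffOn_partialD {f : ℂ → F} {Ω : Set ℂ} (hΩ : IsOpen Ω)
    (hf : ContDiffOn ℝ (⊤ : ℕ∞) f Ω) (j : Fin 2) :
    ContDiffOn ℝ (⊤ : ℕ∞) (partialD j f) Ω :=
  (hf.fderiv_of_isOpen (m := (⊤ : ℕ∞)) hΩ (by exact_mod_cast le_top)).clm_apply contDiffOn_const

theorem partialD_comm {f : ℂ → F} {x : ℂ} (hf : ContDiffAt ℝ (⊤ : ℕ∞) f x) (i j : Fin 2) :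
    partialD i (partialD j f) x = partialD j (partialD i f) x := by
  have h2 : ContDiffAt ℝ (1 + 1) f x :=
    hf.of_le (by rw [one_add_one_eq_two]; exact two_le_smooth)
  have hd : DifferentiableAt ℝ (fderiv ℝ f) x :=
    (h2.fderiv_right (m := 1) le_rfl).differentiableAt one_ne_zero
  have key : ∀ k l : Fin 2, partialD k (partialD l f) x
      = fderiv ℝ (fderiv ℝ f) x (coordDir k) (coordDir l) := by
    intro k l
    change fderiv ℝ (fun y => fderiv ℝ f y (coordDir l)) x (coordDir k) = _
    rw [fderiv_clm_apply hd (differentiableAt_const _)]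
    simp
  rw [key, key]
  exact (hf.isSymmSndFDerivAt (by simpa using two_le_smooth)) _ _

theorem laplacian_eq_partialD {f : ℂ → F} {x : ℂ} (hf : ContDiffAt ℝ 2 f x) :
    Laplacian.laplacian f x = ∑ j, partialD j (partialD j f) x := by
  have hd : DifferentiableAt ℝ (fderiv ℝ f) x :=
    (hf.fderiv_right (m := 1) le_rfl).differentiableAt one_ne_zero
  have key : ∀ k l : Fin 2, partialD k (partialD l f) x
      = fderiv ℝ (fderiv ℝ f) x (coordDir k) (coordDir l) := by
    intro k l
    change fderiv ℝ (fun y => fderiv ℝ f y (coordDir l)) x (coordDir k) = _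
    rw [fderiv_clm_apply hd (differentiableAt_const _)]
    simp
  rw [InnerProductSpace.laplacian_eq_iteratedFDeriv_complexPlane]
  simp [key, iteratedFDeriv_two_apply, coordDir]

/-! ### Stability of test functions and integrability against them. -/

namespace IsTest

variable {Ω : Set ℂ} {φ : ℂ → ℝ}

theorem mono {Ω' : Set ℂ} (h : IsTest Ω φ) (hs : Ω ⊆ Ω') : IsTest Ω' φ :=
  ⟨h.smooth, h.compact, h.supp.trans hs⟩

theorem partialD (h : IsTest Ω φ) (j : Fin 2) : IsTest Ω (partialD j φ) := by
  refine ⟨contDiff_partialD h.smooth j, ?_, ?_⟩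
  · exact h.compact.fderiv_apply ℝ _
  · exact (tsupport_fderiv_apply_subset ℝ _).trans h.supp

theorem eq_zero (h : IsTest Ω φ) {x : ℂ} (hx : x ∉ Ω) : φ x = 0 :=
  image_eq_zero_of_notMem_tsupport fun h' => hx (h.supp h')

theorem contDiff_smul (h : IsTest Ω φ) (hΩ : IsOpen Ω) {f : ℂ → F} {n : WithTop ℕ∞}
    (hn : n ≤ (⊤ : ℕ∞)) (hf : ContDiffOn ℝ n f Ω) : ContDiff ℝ n (fun x => φ x • f x) := by
  rw [contDiff_iff_contDiffAt]
  intro x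
  by_cases hx : x ∈ tsupport φ
  · exact (h.smooth.contDiffAt.of_le hn).smul (hf.contDiffAt (hΩ.mem_nhds (h.supp hx)))
  · have : (fun x => φ x • f x) =ᶠ[𝓝 x] fun _ => (0 : F) := by
      filter_upwards [(isClosed_tsupport φ).isOpen_compl.mem_nhds hx] with y hy
      simp [image_eq_zero_of_notMem_tsupport hy]
    exact contDiffAt_const.congr_of_eventuallyEq this

theorem mul_smooth (h : IsTest Ω φ) (hΩ : IsOpen Ω) {f : ℂ → ℝ}
    (hf : ContDiffOn ℝ (⊤ : ℕ∞) f Ω) : IsTest Ω (fun x => φ x * f x) :=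
  ⟨by simpa using h.contDiff_smul hΩ le_rfl hf, h.compact.mul_right,
    (tsupport_mul_subset_left).trans h.supp⟩

theorem integrable_smul (h : IsTest Ω φ) {f : ℂ → F}
    (hf : LocallyIntegrableOn f Ω volume) : Integrable (fun x => φ x • f x) := by
  have h1 : IntegrableOn f (tsupport φ) := hf.integrableOn_compact_subset h.supp h.compact
  have h2 : IntegrableOn (fun x => φ x • f x) (tsupport φ) :=
    h1.continuousOn_smul h.smooth.continuous.continuousOn h.compact
  refine (integrableOn_iff_integrable_of_support_subset ?_).1 h2
  intro x hx
  by_contra hx'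
  exact hx (by simp [image_eq_zero_of_notMem_tsupport hx'])

theorem integral_smul (h : IsTest Ω φ) (f : ℂ → F) :
    ∫ x in Ω, φ x • f x = ∫ x, φ x • f x :=
  setIntegral_eq_integral_of_forall_compl_eq_zero fun x hx => by simp [h.eq_zero hx]

theorem exists_bound (h : IsTest Ω φ) : ∃ C, ∀ x, ‖φ x‖ ≤ C :=
  h.compact.exists_bound_of_continuous h.smooth.continuous

end IsTest

/-- `v` is the weak gradient of `u` in the open set `Ω`. -/
structure WeakGradOn (Ω : Set ℂ) (u : ℂ → F) (v : Fin 2 → ℂ → F) : Prop where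
  locInt : LocallyIntegrableOn u Ω volume
  locInt_grad : ∀ j, LocallyIntegrableOn (v j) Ω volume
  eqn : ∀ φ : ℂ → ℝ, IsTest Ω φ → ∀ j,
    ∫ x, partialD j φ x • u x = - ∫ x, φ x • v j x

theorem hasWeakGrad_iff {u : ℂ → F} {v : Fin 2 → ℂ → F} :
    HasWeakGrad u v ↔ WeakGradOn unitDisc u v := by
  constructor
  · intro h
    refine ⟨h.locInt, h.locInt_grad, fun φ hφ j => ?_⟩
    rw [← (hφ.partialD j).integral_smul, ← hφ.integral_smul]
    exact h.eqn φ (isDiscTest_iff.2 hφ) j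
  · intro h
    refine ⟨h.locInt, h.locInt_grad, fun φ hφ j => ?_⟩
    rw [isDiscTest_iff] at hφ
    rw [discMeasure, (hφ.partialD j).integral_smul, hφ.integral_smul]
    exact h.eqn φ hφ j

/-- Locally integrable functions on an open set which agree against all test functions agree
almost everywhere. -/
theorem ae_eq_of_forall_isTest [CompleteSpace F] {Ω : Set ℂ} (hΩ : IsOpen Ω) {f g : ℂ → F}
    (hf : LocallyIntegrableOn f Ω volume) (hg : LocallyIntegrableOn g Ω volume)
    (h : ∀ φ : ℂ → ℝ, IsTest Ω φ → ∫ x, φ x • f x = ∫ x, φ x • g x) :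
    f =ᵐ[volume.restrict Ω] g := by
  have := hΩ.ae_eq_zero_of_integral_contDiff_smul_eq_zero (μ := volume) (f := fun x => f x - g x)
    (hf.sub hg) (fun φ h1 h2 h3 => by
      have hφ : IsTest Ω φ := ⟨h1, h2, h3⟩
      simp only [smul_sub]
      rw [integral_sub (hφ.integrable_smul hf) (hφ.integrable_smul hg), h φ hφ, sub_self])
  rw [EventuallyEq, ae_restrict_iff' hΩ.measurableSet]
  filter_upwards [this] with x hx hxΩ using sub_eq_zero.1 (hx hxΩ)

theorem integral_smul_congr {Ω : Set ℂ} {φ : ℂ → ℝ} (hφ : IsTest Ω φ)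
    {f g : ℂ → F} (h : f =ᵐ[volume.restrict Ω] g) : ∫ x, φ x • f x = ∫ x, φ x • g x := by
  rw [← hφ.integral_smul, ← hφ.integral_smul]
  refine integral_congr_ae ?_
  filter_upwards [h] with x hx
  rw [hx]

/-! ### Elementary calculus of weak gradients. -/

namespace WeakGradOn

variable {Ω : Set ℂ} {u u' : ℂ → F} {v v' : Fin 2 → ℂ → F}

theorem mono {Ω' : Set ℂ} (h : WeakGradOn Ω u v) (hs : Ω' ⊆ Ω) : WeakGradOn Ω' u v :=
  ⟨h.locInt.mono_set hs, fun j => (h.locInt_grad j).mono_set hs,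
    fun φ hφ j => h.eqn φ (hφ.mono hs) j⟩

theorem congr (hΩ : IsOpen Ω) (h : WeakGradOn Ω u v) (hu : u =ᵐ[volume.restrict Ω] u')
    (hv : ∀ j, v j =ᵐ[volume.restrict Ω] v' j) : WeakGradOn Ω u' v' := by
  refine ⟨locallyIntegrableOn_congr hΩ h.locInt hu,
    fun j => locallyIntegrableOn_congr hΩ (h.locInt_grad j) (hv j), fun φ hφ j => ?_⟩
  rw [← integral_smul_congr (hφ.partialD j) hu, ← integral_smul_congr hφ (hv j)]
  exact h.eqn φ hφ j

theorem unique [CompleteSpace F] (hΩ : IsOpen Ω) (h : WeakGradOn Ω u v) (h' : WeakGradOn Ω u' v')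
    (hu : u =ᵐ[volume.restrict Ω] u') (j : Fin 2) : v j =ᵐ[volume.restrict Ω] v' j := by
  refine ae_eq_of_forall_isTest hΩ (h.locInt_grad j) (h'.locInt_grad j) fun φ hφ => ?_
  have h1 := h.eqn φ hφ j
  have h2 := h'.eqn φ hφ j
  rw [integral_smul_congr (hφ.partialD j) hu, h2] at h1
  exact (neg_injective h1).symm

theorem add (h : WeakGradOn Ω u v) (h' : WeakGradOn Ω u' v') :
    WeakGradOn Ω (fun x => u x + u' x) (fun j x => v j x + v' j x) := by
  refine ⟨h.locInt.add h'.locInt, fun j => (h.locInt_grad j).add (h'.locInt_grad j),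
    fun φ hφ j => ?_⟩
  simp only [smul_add]
  rw [integral_add ((hφ.partialD j).integrable_smul h.locInt)
    ((hφ.partialD j).integrable_smul h'.locInt), integral_add (hφ.integrable_smul (h.locInt_grad j))
    (hφ.integrable_smul (h'.locInt_grad j)), h.eqn φ hφ j, h'.eqn φ hφ j]
  abel

theorem clm_comp {G : Type*} [NormedAddCommGroup G] [NormedSpace ℝ G] [CompleteSpace F]
    [CompleteSpace G] (hΩ : IsOpen Ω) (L : F →L[ℝ] G)
    (h : WeakGradOn Ω u v) : WeakGradOn Ω (fun x => L (u x)) (fun j x => L (v j x)) := by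
  have key : ∀ {f : ℂ → F}, LocallyIntegrableOn f Ω volume →
      LocallyIntegrableOn (fun x => L (f x)) Ω volume := by
    intro f hf
    rw [locallyIntegrableOn_iff hΩ.isLocallyClosed] at hf ⊢
    intro K hK hKc
    exact L.integrable_comp (hf K hK hKc)
  refine ⟨key h.locInt, fun j => key (h.locInt_grad j), fun φ hφ j => ?_⟩
  have e1 := L.integral_comp_comm ((hφ.partialD j).integrable_smul h.locInt)
  have e2 := L.integral_comp_comm (hφ.integrable_smul (h.locInt_grad j))
  simp only [map_smul] at e1 e2
  rw [e1, e2, h.eqn φ hφ j, map_neg]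

theorem const_smul [CompleteSpace F] (hΩ : IsOpen Ω) (h : WeakGradOn Ω u v) (c : ℝ) :
    WeakGradOn Ω (fun x => c • u x) (fun j x => c • v j x) :=
  h.clm_comp hΩ (c • ContinuousLinearMap.id ℝ F)

theorem sub [CompleteSpace F] (hΩ : IsOpen Ω) (h : WeakGradOn Ω u v) (h' : WeakGradOn Ω u' v') :
    WeakGradOn Ω (fun x => u x - u' x) (fun j x => v j x - v' j x) := by
  simpa [sub_eq_add_neg] using h.add (h'.const_smul hΩ (-1))

/-- A continuously differentiable function has its classical gradient as weak gradient. -/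
theorem of_contDiffOn [CompleteSpace F] (hΩ : IsOpen Ω) (hu : ContDiffOn ℝ (⊤ : ℕ∞) u Ω) :
    WeakGradOn Ω u (fun j => partialD j u) := by
  have h1 : LocallyIntegrableOn u Ω volume := hu.continuousOn.locallyIntegrableOn hΩ.measurableSet
  have h2 : ∀ j, LocallyIntegrableOn (partialD j u) Ω volume := fun j =>
    (contDiffOn_partialD hΩ hu j).continuousOn.locallyIntegrableOn hΩ.measurableSet
  refine ⟨h1, h2, fun φ hφ j => ?_⟩
  rw [← neg_eq_iff_eq_neg]
  symm
  refine integral_smul_fderiv_eq_neg_fderiv_smul_of_integrable (𝕜 := ℝ)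
    ((hφ.partialD j).integrable_smul h1) (hφ.integrable_smul (h2 j)) (hφ.integrable_smul h1)
    (fun x _ => (hφ.smooth.differentiable (by simp)).differentiableAt) ?_
  intro x hx
  exact (hu.contDiffAt (hΩ.mem_nhds (hφ.supp hx))).differentiableAt (by simp)

end WeakGradOn

theorem IsTest.weakGradOn {Ω Ω' : Set ℂ} (hΩ : IsOpen Ω) {φ : ℂ → ℝ} (h : IsTest Ω' φ) :
    WeakGradOn Ω φ (fun j => _root_.partialD j φ) :=
  WeakGradOn.of_contDiffOn hΩ h.smooth.contDiffOn

end Basic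

/-! ### Mollification -/

section Mollify

theorem integrable_indicator_of_locallyIntegrableOn {Ω K : Set ℂ} {F : Type*}
    [NormedAddCommGroup F] {f : ℂ → F}
    (hf : LocallyIntegrableOn f Ω volume) (hK : IsCompact K) (hKΩ : K ⊆ Ω) :
    Integrable (K.indicator f) :=
  (integrable_indicator_iff hK.measurableSet).2 (hf.integrableOn_compact_subset hKΩ hK)

variable {F : Type*} [NormedAddCommGroup F] [NormedSpace ℝ F]

theorem tsupport_partialD_subset (j : Fin 2) (f : ℂ → F) : tsupport (partialD j f) ⊆ tsupport f :=
  tsupport_fderiv_apply_subset ℝ _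

/-- The convolution of `f` with the kernel `k`. -/
noncomputable def mollify (k : ℂ → ℝ) (f : ℂ → F) (x : ℂ) : F := ∫ y, k (x - y) • f y

theorem mollify_eq_convolution (k : ℂ → ℝ) (f : ℂ → F) :
    mollify k f = convolution k f (ContinuousLinearMap.lsmul ℝ ℝ) volume := by
  ext x
  rw [convolution_lsmul_swap]
  rfl

theorem contDiff_mollify {k : ℂ → ℝ} {f : ℂ → F} (hk : IsTest Set.univ k)
    (hf : LocallyIntegrable f volume) : ContDiff ℝ (⊤ : ℕ∞) (mollify k f) := by
  rw [mollify_eq_convolution]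
  exact hk.compact.contDiff_convolution_left _ hk.smooth hf

theorem integrable_mollify_integrand {k : ℂ → ℝ} {f : ℂ → F} (hk : IsTest Set.univ k)
    (hf : LocallyIntegrable f volume) (x : ℂ) : Integrable (fun y => k (x - y) • f y) := by
  have := (hk.compact.convolutionExists_left (ContinuousLinearMap.lsmul ℝ ℝ)
    hk.smooth.continuous hf x).integrable_swap
  simpa using this

theorem partialD_mollify [CompleteSpace F] {k : ℂ → ℝ} {f : ℂ → F} (hk : IsTest Set.univ k)
    (hf : LocallyIntegrable f volume) (j : Fin 2) :
    partialD j (mollify k f) = mollify (partialD j k) f := by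
  ext x
  have h1 : ContDiff ℝ 1 k := hk.smooth.of_le (by exact_mod_cast le_top)
  have h := hk.compact.hasFDerivAt_convolution_left (μ := volume)
    (ContinuousLinearMap.lsmul ℝ ℝ) h1 hf x
  rw [← mollify_eq_convolution] at h
  have hint : Integrable (fun t => ((ContinuousLinearMap.lsmul ℝ ℝ).precompL ℂ)
      (fderiv ℝ k (x - t)) (f t)) := by
    have := ((hk.compact.fderiv ℝ).convolutionExists_left
      ((ContinuousLinearMap.lsmul ℝ ℝ : ℝ →L[ℝ] F →L[ℝ] F).precompL ℂ)
      (h1.continuous_fderiv one_ne_zero) hf x).integrable_swap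
    simpa using this
  rw [partialD, h.fderiv, convolution_eq_swap, ContinuousLinearMap.integral_apply hint]
  simp [mollify, partialD]

theorem isTest_reflect {k : ℂ → ℝ} {Ω : Set ℂ} {x : ℂ} {ε : ℝ} (hk : IsTest Set.univ k)
    (hs : tsupport k ⊆ Metric.closedBall 0 ε) (hx : Metric.closedBall x ε ⊆ Ω) :
    IsTest Ω (fun y => k (x - y)) := by
  refine ⟨hk.smooth.comp (contDiff_const.sub contDiff_id), ?_, ?_⟩
  · exact hk.compact.comp_homeomorph (Homeomorph.subLeft x)
  · refine subset_trans ?_ hx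
    refine closure_minimal ?_ Metric.isClosed_closedBall
    intro y hy
    have : x - y ∈ Metric.closedBall (0 : ℂ) ε := hs (subset_tsupport _ hy)
    simpa [dist_eq_norm, norm_sub_rev] using this

theorem partialD_reflect {k : ℂ → ℝ} (hk : ContDiff ℝ (⊤ : ℕ∞) k) (x y : ℂ) (j : Fin 2) :
    partialD j (fun z => k (x - z)) y = - partialD j k (x - y) := by
  have h : HasFDerivAt (fun z => k (x - z)) ((fderiv ℝ k (x - y)).comp
      (-ContinuousLinearMap.id ℝ ℂ)) y :=
    ((hk.differentiable (by simp)) (x - y)).hasFDerivAt.comp y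
      ((hasFDerivAt_id y).const_sub x)
  rw [partialD, h.fderiv]
  simp [partialD]

/-- The kernel sees only points within ε of x, so a cutoff outside K goes unnoticed at x. This lets
functions that are merely locally integrable in Ω be mollified as if they were integrable on the
plane. -/
theorem mollify_indicator {k : ℂ → ℝ} {f : ℂ → F} {K : Set ℂ} {x : ℂ} {ε : ℝ}
    (hs : tsupport k ⊆ Metric.closedBall 0 ε) (hx : Metric.closedBall x ε ⊆ K) :
    mollify k (K.indicator f) x = mollify k f x := by
  refine integral_congr_ae (Eventually.of_forall fun y => ?_)
  by_cases hy : y ∈ K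
  · simp [hy]
  · have : x - y ∉ tsupport k := by
      intro h
      refine hy (hx ?_)
      simpa [dist_eq_norm, norm_sub_rev] using hs h
    simp [hy, image_eq_zero_of_notMem_tsupport this]

/-- Test the weak equation with y ↦ k(x - y): the sign produced by the reflection cancels the one
from integration by parts. -/
theorem WeakGradOn.mollify_partialD {Ω : Set ℂ} {u : ℂ → F} {v : Fin 2 → ℂ → F}
    (h : WeakGradOn Ω u v) {k : ℂ → ℝ} {x : ℂ} {ε : ℝ} (hk : IsTest Set.univ k)
    (hs : tsupport k ⊆ Metric.closedBall 0 ε) (hx : Metric.closedBall x ε ⊆ Ω) (j : Fin 2) :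
    mollify (partialD j k) u x = mollify k (v j) x := by
  have := h.eqn _ (isTest_reflect hk hs hx) j
  simp only [partialD_reflect hk.smooth, neg_smul, integral_neg, neg_inj] at this
  exact this

/-- A sequence of bump functions shrinking to `0`. -/
noncomputable def bumpSeq (n : ℕ) : ContDiffBump (0 : ℂ) where
  rIn := 1 / (2 * ((n : ℝ) + 1))
  rOut := 1 / ((n : ℝ) + 1)
  rIn_pos := by positivity
  rIn_lt_rOut := by
    apply one_div_lt_one_div_of_lt <;> nlinarith [(Nat.cast_nonneg n : (0 : ℝ) ≤ n)]

/-- The standard mollifying kernels. -/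
noncomputable def stdKernel (n : ℕ) : ℂ → ℝ := (bumpSeq n).normed volume

theorem isTest_stdKernel (n : ℕ) : IsTest Set.univ (stdKernel n) :=
  ⟨(bumpSeq n).contDiff_normed, (bumpSeq n).hasCompactSupport_normed, Set.subset_univ _⟩

theorem tsupport_stdKernel (n : ℕ) :
    tsupport (stdKernel n) = Metric.closedBall 0 (1 / ((n : ℝ) + 1)) :=
  (bumpSeq n).tsupport_normed_eq

theorem tendsto_bumpSeq_rOut : Tendsto (fun n => (bumpSeq n).rOut) atTop (𝓝 0) :=
  tendsto_one_div_add_atTop_nhds_zero_nat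

theorem ae_tendsto_mollify_stdKernel [CompleteSpace F] {f : ℂ → F}
    (hf : LocallyIntegrable f volume) :
    ∀ᵐ x, Tendsto (fun n => mollify (stdKernel n) f x) atTop (𝓝 (f x)) := by
  simp only [mollify_eq_convolution, stdKernel]
  -- 2 is the ratio of outer to inner radius in `bumpSeq`; a bounded ratio is what the Lebesgue
  -- differentiation argument needs.
  refine ContDiffBump.ae_convolution_tendsto_right_of_locallyIntegrable (K := 2)
    tendsto_bumpSeq_rOut (Eventually.of_forall fun n => ?_) hf
  simp only [bumpSeq]
  apply le_of_eq
  field_simp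

/-- Young's inequality in L¹: Tonelli and translation invariance. -/
theorem lintegral_mollify_le {k : ℂ → ℝ} {f : ℂ → F} (hk : IsTest Set.univ k)
    (hf : Integrable f) :
    ∫⁻ x, ‖mollify k f x‖ₑ ≤ (∫⁻ x, ‖k x‖ₑ) * ∫⁻ x, ‖f x‖ₑ := by
  calc ∫⁻ x, ‖mollify k f x‖ₑ ≤ ∫⁻ x, ∫⁻ y, ‖k (x - y)‖ₑ * ‖f y‖ₑ := by
        refine lintegral_mono fun x => ?_
        refine (enorm_integral_le_lintegral_enorm _).trans_eq ?_
        simp [enorm_smul]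
    _ = ∫⁻ y, ∫⁻ x, ‖k (x - y)‖ₑ * ‖f y‖ₑ := by
        refine lintegral_lintegral_swap ?_
        have h1 : Continuous fun p : ℂ × ℂ => k (p.1 - p.2) :=
          hk.smooth.continuous.comp (continuous_fst.sub continuous_snd)
        exact h1.enorm.measurable.aemeasurable.mul hf.aestronglyMeasurable.comp_snd.enorm
    _ = ∫⁻ y, (∫⁻ x, ‖k x‖ₑ) * ‖f y‖ₑ := by
        refine lintegral_congr fun y => ?_
        rw [lintegral_mul_const _ (by
          have : Continuous fun x : ℂ => k (x - y) :=
            hk.smooth.continuous.comp (continuous_id.sub continuous_const)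
          exact this.enorm.measurable)]
        rw [lintegral_sub_right_eq_self (fun x => ‖k x‖ₑ) y]
    _ = _ := lintegral_const_mul'' _ hf.aestronglyMeasurable.enorm

theorem lintegral_enorm_stdKernel (n : ℕ) : ∫⁻ x, ‖stdKernel n x‖ₑ = 1 := by
  have h0 : ∀ x, 0 ≤ stdKernel n x := fun x => (bumpSeq n).nonneg_normed x
  have h1 : Integrable (stdKernel n) :=
    (isTest_stdKernel n).smooth.continuous.integrable_of_hasCompactSupport
      (isTest_stdKernel n).compact
  calc ∫⁻ x, ‖stdKernel n x‖ₑ = ∫⁻ x, ENNReal.ofReal (stdKernel n x) := by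
        refine lintegral_congr fun x => ?_
        rw [Real.enorm_eq_ofReal (h0 x)]
    _ = ENNReal.ofReal (∫ x, stdKernel n x) :=
        (ofReal_integral_eq_lintegral_ofReal h1 (Eventually.of_forall h0)).symm
    _ = 1 := by
        rw [stdKernel, (bumpSeq n).integral_normed]
        simp

theorem tendsto_lintegral_mollify_of_continuous [CompleteSpace F] {h : ℂ → F} (hc : Continuous h)
    (hs : HasCompactSupport h) :
    Tendsto (fun n => ∫⁻ x, ‖mollify (stdKernel n) h x - h x‖ₑ) atTop (𝓝 0) := by
  obtain ⟨M, hM⟩ := hs.exists_bound_of_continuous hc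
  have hM0 : 0 ≤ M := (norm_nonneg _).trans (hM 0)
  -- Every kernel has radius at most 1, so all mollifications vanish off this one compact set and 2M
  -- times its indicator dominates.
  set K : Set ℂ := Metric.cthickening 1 (tsupport h) with hK
  have hKc : IsCompact K := hs.isCompact.cthickening
  have key : ∀ n x, ‖mollify (stdKernel n) h x - h x‖ ≤ K.indicator (fun _ => 2 * M) x := by
    intro n x
    rw [← dist_eq_norm, mollify_eq_convolution]
    refine (bumpSeq n).dist_normed_convolution_le hc.aestronglyMeasurable fun y hy => ?_
    by_cases hx : x ∈ K
    · simp only [hx, Set.indicator_of_mem]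
      rw [dist_eq_norm]
      linarith [norm_sub_le (h y) (h x), hM x, hM y]
    · have h1 : h x = 0 := by
        refine image_eq_zero_of_notMem_tsupport fun hx' => hx ?_
        exact Metric.self_subset_cthickening _ hx'
      have h2 : h y = 0 := by
        refine image_eq_zero_of_notMem_tsupport fun hy' => hx ?_
        refine Metric.mem_cthickening_of_dist_le x y 1 _ hy' ?_
        rw [dist_comm]
        refine (le_of_lt hy).trans ?_
        simp only [bumpSeq]
        rw [div_le_one (by positivity)]
        linarith [(Nat.cast_nonneg n : (0 : ℝ) ≤ n)]
      simp [h1, h2, hx]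
  have hcont : ∀ n, Continuous (mollify (stdKernel n) h) := fun n =>
    (contDiff_mollify (isTest_stdKernel n) hc.locallyIntegrable).continuous
  have := tendsto_lintegral_of_dominated_convergence (μ := volume)
    (F := fun n x => ‖mollify (stdKernel n) h x - h x‖ₑ) (f := fun _ => 0)
    (K.indicator fun _ => ENNReal.ofReal (2 * M))
    (fun n => ((hcont n).sub hc).enorm.measurable)
    (fun n => Eventually.of_forall fun x => by
      change ‖mollify (stdKernel n) h x - h x‖ₑ ≤ _
      rw [← ofReal_norm]
      refine (ENNReal.ofReal_le_ofReal (key n x)).trans_eq ?_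
      by_cases hx : x ∈ K <;> simp [hx])
    (by
      rw [lintegral_indicator hKc.measurableSet, lintegral_const]
      simp only [Measure.restrict_apply_univ]
      exact ENNReal.mul_ne_top ENNReal.ofReal_ne_top hKc.measure_lt_top.ne)
    (Eventually.of_forall fun x => by
      have h1 : Tendsto (fun n => mollify (stdKernel n) h x) atTop (𝓝 (h x)) := by
        simp only [mollify_eq_convolution, stdKernel]
        exact ContDiffBump.convolution_tendsto_right_of_continuous tendsto_bumpSeq_rOut hc x
      have h2 := (h1.sub_const (h x)).enorm
      simpa using h2)
  simpa using this

/-- Compactly supported continuous functions are dense in L¹, and mollification by a kernel of mass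
1 is an L¹ contraction. -/
theorem tendsto_lintegral_mollify [CompleteSpace F] {f : ℂ → F} (hf : Integrable f) :
    Tendsto (fun n => ∫⁻ x, ‖mollify (stdKernel n) f x - f x‖ₑ) atTop (𝓝 0) := by
  rw [ENNReal.tendsto_nhds_zero]
  intro ε hε
  by_cases hε' : ε = ∞
  · simp [hε']
  have h3 : ε / 3 ≠ 0 := (ENNReal.div_pos hε.ne' (by simp)).ne'
  obtain ⟨h, hs, hle, hc, hi⟩ := hf.exists_hasCompactSupport_lintegral_sub_le h3
  have h1 := (ENNReal.tendsto_nhds_zero.1 (tendsto_lintegral_mollify_of_continuous hc hs))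
    (ε / 3) (pos_iff_ne_zero.2 h3)
  filter_upwards [h1] with n hn
  have hk := isTest_stdKernel n
  have hsub : ∀ x, mollify (stdKernel n) f x - f x
      = mollify (stdKernel n) (fun y => f y - h y) x + (mollify (stdKernel n) h x - h x)
        + (h x - f x) := by
    intro x
    have : mollify (stdKernel n) (fun y => f y - h y) x
        = mollify (stdKernel n) f x - mollify (stdKernel n) h x := by
      simp only [mollify, smul_sub]
      exact integral_sub (integrable_mollify_integrand hk hf.locallyIntegrable x)
        (integrable_mollify_integrand hk hi.locallyIntegrable x)
    rw [this]
    abel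
  have m1 : Continuous (mollify (stdKernel n) (fun y => f y - h y)) :=
    (contDiff_mollify hk (hf.sub hi).locallyIntegrable).continuous
  have m2 : Continuous (fun x => mollify (stdKernel n) h x - h x) :=
    (contDiff_mollify hk hi.locallyIntegrable).continuous.sub hc
  calc ∫⁻ x, ‖mollify (stdKernel n) f x - f x‖ₑ
      ≤ ∫⁻ x, (‖mollify (stdKernel n) (fun y => f y - h y) x‖ₑ
          + ‖mollify (stdKernel n) h x - h x‖ₑ) + ‖f x - h x‖ₑ := by
        refine lintegral_mono fun x => ?_
        rw [hsub x]
        refine (enorm_add_le _ _).trans (add_le_add (enorm_add_le _ _) (le_of_eq ?_))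
        rw [← enorm_neg, neg_sub]
    _ = (∫⁻ x, ‖mollify (stdKernel n) (fun y => f y - h y) x‖ₑ)
          + (∫⁻ x, ‖mollify (stdKernel n) h x - h x‖ₑ) + ∫⁻ x, ‖f x - h x‖ₑ := by
        rw [lintegral_add_left (by exact (m1.enorm.add m2.enorm).measurable),
          lintegral_add_left m1.enorm.measurable]
    _ ≤ ε / 3 + ε / 3 + ε / 3 := by
        refine add_le_add (add_le_add ?_ hn) hle
        refine (lintegral_mollify_le hk (hf.sub hi)).trans ?_
        rw [lintegral_enorm_stdKernel, one_mul]
        exact hle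
    _ = ε := ENNReal.add_thirds ε

/-- A compact subset of an open set has a compact neighbourhood of uniform size in it. -/
theorem exists_cthickening_subset {Ω K : Set ℂ} (hΩ : IsOpen Ω) (hK : IsCompact K) (hKΩ : K ⊆ Ω) :
    ∃ K' : Set ℂ, IsCompact K' ∧ K' ⊆ Ω ∧ ∃ δ > 0, ∀ x ∈ K, Metric.closedBall x δ ⊆ K' := by
  obtain ⟨δ, hδ, h⟩ := hK.exists_cthickening_subset_open hΩ hKΩ
  exact ⟨_, hK.cthickening, h, δ, hδ, fun x hx => Metric.closedBall_subset_cthickening hx δ⟩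

theorem eventually_one_div_le {δ : ℝ} (hδ : 0 < δ) : ∀ᶠ n : ℕ in atTop, 1 / ((n : ℝ) + 1) ≤ δ :=
  (tendsto_one_div_add_atTop_nhds_zero_nat.eventually (ge_mem_nhds hδ))

/-- Local approximation of a Sobolev function by smooth functions. -/
theorem WeakGradOn.exists_approx [CompleteSpace F] {Ω K : Set ℂ} (hΩ : IsOpen Ω) {u : ℂ → F}
    {v : Fin 2 → ℂ → F} (h : WeakGradOn Ω u v) (hK : IsCompact K) (hKΩ : K ⊆ Ω) :
    ∃ w : ℕ → ℂ → F, (∀ n, ContDiff ℝ (⊤ : ℕ∞) (w n)) ∧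
      (∀ᵐ x ∂(volume.restrict K), Tendsto (fun n => w n x) atTop (𝓝 (u x))) ∧
      ∀ j, Tendsto (fun n => ∫⁻ x in K, ‖partialD j (w n) x - v j x‖ₑ) atTop (𝓝 0) := by
  obtain ⟨K', hK', hK'Ω, δ, hδ, hball⟩ := exists_cthickening_subset hΩ hK hKΩ
  have hKK' : K ⊆ K' := fun x hx => hball x hx (Metric.mem_closedBall_self hδ.le)
  have hu := integrable_indicator_of_locallyIntegrableOn h.locInt hK' hK'Ω
  refine ⟨fun n => mollify (stdKernel n) (K'.indicator u), fun n =>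
    contDiff_mollify (isTest_stdKernel n) hu.locallyIntegrable, ?_, fun j => ?_⟩
  · rw [ae_restrict_iff' hK.measurableSet]
    filter_upwards [ae_tendsto_mollify_stdKernel hu.locallyIntegrable] with x hx hxK
    rwa [Set.indicator_of_mem (hKK' hxK)] at hx
  · have hv := integrable_indicator_of_locallyIntegrableOn (h.locInt_grad j) hK' hK'Ω
    have h1 := tendsto_lintegral_mollify hv
    refine tendsto_of_tendsto_of_tendsto_of_le_of_le' tendsto_const_nhds h1
      (Eventually.of_forall fun _ => zero_le) ?_
    filter_upwards [eventually_one_div_le hδ] with n hn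
    refine le_trans (le_of_eq ?_) (setLIntegral_le_lintegral K _)
    refine setLIntegral_congr_fun hK.measurableSet fun x hx => ?_
    have hk := isTest_stdKernel n
    have hsup : tsupport (stdKernel n) ⊆ Metric.closedBall 0 δ := by
      rw [tsupport_stdKernel]
      exact Metric.closedBall_subset_closedBall hn
    rw [partialD_mollify hk hu.locallyIntegrable, mollify_indicator
      ((tsupport_partialD_subset _ _).trans hsup) (hball x hx),
      h.mollify_partialD hk hsup ((hball x hx).trans hK'Ω),
      mollify_indicator hsup (hball x hx), Set.indicator_of_mem (hKK' hx)]

end Mollify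

/-! ### The chain and product rule -/

section ChainRule

variable {F : Type*} [NormedAddCommGroup F] [NormedSpace ℝ F]

theorem locallyIntegrableOn_bdd_smul {Ω : Set ℂ} (hΩ : IsOpen Ω) {c : ℂ → ℝ} {f : ℂ → F} {C : ℝ}
    (hc : AEStronglyMeasurable c (volume.restrict Ω)) (hC : ∀ᵐ x ∂(volume.restrict Ω), ‖c x‖ ≤ C)
    (hf : LocallyIntegrableOn f Ω volume) :
    LocallyIntegrableOn (fun x => c x • f x) Ω volume := by
  rw [locallyIntegrableOn_iff hΩ.isLocallyClosed] at hf ⊢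
  intro K hK hKc
  exact (hf K hK hKc).bdd_smul C (hc.mono_set hK) (ae_restrict_of_ae_restrict_of_subset hK hC)

theorem locallyIntegrableOn_smul_bdd {Ω : Set ℂ} (hΩ : IsOpen Ω) {c : ℂ → ℝ} {f : ℂ → F} {C : ℝ}
    (hf : AEStronglyMeasurable f (volume.restrict Ω)) (hC : ∀ᵐ x ∂(volume.restrict Ω), ‖f x‖ ≤ C)
    (hc : LocallyIntegrableOn c Ω volume) :
    LocallyIntegrableOn (fun x => c x • f x) Ω volume := by
  rw [locallyIntegrableOn_iff hΩ.isLocallyClosed] at hc ⊢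
  intro K hK hKc
  exact (hc K hK hKc).smul_bdd C (hf.mono_set hK) (ae_restrict_of_ae_restrict_of_subset hK hC)

theorem IsTest.tendsto_integral_smul {Ω : Set ℂ} {φ : ℂ → ℝ} (hφ : IsTest Ω φ) {h : ℂ → F}
    (hh : LocallyIntegrableOn h Ω volume) {c : ℕ → ℂ → ℝ} {c₀ : ℂ → ℝ} {C : ℝ}
    (hc : ∀ n, Continuous (c n)) (hC : ∀ n x, ‖c n x‖ ≤ C)
    (hlim : ∀ᵐ x, x ∈ tsupport φ → Tendsto (fun n => c n x) atTop (𝓝 (c₀ x))) :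
    Tendsto (fun n => ∫ x, φ x • c n x • h x) atTop (𝓝 (∫ x, φ x • c₀ x • h x)) := by
  have hi := hφ.integrable_smul hh
  have e : ∀ n x, φ x • c n x • h x = c n x • (φ x • h x) := fun n x => smul_comm _ _ _
  refine tendsto_integral_of_dominated_convergence (fun x => C * ‖φ x • h x‖) ?_
    (hi.norm.const_mul C) ?_ ?_
  · intro n
    simp only [e]
    exact (hc n).aestronglyMeasurable.smul hi.aestronglyMeasurable
  · intro n
    refine Eventually.of_forall fun x => ?_
    rw [e, norm_smul]
    exact mul_le_mul_of_nonneg_right (hC n x) (norm_nonneg _)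
  · filter_upwards [hlim] with x hx
    by_cases hxs : x ∈ tsupport φ
    · exact ((hx hxs).smul_const _).const_smul _
    · simp [image_eq_zero_of_notMem_tsupport hxs]

theorem partialD_mul_real {f g : ℂ → ℝ} {x : ℂ} (hf : DifferentiableAt ℝ f x)
    (hg : DifferentiableAt ℝ g x) (j : Fin 2) :
    partialD j (fun y => f y * g y) x = partialD j f x * g x + f x * partialD j g x := by
  simp only [partialD]
  rw [fderiv_fun_mul hf hg]
  simp
  ring

theorem partialD_comp_real {f : ℝ → ℝ} {w : ℂ → ℝ} {x : ℂ} (hf : DifferentiableAt ℝ f (w x))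
    (hw : DifferentiableAt ℝ w x) (j : Fin 2) :
    partialD j (fun y => f (w y)) x = deriv f (w x) * partialD j w x := by
  have := (hf.hasDerivAt.comp_hasFDerivAt x hw.hasFDerivAt).fderiv
  simp only [partialD]
  rw [show (fun y => f (w y)) = f ∘ w from rfl, this]
  simp

/-- Chain and product rule at once. With smooth w_n approximating a, φ f(w_n) is a test function for
the weak gradient of g; then n → ∞. Bounds on f, f' and g replace any higher integrability of ∇a or
∇g. -/
theorem WeakGradOn.comp_smul [CompleteSpace F] {Ω : Set ℂ} (hΩ : IsOpen Ω) {a : ℂ → ℝ}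
    {va : Fin 2 → ℂ → ℝ} {g : ℂ → F} {vg : Fin 2 → ℂ → F} (ha : WeakGradOn Ω a va)
    (hg : WeakGradOn Ω g vg) {M : ℝ} (hM : ∀ᵐ x ∂(volume.restrict Ω), ‖g x‖ ≤ M) {f : ℝ → ℝ}
    (hf : ContDiff ℝ (⊤ : ℕ∞) f) {C : ℝ} (hfC : ∀ t, ‖f t‖ ≤ C) (hfC' : ∀ t, ‖deriv f t‖ ≤ C) :
    WeakGradOn Ω (fun x => f (a x) • g x)
      (fun j x => f (a x) • vg j x + deriv f (a x) • va j x • g x) := by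
  have hf' : Continuous (deriv f) := hf.continuous_deriv (by simp)
  have hva : ∀ j, LocallyIntegrableOn (fun x => va j x • g x) Ω volume := fun j =>
    locallyIntegrableOn_smul_bdd hΩ hg.locInt.aestronglyMeasurable hM (ha.locInt_grad j)
  have mf : ∀ {k : ℝ → ℝ}, Continuous k →
      AEStronglyMeasurable (fun x => k (a x)) (volume.restrict Ω) := fun hk =>
    hk.comp_aestronglyMeasurable ha.locInt.aestronglyMeasurable
  have h1 : ∀ j, LocallyIntegrableOn (fun x => f (a x) • vg j x) Ω volume := fun j =>
    locallyIntegrableOn_bdd_smul hΩ (mf hf.continuous) (Eventually.of_forall fun x => hfC _)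
      (hg.locInt_grad j)
  have h2 : ∀ j, LocallyIntegrableOn (fun x => deriv f (a x) • va j x • g x) Ω volume := fun j =>
    locallyIntegrableOn_bdd_smul hΩ (mf hf') (Eventually.of_forall fun x => hfC' _) (hva j)
  have h0 : LocallyIntegrableOn (fun x => f (a x) • g x) Ω volume :=
    locallyIntegrableOn_bdd_smul hΩ (mf hf.continuous) (Eventually.of_forall fun x => hfC _)
      hg.locInt
  refine ⟨h0, fun j => (h1 j).add (h2 j), fun φ hφ j => ?_⟩
  obtain ⟨w, hw, hwa, hwv⟩ := ha.exists_approx hΩ hφ.compact.isCompact hφ.supp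
  rw [ae_restrict_iff' hφ.compact.isCompact.measurableSet] at hwa
  have hfw : ∀ n, ContDiff ℝ (⊤ : ℕ∞) (fun x => f (w n x)) := fun n => hf.comp (hw n)
  have hcd : ∀ n, Continuous (fun x => deriv f (w n x)) := fun n => hf'.comp (hw n).continuous
  have hpw : ∀ n, Continuous (partialD j (w n)) := fun n => (contDiff_partialD (hw n) j).continuous
  have t1 := (hφ.partialD j).tendsto_integral_smul hg.locInt (c := fun n x => f (w n x))
    (c₀ := fun x => f (a x)) (C := C) (fun n => (hfw n).continuous) (fun n x => hfC _)
    (by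
      filter_upwards [hwa] with x hx hxs
      exact (hf.continuous.tendsto _).comp (hx (tsupport_partialD_subset _ _ hxs)))
  have t2 := hφ.tendsto_integral_smul (hg.locInt_grad j) (c := fun n x => f (w n x))
    (c₀ := fun x => f (a x)) (C := C) (fun n => (hfw n).continuous) (fun n x => hfC _)
    (by
      filter_upwards [hwa] with x hx hxs
      exact (hf.continuous.tendsto _).comp (hx hxs))
  have t3 := hφ.tendsto_integral_smul (hva j) (c := fun n x => deriv f (w n x))
    (c₀ := fun x => deriv f (a x)) (C := C) hcd (fun n x => hfC' _)
    (by
      filter_upwards [hwa] with x hx hxs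
      exact (hf'.tendsto _).comp (hx hxs))
  have iw : ∀ n, LocallyIntegrableOn (fun x => partialD j (w n) x • g x) Ω volume := fun n =>
    hg.locInt.continuousOn_smul hΩ.isLocallyClosed (hpw n).continuousOn
  have iwd : ∀ n, LocallyIntegrableOn
      (fun x => deriv f (w n x) • (partialD j (w n) x • g x - va j x • g x)) Ω volume := fun n =>
    locallyIntegrableOn_bdd_smul hΩ (hcd n).aestronglyMeasurable
      (Eventually.of_forall fun x => hfC' _) ((iw n).sub (hva j))
  obtain ⟨B, hB⟩ := hφ.exists_bound
  -- The error from replacing ∂w_n by ∂a is at most BCM times the L¹ distance of the two on the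
  -- support of φ. Boundedness of g makes L¹ convergence of the gradients enough.
  have t4 : Tendsto (fun n => ∫ x, φ x • deriv f (w n x) •
      (partialD j (w n) x • g x - va j x • g x)) atTop (𝓝 0) := by
    rw [tendsto_zero_iff_enorm_tendsto_zero]
    have hlim := ENNReal.Tendsto.const_mul (a := ENNReal.ofReal (B * (C * M))) (hwv j)
      (Or.inr ENNReal.ofReal_ne_top)
    rw [mul_zero] at hlim
    refine tendsto_of_tendsto_of_tendsto_of_le_of_le tendsto_const_nhds hlim
      (fun _ => zero_le) fun n => ?_
    refine (enorm_integral_le_lintegral_enorm _).trans ?_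
    rw [← lintegral_const_mul' _ _ ENNReal.ofReal_ne_top]
    rw [← lintegral_indicator hφ.compact.isCompact.measurableSet]
    refine lintegral_mono_ae ?_
    rw [ae_restrict_iff' hΩ.measurableSet] at hM
    filter_upwards [hM] with x hx
    by_cases hxs : x ∈ tsupport φ
    · rw [Set.indicator_of_mem hxs, ← ofReal_norm, ← ofReal_norm, ← ENNReal.ofReal_mul']
      · refine ENNReal.ofReal_le_ofReal ?_
        rw [← sub_smul, norm_smul, norm_smul, norm_smul]
        have hx' := hx (hφ.supp hxs)
        have b1 := hB x
        have b2 := hfC' (w n x)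
        have B0 := (norm_nonneg _).trans b1
        have C0 := (norm_nonneg _).trans b2
        calc ‖φ x‖ * (‖deriv f (w n x)‖ * (‖partialD j (w n) x - va j x‖ * ‖g x‖))
            ≤ B * (C * (‖partialD j (w n) x - va j x‖ * M)) := by gcongr
          _ = _ := by ring
      · exact norm_nonneg _
    · simp [image_eq_zero_of_notMem_tsupport hxs]
  have key : ∀ n, ∫ x, partialD j φ x • f (w n x) • g x
      = - (∫ x, φ x • f (w n x) • vg j x) - (∫ x, φ x • deriv f (w n x) • va j x • g x)
        - ∫ x, φ x • deriv f (w n x) • (partialD j (w n) x • g x - va j x • g x) := by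
    intro n
    have hψ : IsTest Ω (fun x => φ x * f (w n x)) := hφ.mul_smooth hΩ (hfw n).contDiffOn
    have e := hg.eqn _ hψ j
    have i1 := (hφ.partialD j).integrable_smul
      (hg.locInt.continuousOn_smul hΩ.isLocallyClosed (hfw n).continuous.continuousOn)
    have i2 := hφ.integrable_smul (iwd n)
    have i3 : Integrable (fun x => φ x • deriv f (w n x) • va j x • g x) :=
      hφ.integrable_smul (locallyIntegrableOn_bdd_smul hΩ (hcd n).aestronglyMeasurable
        (Eventually.of_forall fun x => hfC' _) (hva j))
    have e2 : ∀ x, partialD j (fun x => φ x * f (w n x)) x • g x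
        = partialD j φ x • f (w n x) • g x + (φ x • deriv f (w n x) • va j x • g x
          + φ x • deriv f (w n x) • (partialD j (w n) x • g x - va j x • g x)) := by
      intro x
      rw [partialD_mul_real ((hφ.smooth.differentiable (by simp)) x)
        (((hfw n).differentiable (by simp)) x),
        partialD_comp_real ((hf.differentiable (by simp)) _) (((hw n).differentiable (by simp)) x)]
      module
    have i23 : Integrable (fun x => φ x • deriv f (w n x) • va j x • g x
          + φ x • deriv f (w n x) • (partialD j (w n) x • g x - va j x • g x)) := i3.add i2
    simp only [e2] at e
    rw [integral_add i1 i23, integral_add i3 i2] at e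
    simp only [← smul_eq_mul, smul_assoc] at e
    rw [← sub_eq_zero] at e ⊢
    rw [← e]
    abel
  have lim := ((t2.neg.sub t3).sub t4)
  simp only [← key] at lim
  have := tendsto_nhds_unique t1 lim
  rw [this]
  simp only [smul_add]
  rw [integral_add (hφ.integrable_smul (h1 j)) (hφ.integrable_smul (h2 j))]
  abel

end ChainRule

/-! ### Weyl's lemma -/

section Weyl

/-- A bump is composed with ‖z‖², which is smooth at the origin as ‖z‖ is not; hence the squared
radii. -/
theorem exists_radial_kernel {R : ℝ} (hR : 0 < R) : ∃ (ρ : ℂ → ℝ) (β : ℝ → ℝ),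
    IsTest Set.univ ρ ∧ tsupport ρ ⊆ Metric.closedBall 0 R ∧ (∀ z, ρ z = β ‖z‖) ∧
      ∫ z, ρ z = 1 := by
  have hR2 : 0 < R ^ 2 := by positivity
  let b : ContDiffBump (0 : ℝ) := ⟨R ^ 2 / 2, R ^ 2, by positivity, by linarith⟩
  let ρ₀ : ℂ → ℝ := fun z => b (‖z‖ ^ 2)
  have hsm : ContDiff ℝ (⊤ : ℕ∞) ρ₀ := b.contDiff.comp (contDiff_norm_sq ℝ)
  have hsupp : Function.support ρ₀ ⊆ Metric.closedBall 0 R := by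
    intro z hz
    have h1 : ‖z‖ ^ 2 ∈ Function.support b := hz
    rw [b.support_eq, Metric.mem_ball, dist_zero_right, Real.norm_eq_abs,
      abs_of_nonneg (by positivity)] at h1
    rw [mem_closedBall_zero_iff]
    exact (pow_lt_pow_iff_left₀ (norm_nonneg z) hR.le two_ne_zero).1 h1 |>.le
  have hts : tsupport ρ₀ ⊆ Metric.closedBall 0 R := closure_minimal hsupp Metric.isClosed_closedBall
  have hcs : HasCompactSupport ρ₀ :=
    HasCompactSupport.intro (isCompact_closedBall (0 : ℂ) R) fun x hx => by
      by_contra h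
      exact hx (hsupp h)
  have hpos : 0 < ∫ z, ρ₀ z := by
    refine hsm.continuous.integral_pos_of_hasCompactSupport_nonneg_nonzero hcs
      (fun z => b.nonneg) (x := 0) ?_
    have : b (‖(0 : ℂ)‖ ^ 2) = 1 := b.one_of_mem_closedBall (by simp; exact b.rIn_pos.le)
    change b (‖(0 : ℂ)‖ ^ 2) ≠ 0
    rw [this]
    exact one_ne_zero
  refine ⟨fun z => (∫ w, ρ₀ w)⁻¹ * ρ₀ z, fun t => (∫ w, ρ₀ w)⁻¹ * b (t ^ 2),
    ⟨contDiff_const.mul hsm, hcs.mul_left, Set.subset_univ _⟩,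
    tsupport_mul_subset_right.trans hts, fun z => rfl, ?_⟩
  rw [integral_const_mul, inv_mul_cancel₀ hpos.ne']


variable {F : Type*} [NormedAddCommGroup F] [NormedSpace ℝ F]

/-- `u` is harmonic in `Ω` in the sense of distributions. -/
structure WeaklyHarmonicOn (Ω : Set ℂ) (u : ℂ → F) : Prop where
  locInt : LocallyIntegrableOn u Ω volume
  eqn : ∀ φ : ℂ → ℝ, IsTest Ω φ → ∫ x, (∑ j, partialD j (partialD j φ) x) • u x = 0

theorem WeakGradOn.integral_laplacian {Ω : Set ℂ} {u : ℂ → F} {v : Fin 2 → ℂ → F}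
    (h : WeakGradOn Ω u v) {φ : ℂ → ℝ} (hφ : IsTest Ω φ) :
    ∫ x, (∑ j, partialD j (partialD j φ) x) • u x = - ∫ x, ∑ j, partialD j φ x • v j x := by
  simp only [Finset.sum_smul]
  rw [integral_finsetSum _ fun j _ => ((hφ.partialD j).partialD j).integrable_smul h.locInt,
    integral_finsetSum _ fun j _ => (hφ.partialD j).integrable_smul (h.locInt_grad j),
    ← Finset.sum_neg_distrib]
  exact Finset.sum_congr rfl fun j _ => h.eqn _ (hφ.partialD j) j

theorem WeakGradOn.weaklyHarmonicOn {Ω : Set ℂ} {u : ℂ → F} {v : Fin 2 → ℂ → F}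
    (h : WeakGradOn Ω u v)
    (h0 : ∀ φ, IsTest Ω φ → ∫ x, ∑ j, partialD j φ x • v j x = 0) : WeaklyHarmonicOn Ω u :=
  ⟨h.locInt, fun φ hφ => by rw [h.integral_laplacian hφ, h0 φ hφ, neg_zero]⟩

theorem fderiv_eq_zero_of_partialD {f : ℂ → F} {x : ℂ} (h : ∀ j, partialD j f x = 0) :
    fderiv ℝ f x = 0 := by
  ext z
  have h0 := h 0
  have h1 := h 1
  simp only [partialD, coordDir, Matrix.cons_val_zero, Matrix.cons_val_one] at h0 h1
  have : z = z.re • (1 : ℂ) + z.im • Complex.I := by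
    simp [Complex.re_add_im]
  rw [this, map_add, map_smul, map_smul, h0, h1]
  simp

variable [CompleteSpace F]

/-- Rotating the integration variable does not change a radial convolution. Averaging over all
rotations and exchanging integrals replaces f by its circle averages, which equal f x by the mean
value property. -/
theorem mollify_radial_of_harmonic {ρ : ℂ → ℝ} {β : ℝ → ℝ} {R : ℝ} (hρ : IsTest Set.univ ρ)
    (hs : tsupport ρ ⊆ Metric.closedBall 0 R) (hβ : ∀ z, ρ z = β ‖z‖) (h1 : ∫ z, ρ z = 1)
    {f : ℂ → F} (hf : Continuous f) {x : ℂ}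
    (hx : InnerProductSpace.HarmonicOnNhd f (Metric.closedBall x R)) : mollify ρ f x = f x := by
  have e1 : mollify ρ f x = ∫ y, ρ y • f (x - y) := by
    have := integral_sub_left_eq_self (fun y => ρ y • f (x - y)) volume x
    simp only [sub_sub_cancel] at this
    exact this
  have e2 : ∀ θ : ℝ, ∫ y, ρ y • f (x - Complex.exp (θ * Complex.I) * y) = mollify ρ f x := by
    intro θ
    rw [e1]
    have := (rotation (Circle.exp θ)).measurePreserving.integral_comp
      (rotation (Circle.exp θ)).toHomeomorph.measurableEmbedding (fun y => ρ y • f (x - y))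
    rw [← this]
    refine integral_congr_ae (Eventually.of_forall fun y => ?_)
    simp only [rotation_apply, Circle.coe_exp]
    rw [hβ, hβ, norm_mul, Complex.norm_exp_ofReal_mul_I, one_mul]
  have hK := isCompact_closedBall (0 : ℂ) R
  have hsup : ∀ (k : ℂ → F), ∫ y in Metric.closedBall (0 : ℂ) R, ρ y • k y = ∫ y, ρ y • k y := by
    intro k
    refine setIntegral_eq_integral_of_forall_compl_eq_zero fun y hy => ?_
    rw [image_eq_zero_of_notMem_tsupport (fun h => hy (hs h)), zero_smul]
  have e3 : ∀ y ∈ Metric.closedBall (0 : ℂ) R,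
      ∫ θ in (0 : ℝ)..2 * Real.pi, f (x - Complex.exp (θ * Complex.I) * y)
        = (2 * Real.pi) • f x := by
    intro y hy
    have hy' : |‖y‖| ≤ R := by simpa using hy
    have h := (hx.mono (Metric.closedBall_subset_closedBall hy')).circleAverage_eq
    -- The angle is shifted because x - e^{iθ}y = x + |y| e^{i(θ + arg y + π)}.
    rw [Real.circleAverage_eq_integral_add (y.arg + Real.pi)] at h
    rw [← h, smul_smul, mul_inv_cancel₀ (by positivity), one_smul]
    refine intervalIntegral.integral_congr fun θ _ => ?_
    simp only [circleMap]
    congr 1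
    have := Complex.norm_mul_exp_arg_mul_I y
    rw [show ((θ + (y.arg + Real.pi) : ℝ) : ℂ) * Complex.I
      = θ * Complex.I + (y.arg * Complex.I + Real.pi * Complex.I) by push_cast; ring,
      Complex.exp_add, Complex.exp_add, Complex.exp_pi_mul_I]
    linear_combination (Complex.exp (θ * Complex.I)) * this
  have hint : Integrable (Function.uncurry fun (θ : ℝ) (y : ℂ) =>
      ρ y • f (x - Complex.exp (θ * Complex.I) * y))
      ((volume.restrict (Set.Icc 0 (2 * Real.pi))).prod
        (volume.restrict (Metric.closedBall (0 : ℂ) R))) := by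
    rw [Measure.prod_restrict]
    refine ContinuousOn.integrableOn_compact (isCompact_Icc.prod hK) (Continuous.continuousOn ?_)
    have := hρ.smooth.continuous
    simp only [Function.uncurry_def]
    fun_prop
  have sw := integral_integral_swap hint
  have l1 : ∫ θ in Set.Icc 0 (2 * Real.pi), (∫ y in Metric.closedBall (0 : ℂ) R,
      ρ y • f (x - Complex.exp (θ * Complex.I) * y)) = (2 * Real.pi) • mollify ρ f x := by
    simp only [hsup (fun y => f (x - Complex.exp (_ * Complex.I) * y)), e2]
    rw [setIntegral_const]
    simp [measureReal_def, Real.pi_pos.le]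
  have l2 : ∫ y in Metric.closedBall (0 : ℂ) R, (∫ θ in Set.Icc 0 (2 * Real.pi),
      ρ y • f (x - Complex.exp (θ * Complex.I) * y)) = (2 * Real.pi) • f x := by
    rw [setIntegral_congr_fun (g := fun y => ρ y • ((2 * Real.pi) • f x)) hK.measurableSet]
    · rw [hsup (fun _ => (2 * Real.pi) • f x), integral_smul_const, h1, one_smul]
    · intro y hy
      simp only
      rw [integral_smul, integral_Icc_eq_integral_Ioc, ← intervalIntegral.integral_of_le
        (by positivity), e3 y hy]
  rw [l1, l2] at sw
  exact smul_right_injective F (by positivity : (2 * Real.pi) ≠ 0) sw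

/-- Both derivatives of the Laplacian fall on the kernel, and y ↦ k(x - y) is an admissible test
function for u. -/
theorem WeaklyHarmonicOn.harmonicAt_mollify {Ω K : Set ℂ} {u : ℂ → F} (h : WeaklyHarmonicOn Ω u)
    (hK : IsCompact K) (hKΩ : K ⊆ Ω) {k : ℂ → ℝ} {ε : ℝ} (hk : IsTest Set.univ k)
    (hs : tsupport k ⊆ Metric.closedBall 0 ε) {x : ℂ}
    (hx : ∀ᶠ y in 𝓝 x, Metric.closedBall y ε ⊆ K) :
    InnerProductSpace.HarmonicAt (mollify k (K.indicator u)) x := by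
  have hu := (integrable_indicator_of_locallyIntegrableOn h.locInt hK hKΩ).locallyIntegrable
  have hsm := contDiff_mollify hk hu
  refine ⟨hsm.contDiffAt.of_le two_le_smooth, ?_⟩
  filter_upwards [hx] with y hy
  rw [laplacian_eq_partialD (hsm.contDiffAt.of_le two_le_smooth)]
  have hkj : ∀ j, IsTest Set.univ (partialD j k) := fun j => hk.partialD j
  simp only [partialD_mollify hk hu, partialD_mollify (hkj _) hu]
  have hts : ∀ j, tsupport (partialD j (partialD j k)) ⊆ Metric.closedBall 0 ε := fun j =>
    ((tsupport_partialD_subset _ _).trans (tsupport_partialD_subset _ _)).trans hs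
  simp only [mollify_indicator (hts _) hy, Pi.zero_apply]
  have ht := isTest_reflect hk hs (hy.trans hKΩ)
  have e := h.eqn _ ht
  have e2 : ∀ j z, partialD j (partialD j (fun w => k (y - w))) z
      = partialD j (partialD j k) (y - z) := by
    intro j z
    have : partialD j (fun w => k (y - w)) = fun w => (fun t => - partialD j k t) (y - w) := by
      ext w
      rw [partialD_reflect hk.smooth]
    have h3 : partialD j (fun t => -partialD j k t) (y - z) = - partialD j (partialD j k) (y - z) := by
      change fderiv ℝ (fun t => -partialD j k t) (y - z) (coordDir j) = _
      rw [fderiv_fun_neg]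
      rfl
    rw [this, partialD_reflect (hkj j).smooth.neg, h3, neg_neg]
  simp only [e2, Finset.sum_smul] at e
  rw [integral_finsetSum] at e
  · exact e
  · intro j _
    have ht2 : IsTest Ω (fun z => partialD j (partialD j k) (y - z)) :=
      isTest_reflect ((hkj j).partialD j) (hts j) (hy.trans hKΩ)
    exact ht2.integrable_smul h.locInt

/-- The mollifications w_n of u are harmonic, hence fixed by convolution with a radial kernel ρ of
fixed size. As n → ∞ the identity ρ * w_n = w_n becomes ρ * u = u almost everywhere, and ρ * u is
smooth and harmonic. -/
theorem WeaklyHarmonicOn.exists_local_harmonic {Ω : Set ℂ} (hΩ : IsOpen Ω) {u : ℂ → F}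
    (h : WeaklyHarmonicOn Ω u) {x₀ : ℂ} (hx₀ : x₀ ∈ Ω) :
    ∃ r > 0, Metric.ball x₀ r ⊆ Ω ∧ ∃ k : ℂ → F, ContDiff ℝ (⊤ : ℕ∞) k ∧
      InnerProductSpace.HarmonicOnNhd k (Metric.ball x₀ r) ∧
      u =ᵐ[volume.restrict (Metric.ball x₀ r)] k := by
  obtain ⟨s, hs, hsΩ⟩ := Metric.nhds_basis_closedBall.mem_iff.1 (hΩ.mem_nhds hx₀)
  -- Room for x within R of x₀, for the kernel ρ of radius R about x, and for a further kernel of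
  -- radius R that keeps w_n harmonic there.
  obtain ⟨R, hR, rfl⟩ : ∃ R > 0, s = 4 * R := ⟨s / 4, by positivity, by ring⟩
  set K := Metric.closedBall x₀ (4 * R) with hKdef
  have hK : IsCompact K := isCompact_closedBall _ _
  have hu := integrable_indicator_of_locallyIntegrableOn h.locInt hK hsΩ
  obtain ⟨ρ, β, hρ, hρs, hβ, hρ1⟩ := exists_radial_kernel hR
  obtain ⟨B, hB⟩ := hρ.exists_bound
  have sub : ∀ {y : ℂ}, y ∈ Metric.ball x₀ (3 * R) → Metric.closedBall y R ⊆ K := by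
    intro y hy z hz
    rw [hKdef, Metric.mem_closedBall]
    have := dist_triangle z y x₀
    rw [Metric.mem_ball] at hy
    rw [Metric.mem_closedBall] at hz
    linarith
  have ev : ∀ {y : ℂ}, y ∈ Metric.ball x₀ (3 * R) →
      ∀ᶠ z in 𝓝 y, Metric.closedBall z R ⊆ K := fun hy => by
    filter_upwards [Metric.isOpen_ball.mem_nhds hy] with z hz using sub hz
  refine ⟨R, hR, (Metric.ball_subset_closedBall.trans
    (Metric.closedBall_subset_closedBall (by linarith))).trans hsΩ,
    mollify ρ (K.indicator u), contDiff_mollify hρ hu.locallyIntegrable, fun y hy =>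
      h.harmonicAt_mollify hK hsΩ hρ hρs (ev (Metric.ball_subset_ball (by linarith) hy)), ?_⟩
  rw [EventuallyEq, ae_restrict_iff' Metric.isOpen_ball.measurableSet]
  filter_upwards [ae_tendsto_mollify_stdKernel hu.locallyIntegrable] with x hx hxR
  have hxK : x ∈ K := (Metric.ball_subset_closedBall.trans
    (Metric.closedBall_subset_closedBall (by linarith))) hxR
  rw [Set.indicator_of_mem hxK] at hx
  set w : ℕ → ℂ → F := fun n => mollify (stdKernel n) (K.indicator u) with hw
  have hwc : ∀ n, ContDiff ℝ (⊤ : ℕ∞) (w n) := fun n =>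
    contDiff_mollify (isTest_stdKernel n) hu.locallyIntegrable
  have hfix : ∀ᶠ n in atTop, mollify ρ (w n) x = w n x := by
    filter_upwards [eventually_one_div_le hR] with n hn
    refine mollify_radial_of_harmonic hρ hρs hβ hρ1 (hwc n).continuous fun y hy => ?_
    refine h.harmonicAt_mollify hK hsΩ (isTest_stdKernel n) (ε := R) ?_ (ev ?_)
    · rw [tsupport_stdKernel]
      exact Metric.closedBall_subset_closedBall hn
    · rw [Metric.mem_ball] at hxR ⊢
      rw [Metric.mem_closedBall] at hy
      linarith [dist_triangle y x x₀]
  have hlim : Tendsto (fun n => mollify ρ (w n) x) atTop (𝓝 (mollify ρ (K.indicator u) x)) := by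
    rw [tendsto_iff_edist_tendsto_0]
    have hl := ENNReal.Tendsto.const_mul (a := ENNReal.ofReal B)
      (tendsto_lintegral_mollify hu) (Or.inr ENNReal.ofReal_ne_top)
    rw [mul_zero] at hl
    refine tendsto_of_tendsto_of_tendsto_of_le_of_le tendsto_const_nhds hl
      (fun _ => zero_le) fun n => ?_
    have : mollify ρ (w n) x - mollify ρ (K.indicator u) x
        = ∫ y, ρ (x - y) • (w n y - K.indicator u y) := by
      simp only [mollify, smul_sub]
      exact (integral_sub (integrable_mollify_integrand hρ (hwc n).continuous.locallyIntegrable x)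
        (integrable_mollify_integrand hρ hu.locallyIntegrable x)).symm
    simp only
    rw [edist_eq_enorm_sub, this]
    refine (enorm_integral_le_lintegral_enorm _).trans ?_
    rw [← lintegral_const_mul' _ _ ENNReal.ofReal_ne_top]
    refine lintegral_mono fun y => ?_
    rw [enorm_smul]
    gcongr
    rw [← ofReal_norm]
    exact ENNReal.ofReal_le_ofReal (hB _)
  have := hlim.congr' hfix
  exact tendsto_nhds_unique hx this

/-- Local continuous representatives of a function can be glued together. -/
theorem exists_glue {Y : Type*} [TopologicalSpace Y] [T2Space Y] {Ω : Set ℂ} {u : ℂ → Y}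
    (r : ℂ → ℝ) (k : ℂ → ℂ → Y) (hr : ∀ x ∈ Ω, 0 < r x)
    (hk : ∀ x ∈ Ω, ContinuousOn (k x) (Metric.ball x (r x)))
    (hae : ∀ x ∈ Ω, u =ᵐ[volume.restrict (Metric.ball x (r x))] k x) :
    ∃ h : ℂ → Y, (∀ᵐ x, x ∈ Ω → u x = h x) ∧
      ∀ x ∈ Ω, ∀ y ∈ Metric.ball x (r x), y ∈ Ω → h y = k x y := by
  have key : ∀ x ∈ Ω, ∀ y ∈ Metric.ball x (r x), y ∈ Ω → k y y = k x y := by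
    intro x hx y hy hyΩ
    refine Measure.eqOn_open_of_ae_eq (μ := volume)
      (U := Metric.ball x (r x) ∩ Metric.ball y (r y)) ?_
      (Metric.isOpen_ball.inter Metric.isOpen_ball) ((hk y hyΩ).mono Set.inter_subset_right)
      ((hk x hx).mono Set.inter_subset_left) ⟨hy, Metric.mem_ball_self (hr y hyΩ)⟩
    have h1 := ae_restrict_of_ae_restrict_of_subset
      (Set.inter_subset_left (s := Metric.ball x (r x)) (t := Metric.ball y (r y))) (hae x hx)
    have h2 := ae_restrict_of_ae_restrict_of_subset
      (Set.inter_subset_right (s := Metric.ball x (r x)) (t := Metric.ball y (r y))) (hae y hyΩ)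
    filter_upwards [h1, h2] with z hz1 hz2
    rw [← hz1, ← hz2]
  -- Each point uses its own local representative; `key` shows that the choice is immaterial. The
  -- exceptional set is locally null, hence null.
  refine ⟨fun y => k y y, ?_, key⟩
  rw [ae_iff]
  refine measure_null_of_locally_null _ fun x hx => ?_
  simp only [Set.mem_ofPred_eq, Classical.not_imp] at hx
  refine ⟨_, inter_mem_nhdsWithin _ (Metric.ball_mem_nhds x (hr x hx.1)), ?_⟩
  have h1 := hae x hx.1
  rw [EventuallyEq, ae_restrict_iff' Metric.isOpen_ball.measurableSet, ae_iff] at h1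
  refine measure_mono_null ?_ h1
  rintro y ⟨hy1, hy2⟩
  simp only [Set.mem_ofPred_eq, Classical.not_imp] at hy1 ⊢
  exact ⟨hy2, fun e => hy1.2 (e.trans (key x hx.1 y hy2 hy1.1).symm)⟩

/-- **Weyl's lemma**. -/
theorem WeaklyHarmonicOn.exists_harmonic {Ω : Set ℂ} (hΩ : IsOpen Ω) {u : ℂ → F}
    (h : WeaklyHarmonicOn Ω u) :
    ∃ k : ℂ → F, ContDiffOn ℝ (⊤ : ℕ∞) k Ω ∧ InnerProductSpace.HarmonicOnNhd k Ω ∧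
      u =ᵐ[volume.restrict Ω] k := by
  have := fun x (hx : x ∈ Ω) => h.exists_local_harmonic hΩ hx
  choose! r hr hsub k hsm hk hae using this
  obtain ⟨H, hH, hHk⟩ := exists_glue (Ω := Ω) (u := u) r k hr
    (fun x hx => (hsm x hx).continuous.continuousOn) hae
  have hev : ∀ x ∈ Ω, H =ᶠ[𝓝 x] k x := fun x hx => by
    filter_upwards [Metric.ball_mem_nhds x (hr x hx)] with y hy
    exact hHk x hx y hy (hsub x hx hy)
  refine ⟨H, fun x hx => ?_, fun x hx => ?_, ?_⟩
  · exact ((hsm x hx).contDiffAt.congr_of_eventuallyEq (hev x hx)).contDiffWithinAt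
  · exact (InnerProductSpace.harmonicAt_congr_nhds (hev x hx)).2
      (hk x hx x (Metric.mem_ball_self (hr x hx)))
  · rw [EventuallyEq, ae_restrict_iff' hΩ.measurableSet]
    exact hH

/-- A function with vanishing weak gradient on a connected open set is constant. -/
theorem WeakGradOn.ae_const {Ω : Set ℂ} (hΩ : IsOpen Ω) (hc : IsPreconnected Ω) {u : ℂ → F}
    {v : Fin 2 → ℂ → F} (h : WeakGradOn Ω u v) (h0 : ∀ j, v j =ᵐ[volume.restrict Ω] 0) :
    ∃ c : F, u =ᵐ[volume.restrict Ω] fun _ => c := by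
  -- Zero gradient is trivially weakly harmonic, so Weyl's lemma reduces the claim to a smooth
  -- function with vanishing derivative.
  have h' : WeakGradOn Ω u (fun _ => 0) := h.congr hΩ (ae_eq_refl _) h0
  obtain ⟨k, hk, -, hae⟩ := (h'.weaklyHarmonicOn (fun φ _ => by simp)).exists_harmonic hΩ
  have hz : ∀ x ∈ Ω, ∀ j, partialD j k x = 0 := by
    intro x hx j
    have := (WeakGradOn.of_contDiffOn hΩ hk).unique hΩ h' hae.symm j
    exact Measure.eqOn_open_of_ae_eq this hΩ (contDiffOn_partialD hΩ hk j).continuousOn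
      continuousOn_const hx
  obtain ⟨c, hc⟩ := hΩ.exists_is_const_of_fderiv_eq_zero (𝕜 := ℝ) hc
    (hk.differentiableOn (by simp)) (fun x hx => fderiv_eq_zero_of_partialD (hz x hx))
  refine ⟨c, hae.trans ?_⟩
  filter_upwards [ae_restrict_mem hΩ.measurableSet] with x hx using hc x hx

end Weyl

/-! ### Sobolev functions vanishing on the boundary of the disc -/

section Annulus

/-- The annulus `r < |z| < 1`. -/
def annulus (r : ℝ) : Set ℂ := Metric.ball 0 1 \ Metric.closedBall 0 r

theorem isOpen_annulus (r : ℝ) : IsOpen (annulus r) :=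
  Metric.isOpen_ball.sdiff Metric.isClosed_closedBall

theorem annulus_subset (r : ℝ) : annulus r ⊆ unitDisc := Set.sdiff_subset

theorem mem_annulus {r : ℝ} {z : ℂ} : z ∈ annulus r ↔ r < ‖z‖ ∧ ‖z‖ < 1 := by
  simp [annulus, and_comm]

theorem lintegral_annulus_eq {r : ℝ} (hr : 0 ≤ r) (f : ℂ → ℝ≥0∞) :
    ∫⁻ z in annulus r, f z = ∫⁻ p in Set.Ioo r 1 ×ˢ Set.Ioo (-Real.pi) Real.pi,
      ENNReal.ofReal p.1 * f (Complex.polarCoord.symm p) := by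
  rw [← lintegral_indicator (isOpen_annulus r).measurableSet,
    ← Complex.lintegral_comp_polarCoord_symm, polarCoord_target]
  have hm : MeasurableSet (Set.Ioo r 1 ×ˢ Set.Ioo (-Real.pi) Real.pi) :=
    measurableSet_Ioo.prod measurableSet_Ioo
  have hm' : MeasurableSet (Set.Ioi (0 : ℝ) ×ˢ Set.Ioo (-Real.pi) Real.pi) :=
    measurableSet_Ioi.prod measurableSet_Ioo
  rw [← lintegral_indicator hm, ← lintegral_indicator hm']
  refine lintegral_congr fun p => ?_
  by_cases hp : p ∈ Set.Ioi (0 : ℝ) ×ˢ Set.Ioo (-Real.pi) Real.pi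
  · have h0 : 0 < p.1 := hp.1
    have hn : ‖Complex.polarCoord.symm p‖ = p.1 := by
      rw [Complex.norm_polarCoord_symm, abs_of_pos h0]
    rw [Set.indicator_of_mem hp]
    by_cases hp1 : p.1 ∈ Set.Ioo r 1
    · rw [Set.indicator_of_mem, Set.indicator_of_mem, smul_eq_mul]
      · exact ⟨hp1, hp.2⟩
      · rw [mem_annulus, hn]
        exact hp1
    · rw [Set.indicator_of_notMem, Set.indicator_of_notMem, smul_zero]
      · exact fun h => hp1 h.1
      · rw [mem_annulus, hn]
        exact hp1
  · rw [Set.indicator_of_notMem hp, Set.indicator_of_notMem]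
    exact fun h => hp ⟨hr.trans_lt h.1.1, h.2⟩

theorem measurable_polar_integrand {f : ℂ → ℝ≥0∞} (hf : Measurable f) :
    Measurable fun p : ℝ × ℝ => ENNReal.ofReal p.1 * f (Complex.polarCoord.symm p) := by
  refine (ENNReal.measurable_ofReal.comp measurable_fst).mul (hf.comp ?_)
  have : Continuous fun p : ℝ × ℝ => Complex.polarCoord.symm p := by
    simp only [Complex.polarCoord_symm_apply]
    fun_prop
  exact this.measurable

theorem lintegral_annulus_radius {r : ℝ} (hr : 0 ≤ r) {f : ℂ → ℝ≥0∞} (hf : Measurable f) :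
    ∫⁻ z in annulus r, f z = ∫⁻ ρ in Set.Ioo r 1, ∫⁻ θ in Set.Ioo (-Real.pi) Real.pi,
      ENNReal.ofReal ρ * f (Complex.polarCoord.symm (ρ, θ)) := by
  rw [lintegral_annulus_eq hr, Measure.volume_eq_prod, ← Measure.prod_restrict,
    lintegral_prod _ (measurable_polar_integrand hf).aemeasurable]

theorem lintegral_annulus_angle {r : ℝ} (hr : 0 ≤ r) {f : ℂ → ℝ≥0∞} (hf : Measurable f) :
    ∫⁻ z in annulus r, f z = ∫⁻ θ in Set.Ioo (-Real.pi) Real.pi, ∫⁻ ρ in Set.Ioo r 1,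
      ENNReal.ofReal ρ * f (Complex.polarCoord.symm (ρ, θ)) := by
  rw [lintegral_annulus_eq hr, Measure.volume_eq_prod, ← Measure.prod_restrict,
    lintegral_prod_symm _ (measurable_polar_integrand hf).aemeasurable]

theorem fderiv_apply_eq {f : ℂ → ℝ} (x z : ℂ) :
    fderiv ℝ f x z = z.re * partialD 0 f x + z.im * partialD 1 f x := by
  have : z = z.re • (1 : ℂ) + z.im • Complex.I := by simp [Complex.re_add_im]
  conv_lhs => rw [this]
  rw [map_add, map_smul, map_smul]
  simp [partialD, coordDir]

/-- Poincaré inequality on an annulus adjacent to the boundary. -/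
theorem IsTest.lintegral_annulus_le {φ : ℂ → ℝ} (hφ : IsTest unitDisc φ) {r : ℝ} (hr : 0 ≤ r) :
    ∫⁻ z in annulus r, ‖φ z‖ₑ
      ≤ ENNReal.ofReal (1 - r) * ∫⁻ z in annulus r, (‖_root_.partialD 0 φ z‖ₑ + ‖_root_.partialD 1 φ z‖ₑ) := by
  have hm0 : Measurable fun z => ‖φ z‖ₑ := hφ.smooth.continuous.enorm.measurable
  have hc : ∀ j, Continuous (_root_.partialD j φ) := fun j =>
    (hφ.partialD j).smooth.continuous
  have hm1 : Measurable fun z => ‖_root_.partialD 0 φ z‖ₑ + ‖_root_.partialD 1 φ z‖ₑ :=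
    ((hc 0).enorm.add (hc 1).enorm).measurable
  rw [lintegral_annulus_angle hr hm0, lintegral_annulus_angle hr hm1,
    ← lintegral_const_mul' _ _ ENNReal.ofReal_ne_top]
  refine lintegral_mono fun θ => ?_
  set e : ℂ := Real.cos θ + Real.sin θ * Complex.I with he
  have hen : ‖e‖ = 1 := by
    rw [he, Complex.ofReal_cos, Complex.ofReal_sin, Complex.norm_cos_add_sin_mul_I]
  have hre : e.re = Real.cos θ := by simp [he, -Complex.ofReal_cos, -Complex.ofReal_sin]
  have him : e.im = Real.sin θ := by simp [he, -Complex.ofReal_cos, -Complex.ofReal_sin]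
  have hpol : ∀ s : ℝ, Complex.polarCoord.symm (s, θ) = s * e := fun s => by
    rw [Complex.polarCoord_symm_apply]
  simp only [hpol]
  have hder : ∀ s : ℝ, HasDerivAt (fun t : ℝ => φ (t * e)) (fderiv ℝ φ (s * e) e) s := by
    intro s
    have h1 : HasDerivAt (fun t : ℝ => (t : ℂ) * e) e s := by
      simpa using (Complex.ofRealCLM.hasDerivAt (x := s)).mul_const e
    exact ((hφ.smooth.differentiable (by simp)) _).hasFDerivAt.comp_hasDerivAt s h1
  have hcd : Continuous fun s : ℝ => fderiv ℝ φ (s * e) e := by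
    have := hφ.smooth.continuous_fderiv (by simp)
    fun_prop
  have h1 : φ ((1 : ℝ) * e) = 0 := hφ.eq_zero (by simp [unitDisc, hen])
  have hbd : ∀ s : ℝ, ‖fderiv ℝ φ (s * e) e‖ₑ
      ≤ ‖_root_.partialD 0 φ (s * e)‖ₑ + ‖_root_.partialD 1 φ (s * e)‖ₑ := by
    intro s
    rw [fderiv_apply_eq, hre, him]
    refine (enorm_add_le _ _).trans (add_le_add ?_ ?_)
    · rw [enorm_mul]
      refine mul_le_of_le_one_left' ?_
      rw [← ofReal_norm, ENNReal.ofReal_le_one]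
      exact Real.abs_cos_le_one θ
    · rw [enorm_mul]
      refine mul_le_of_le_one_left' ?_
      rw [← ofReal_norm, ENNReal.ofReal_le_one]
      exact Real.abs_sin_le_one θ
  set J := ∫⁻ s in Set.Ioo r 1, ENNReal.ofReal s *
    (‖_root_.partialD 0 φ (s * e)‖ₑ + ‖_root_.partialD 1 φ (s * e)‖ₑ) with hJ
  -- Integrate inward from the boundary, where φ = 0. As ρ ≤ s, the weight moves inside the integral
  -- as s, the polar Jacobian. The bound J is independent of ρ, so integrating over (r, 1) yields
  -- the factor 1 - r.
  have hpt : ∀ ρ ∈ Set.Ioo r 1, ENNReal.ofReal ρ * ‖φ (ρ * e)‖ₑ ≤ J := by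
    intro ρ hρ
    have hint := intervalIntegral.integral_eq_sub_of_hasDerivAt (fun s _ => hder s)
      (hcd.intervalIntegrable ρ 1)
    rw [h1, zero_sub] at hint
    have h2 : ‖φ (ρ * e)‖ₑ ≤ ∫⁻ s in Set.Ioc ρ 1, ‖fderiv ℝ φ (s * e) e‖ₑ := by
      rw [← enorm_neg, ← hint, intervalIntegral.integral_of_le hρ.2.le]
      exact enorm_integral_le_lintegral_enorm _
    calc ENNReal.ofReal ρ * ‖φ (ρ * e)‖ₑ
        ≤ ENNReal.ofReal ρ * ∫⁻ s in Set.Ioc ρ 1, ‖fderiv ℝ φ (s * e) e‖ₑ := by gcongr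
      _ = ∫⁻ s in Set.Ioc ρ 1, ENNReal.ofReal ρ * ‖fderiv ℝ φ (s * e) e‖ₑ :=
        (lintegral_const_mul' _ _ ENNReal.ofReal_ne_top).symm
      _ = ∫⁻ s in Set.Ioo ρ 1, ENNReal.ofReal ρ * ‖fderiv ℝ φ (s * e) e‖ₑ := by
        rw [restrict_Ioo_eq_restrict_Ioc]
      _ ≤ ∫⁻ s in Set.Ioo ρ 1, ENNReal.ofReal s *
          (‖_root_.partialD 0 φ (s * e)‖ₑ + ‖_root_.partialD 1 φ (s * e)‖ₑ) := by
        refine setLIntegral_mono' measurableSet_Ioo fun s hs => ?_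
        exact mul_le_mul' (ENNReal.ofReal_le_ofReal hs.1.le) (hbd s)
      _ ≤ J := lintegral_mono_set (Set.Ioo_subset_Ioo_left hρ.1.le)
  calc ∫⁻ ρ in Set.Ioo r 1, ENNReal.ofReal ρ * ‖φ (ρ * e)‖ₑ
      ≤ ∫⁻ ρ in Set.Ioo r 1, J := setLIntegral_mono' measurableSet_Ioo hpt
    _ = ENNReal.ofReal (1 - r) * J := by
      rw [setLIntegral_const, Real.volume_Ioo, mul_comm]

/-- `b ∈ W^{1,1}_0(D²)` with weak gradient `vb`. -/
structure MemSobolevZeroOne (b : ℂ → ℝ) (vb : Fin 2 → ℂ → ℝ) : Prop where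
  weakGrad : WeakGradOn unitDisc b vb
  approx : ∃ φ : ℕ → ℂ → ℝ, (∀ n, IsTest unitDisc (φ n)) ∧
    Tendsto (fun n => ∫⁻ x in unitDisc, ‖φ n x - b x‖ₑ) atTop (𝓝 0) ∧
    ∀ j, Tendsto (fun n => ∫⁻ x in unitDisc, ‖partialD j (φ n) x - vb j x‖ₑ) atTop (𝓝 0)

namespace MemSobolevZeroOne

variable {b : ℂ → ℝ} {vb : Fin 2 → ℂ → ℝ}

/-- The inequality for test functions passes to L¹ limits. Its factor 1 - r later cancels the width
of the annulus in the averaged Poisson bound. -/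
theorem lintegral_annulus_le (h : MemSobolevZeroOne b vb) {r : ℝ} (hr : 0 ≤ r) :
    ∫⁻ z in annulus r, ‖b z‖ₑ
      ≤ ENNReal.ofReal (1 - r) * ∫⁻ z in annulus r, (‖vb 0 z‖ₑ + ‖vb 1 z‖ₑ) := by
  obtain ⟨φ, hφ, h0, hj⟩ := h.approx
  have mb : AEStronglyMeasurable b (volume.restrict (annulus r)) :=
    h.weakGrad.locInt.aestronglyMeasurable.mono_set (annulus_subset r)
  have mv : ∀ j, AEStronglyMeasurable (vb j) (volume.restrict (annulus r)) := fun j =>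
    (h.weakGrad.locInt_grad j).aestronglyMeasurable.mono_set (annulus_subset r)
  have mφ : ∀ n, Continuous (φ n) := fun n => (hφ n).smooth.continuous
  have mp : ∀ n j, Continuous (partialD j (φ n)) := fun n j => ((hφ n).partialD j).smooth.continuous
  set δ := fun n => ∫⁻ x in unitDisc, ‖φ n x - b x‖ₑ with hδ
  set ε := fun j n => ∫⁻ x in unitDisc, ‖partialD j (φ n) x - vb j x‖ₑ with hε
  set V := ∫⁻ z in annulus r, (‖vb 0 z‖ₑ + ‖vb 1 z‖ₑ) with hV
  have key : ∀ n, ∫⁻ z in annulus r, ‖b z‖ₑ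
      ≤ ENNReal.ofReal (1 - r) * (V + (ε 0 n + ε 1 n)) + δ n := by
    intro n
    calc ∫⁻ z in annulus r, ‖b z‖ₑ
        ≤ ∫⁻ z in annulus r, (‖φ n z‖ₑ + ‖φ n z - b z‖ₑ) := by
          refine lintegral_mono fun z => ?_
          rw [show b z = φ n z - (φ n z - b z) by ring]
          refine enorm_sub_le.trans_eq ?_
          simp
      _ = (∫⁻ z in annulus r, ‖φ n z‖ₑ) + ∫⁻ z in annulus r, ‖φ n z - b z‖ₑ :=
          lintegral_add_left (mφ n).enorm.measurable _
      _ ≤ ENNReal.ofReal (1 - r) * (V + (ε 0 n + ε 1 n)) + δ n := by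
          refine add_le_add (((hφ n).lintegral_annulus_le hr).trans ?_)
            (lintegral_mono_set (annulus_subset r))
          gcongr
          calc ∫⁻ z in annulus r, (‖partialD 0 (φ n) z‖ₑ + ‖partialD 1 (φ n) z‖ₑ)
              ≤ ∫⁻ z in annulus r, ((‖vb 0 z‖ₑ + ‖vb 1 z‖ₑ) + (‖partialD 0 (φ n) z - vb 0 z‖ₑ
                  + ‖partialD 1 (φ n) z - vb 1 z‖ₑ)) := by
                refine lintegral_mono fun z => ?_
                have : ∀ j, ‖partialD j (φ n) z‖ₑ
                    ≤ ‖vb j z‖ₑ + ‖partialD j (φ n) z - vb j z‖ₑ := fun j => by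
                  conv_lhs => rw [show partialD j (φ n) z
                    = vb j z + (partialD j (φ n) z - vb j z) by ring]
                  exact enorm_add_le _ _
                refine (add_le_add (this 0) (this 1)).trans_eq ?_
                abel
            _ = V + ((∫⁻ z in annulus r, ‖partialD 0 (φ n) z - vb 0 z‖ₑ)
                  + ∫⁻ z in annulus r, ‖partialD 1 (φ n) z - vb 1 z‖ₑ) := by
                rw [lintegral_add_left' (f := fun z => ‖vb 0 z‖ₑ + ‖vb 1 z‖ₑ)
                  ((mv 0).enorm.add (mv 1).enorm), lintegral_add_left'
                  (f := fun z => ‖partialD 0 (φ n) z - vb 0 z‖ₑ)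
                  (((mp n 0).aestronglyMeasurable.sub (mv 0)).enorm)]
            _ ≤ V + (ε 0 n + ε 1 n) := by
                gcongr
                · exact lintegral_mono_set (annulus_subset r)
                · exact lintegral_mono_set (annulus_subset r)
  have lim : Tendsto (fun n => ENNReal.ofReal (1 - r) * (V + (ε 0 n + ε 1 n)) + δ n) atTop
      (𝓝 (ENNReal.ofReal (1 - r) * (V + (0 + 0)) + 0)) :=
    (ENNReal.Tendsto.const_mul (tendsto_const_nhds.add ((hj 0).add (hj 1)))
      (Or.inr ENNReal.ofReal_ne_top)).add h0
  simpa using ge_of_tendsto' lim key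

theorem lintegral_grad_ne_top (h : MemSobolevZeroOne b vb) :
    ∫⁻ z in unitDisc, (‖vb 0 z‖ₑ + ‖vb 1 z‖ₑ) ≠ ∞ := by
  obtain ⟨φ, hφ, h0, hj⟩ := h.approx
  have key : ∀ j, ∫⁻ z in unitDisc, ‖vb j z‖ₑ < ∞ := by
    intro j
    obtain ⟨n, hn⟩ := ((hj j).eventually (gt_mem_nhds zero_lt_one)).exists
    have hc : Integrable (partialD j (φ n)) :=
      ((hφ n).partialD j).smooth.continuous.integrable_of_hasCompactSupport
        ((hφ n).partialD j).compact
    have hm := ((hφ n).partialD j).smooth.continuous.enorm.measurable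
    calc ∫⁻ z in unitDisc, ‖vb j z‖ₑ
        ≤ ∫⁻ z in unitDisc, (‖partialD j (φ n) z‖ₑ + ‖partialD j (φ n) z - vb j z‖ₑ) := by
          refine lintegral_mono fun z => ?_
          rw [show vb j z = partialD j (φ n) z - (partialD j (φ n) z - vb j z) by ring]
          refine enorm_sub_le.trans_eq ?_
          simp
      _ = (∫⁻ z in unitDisc, ‖partialD j (φ n) z‖ₑ)
          + ∫⁻ z in unitDisc, ‖partialD j (φ n) z - vb j z‖ₑ := lintegral_add_left hm _
      _ < ∞ := ENNReal.add_lt_top.2 ⟨(setLIntegral_le_lintegral _ _).trans_lt hc.2,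
          hn.trans ENNReal.one_lt_top⟩
  rw [lintegral_add_left' (h.weakGrad.locInt_grad 0).aestronglyMeasurable.enorm]
  exact (ENNReal.add_lt_top.2 ⟨key 0, key 1⟩).ne

end MemSobolevZeroOne

theorem tendsto_volume_annulus :
    Tendsto (fun n : ℕ => volume (annulus (1 - 1 / ((n : ℝ) + 1)))) atTop (𝓝 0) := by
  have hanti : Antitone fun n : ℕ => annulus (1 - 1 / ((n : ℝ) + 1)) := by
    intro m n hmn z hz
    rw [mem_annulus] at hz ⊢
    refine ⟨lt_of_le_of_lt ?_ hz.1, hz.2⟩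
    have := Nat.one_div_le_one_div (α := ℝ) hmn
    linarith
  have := tendsto_measure_iInter_atTop (μ := volume)
    (fun n => (isOpen_annulus _).measurableSet.nullMeasurableSet) hanti
    ⟨0, (measure_mono (annulus_subset _)).trans_lt measure_ball_lt_top |>.ne⟩
  have he : ⋂ n : ℕ, annulus (1 - 1 / ((n : ℝ) + 1)) = ∅ := by
    rw [Set.eq_empty_iff_forall_notMem]
    intro z hz
    rw [Set.mem_iInter] at hz
    have h1 := (mem_annulus.1 (hz 0)).2
    obtain ⟨n, hn⟩ := (eventually_one_div_le (sub_pos.2 h1)).exists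
    have := (mem_annulus.1 (hz n)).1
    linarith
  rwa [he, measure_empty] at this

/-- The Poisson formula bounds a harmonic function by its circle averages. -/
theorem enorm_le_lintegral_circle {h : ℂ → ℝ} {w : ℂ} {r ρ : ℝ} (hwr : ‖w‖ < r) (hrρ : r < ρ)
    (hρ : ρ < 1) (hh : InnerProductSpace.HarmonicOnNhd h (Metric.closedBall 0 ρ)) :
    ‖h w‖ₑ ≤ ENNReal.ofReal (1 / (r - ‖w‖) ^ 2) *
      ∫⁻ θ in Set.Ioo (-Real.pi) Real.pi, ‖h (Complex.polarCoord.symm (ρ, θ))‖ₑ := by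
  have hρ0 : 0 < ρ := (norm_nonneg w).trans_lt (hwr.trans hrρ)
  have hw : w ∈ Metric.ball (0 : ℂ) ρ := by
    rw [mem_ball_zero_iff]
    linarith
  have e := InnerProductSpace.HarmonicOnNhd.circleAverage_poissonKernel_smul hh hw
  rw [Real.circleAverage_eq_integral_add (-Real.pi),
    intervalIntegral.integral_comp_add_right
      (fun θ => (poissonKernel 0 w • h) (circleMap 0 ρ θ))] at e
  rw [show (0 : ℝ) + -Real.pi = -Real.pi by ring,
    show 2 * Real.pi + -Real.pi = Real.pi by ring,
    intervalIntegral.integral_of_le (by linarith [Real.pi_pos]),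
    ← restrict_Ioo_eq_restrict_Ioc] at e
  rw [← e, enorm_smul]
  have hpi : ‖(2 * Real.pi)⁻¹‖ₑ ≤ 1 := by
    rw [← ofReal_norm, ENNReal.ofReal_le_one, norm_inv, Real.norm_eq_abs,
      abs_of_pos (by positivity)]
    exact inv_le_one_of_one_le₀ (by nlinarith [Real.pi_gt_three])
  refine (mul_le_of_le_one_left' hpi).trans ?_
  refine (enorm_integral_le_lintegral_enorm _).trans ?_
  rw [← lintegral_const_mul' _ _ ENNReal.ofReal_ne_top]
  refine lintegral_mono fun θ => ?_
  have hpc : Complex.polarCoord.symm (ρ, θ) = circleMap 0 ρ θ := by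
    rw [Complex.polarCoord_symm_apply, circleMap_zero, Complex.exp_mul_I]
    push_cast
    rfl
  simp only
  rw [hpc, Pi.smul_apply', enorm_smul]
  gcongr
  rw [← ofReal_norm]
  refine ENNReal.ofReal_le_ofReal ?_
  have hn : ‖circleMap 0 ρ θ‖ = ρ := by simp [abs_of_pos hρ0]
  rw [poissonKernel_def]
  simp only [sub_zero, hn]
  have h1 : ρ - ‖w‖ ≤ ‖circleMap 0 ρ θ - w‖ := by
    have := norm_sub_norm_le (circleMap 0 ρ θ) w
    rwa [hn] at this
  have h2 : 0 < r - ‖w‖ := by linarith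
  rw [Real.norm_eq_abs, abs_of_nonneg
    (div_nonneg (by nlinarith [norm_nonneg w]) (by positivity))]
  -- The numerator ρ² - |w|² is at most 1 as ρ < 1. Using r < ρ in the denominator makes the bound
  -- uniform in ρ.
  refine div_le_div₀ zero_le_one (by nlinarith [norm_nonneg w]) (by positivity) ?_
  exact pow_le_pow_left₀ h2.le (by linarith) 2

/-- Uniqueness for the Dirichlet problem in `W^{1,1}_0`. -/
theorem MemSobolevZeroOne.ae_eq_zero {b : ℂ → ℝ} {vb : Fin 2 → ℂ → ℝ} (h : MemSobolevZeroOne b vb)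
    (h0 : ∀ φ, IsTest unitDisc φ → ∫ x, ∑ j, partialD j φ x • vb j x = 0) :
    b =ᵐ[volume.restrict unitDisc] 0 := by
  obtain ⟨k, hk, hkh, hae⟩ := (h.weakGrad.weaklyHarmonicOn h0).exists_harmonic isOpen_unitDisc
  refine hae.trans ?_
  filter_upwards [ae_restrict_mem measurableSet_unitDisc] with w hw
  have hw1 : ‖w‖ < 1 := by simpa [unitDisc] using hw
  obtain ⟨r₀, hr₀, hr₀1⟩ := exists_between hw1
  set C := ENNReal.ofReal (1 / (r₀ - ‖w‖) ^ 2) with hC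
  set V := fun n : ℕ => ∫⁻ z in annulus (1 - 1 / ((n : ℝ) + 1)), (‖vb 0 z‖ₑ + ‖vb 1 z‖ₑ) with hV
  have hVlim : Tendsto V atTop (𝓝 0) := by
    have e : ∀ n : ℕ, V n = ∫⁻ z in annulus (1 - 1 / ((n : ℝ) + 1)),
        (‖vb 0 z‖ₑ + ‖vb 1 z‖ₑ) ∂(volume.restrict unitDisc) := by
      intro n
      rw [Measure.restrict_restrict (isOpen_annulus _).measurableSet,
        Set.inter_eq_left.2 (annulus_subset _)]
    rw [funext e]
    refine tendsto_setLIntegral_zero h.lintegral_grad_ne_top ?_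
    refine tendsto_of_tendsto_of_tendsto_of_le_of_le tendsto_const_nhds tendsto_volume_annulus
      (fun _ => zero_le) fun n => Measure.restrict_apply_le _ _
  -- Integrating the Poisson bound over radii in (1 - d, 1) gives (d/2)|k(w)| ≤ C∫|b| over the
  -- annulus, and Poincaré bounds the right side by C d ∫(|∂₁b| + |∂₂b|). The factors d cancel.
  have key : ∀ᶠ n in atTop, ‖k w‖ₑ ≤ 2 * C * V n := by
    -- The first condition keeps all radii beyond r₀; the second keeps the polar weight ρ above 1/2.
    filter_upwards [eventually_one_div_le (sub_pos.2 hr₀1),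
      eventually_one_div_le (show (0 : ℝ) < 1 / 2 by norm_num)] with n hn hn2
    set d : ℝ := 1 / ((n : ℝ) + 1) with hd
    have hd0 : 0 < d := by positivity
    set r := 1 - d with hr
    set f : ℂ → ℝ≥0∞ := (annulus r).indicator fun z => ‖k z‖ₑ with hf
    have hfm : Measurable f := by
      have hc : ContinuousOn (fun z => ‖k z‖ₑ) (annulus r) :=
        (hk.continuousOn.mono (annulus_subset r)).enorm
      classical
      have := ContinuousOn.measurable_piecewise hc (continuousOn_const (c := (0 : ℝ≥0∞)))
        (isOpen_annulus r).measurableSet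
      rwa [hf, ← Set.piecewise_eq_indicator]
    have hfb : ∫⁻ z in annulus r, f z = ∫⁻ z in annulus r, ‖b z‖ₑ := by
      have h1 := ae_restrict_of_ae_restrict_of_subset (annulus_subset r) hae
      refine lintegral_congr_ae ?_
      filter_upwards [h1, ae_restrict_mem (isOpen_annulus r).measurableSet] with z hz1 hz2
      rw [hf, Set.indicator_of_mem hz2, hz1]
    have hlow : ‖k w‖ₑ * (ENNReal.ofReal (1 / 2) * ENNReal.ofReal d)
        ≤ C * ∫⁻ z in annulus r, f z := by
      rw [lintegral_annulus_radius (by linarith) hfm,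
        ← lintegral_const_mul' _ _ ENNReal.ofReal_ne_top]
      calc ‖k w‖ₑ * (ENNReal.ofReal (1 / 2) * ENNReal.ofReal d)
          = ∫⁻ ρ in Set.Ioo r 1, ENNReal.ofReal (1 / 2) * ‖k w‖ₑ := by
            rw [setLIntegral_const, Real.volume_Ioo, hr, sub_sub_cancel]
            ring
        _ ≤ _ := by
            refine setLIntegral_mono' measurableSet_Ioo fun ρ hρ => ?_
            rw [lintegral_const_mul' _ _ ENNReal.ofReal_ne_top, mul_left_comm]
            refine mul_le_mul' (ENNReal.ofReal_le_ofReal (by linarith [hρ.1])) ?_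
            have hpo := enorm_le_lintegral_circle (h := k) (w := w) (r := r₀) (ρ := ρ) hr₀
              (by linarith [hρ.1]) hρ.2 fun z hz => hkh z (by
                simp only [unitDisc, mem_ball_zero_iff]
                exact (mem_closedBall_zero_iff.1 hz).trans_lt hρ.2)
            refine hpo.trans_eq ?_
            congr 1
            refine lintegral_congr fun θ => ?_
            rw [hf, Set.indicator_of_mem]
            rw [mem_annulus, Complex.norm_polarCoord_symm]
            simp only
            rw [abs_of_pos (by linarith [hρ.1])]
            exact hρ
    have hup := h.lintegral_annulus_le (r := r) (by linarith)
    rw [hfb] at hlow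
    have h3 := hlow.trans (mul_le_mul_right hup C)
    rw [hr, sub_sub_cancel] at h3
    have hd1 : ENNReal.ofReal d ≠ 0 := by simpa using hd0
    have h4 : ENNReal.ofReal d * (‖k w‖ₑ * ENNReal.ofReal (1 / 2))
        ≤ ENNReal.ofReal d * (C * V n) := by
      calc _ = ‖k w‖ₑ * (ENNReal.ofReal (1 / 2) * ENNReal.ofReal d) := by ring
        _ ≤ _ := h3
        _ = _ := by ring
    have h5 := (ENNReal.mul_le_mul_iff_right hd1 ENNReal.ofReal_ne_top).1 h4
    have h6 : (2 : ℝ≥0∞) * ENNReal.ofReal (1 / 2) = 1 := by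
      rw [← ENNReal.ofReal_ofNat, ← ENNReal.ofReal_mul (by norm_num)]
      norm_num
    calc ‖k w‖ₑ = 2 * ENNReal.ofReal (1 / 2) * ‖k w‖ₑ := by rw [h6, one_mul]
      _ = 2 * (‖k w‖ₑ * ENNReal.ofReal (1 / 2)) := by ring
      _ ≤ 2 * (C * V n) := by gcongr
      _ = 2 * C * V n := by ring
  have hlim : Tendsto (fun n => 2 * C * V n) atTop (𝓝 0) := by
    have := ENNReal.Tendsto.const_mul (a := 2 * C) hVlim
      (Or.inr (ENNReal.mul_ne_top (by simp) ENNReal.ofReal_ne_top))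
    rwa [mul_zero] at this
  have := ge_of_tendsto hlim key
  simpa using this

end Annulus

/-! ### Density of test functions for the Dirichlet norm -/

section Density

/-- Poincaré on the annulus of inner radius 0, which is the disc without a null set. -/
theorem lintegral_enorm_disc_le {φ : ℂ → ℝ} (hφ : IsTest unitDisc φ) :
    ∫⁻ z in unitDisc, ‖φ z‖ₑ ≤ ∫⁻ z in unitDisc, (‖partialD 0 φ z‖ₑ + ‖partialD 1 φ z‖ₑ) := by
  have h := hφ.lintegral_annulus_le le_rfl
  have e : volume.restrict (annulus 0) = volume.restrict unitDisc := by
    refine Measure.restrict_congr_set ?_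
    rw [annulus, Metric.closedBall_zero]
    exact sdiff_null_ae_eq_self (measure_singleton 0)
  simpa [e] using h

theorem lintegral_enorm_sub_le_add {μ : Measure ℂ} {f g : ℂ → ℝ} (hf : AEStronglyMeasurable f μ) :
    ∫⁻ x, ‖f x - g x‖ₑ ∂μ ≤ (∫⁻ x, ‖f x‖ₑ ∂μ) + ∫⁻ x, ‖g x‖ₑ ∂μ := by
  rw [← lintegral_add_left' hf.enorm]
  exact lintegral_mono fun x => enorm_sub_le

theorem weakGradOn_const {F : Type*} [NormedAddCommGroup F] [NormedSpace ℝ F] [CompleteSpace F]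
    {Ω : Set ℂ} (hΩ : IsOpen Ω) (c : F) : WeakGradOn Ω (fun _ => c) (fun _ _ => 0) := by
  have h := WeakGradOn.of_contDiffOn hΩ (contDiffOn_const (c := c))
  have e : (fun j => partialD j fun _ : ℂ => c) = fun _ _ => 0 := by
    ext j x
    simp [partialD]
  rwa [e] at h

theorem MemSobolevZeroOne.sub {b b' : ℂ → ℝ} {vb vb' : Fin 2 → ℂ → ℝ}
    (h : MemSobolevZeroOne b vb) (h' : MemSobolevZeroOne b' vb') :
    MemSobolevZeroOne (fun x => b x - b' x) (fun j x => vb j x - vb' j x) := by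
  refine ⟨h.weakGrad.sub isOpen_unitDisc h'.weakGrad, ?_⟩
  obtain ⟨φ, hφ, h0, hj⟩ := h.approx
  obtain ⟨φ', hφ', h0', hj'⟩ := h'.approx
  have key : ∀ {p p' : ℕ → ℂ → ℝ} {u u' : ℂ → ℝ}, (∀ n, Continuous (p n)) →
      LocallyIntegrableOn u unitDisc volume →
      Tendsto (fun n => ∫⁻ x in unitDisc, ‖p n x - u x‖ₑ) atTop (𝓝 0) →
      Tendsto (fun n => ∫⁻ x in unitDisc, ‖p' n x - u' x‖ₑ) atTop (𝓝 0) →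
      Tendsto (fun n => ∫⁻ x in unitDisc, ‖(p n x - p' n x) - (u x - u' x)‖ₑ) atTop (𝓝 0) := by
    intro p p' u u' hp hu h1 h2
    have h3 := h1.add h2
    rw [add_zero] at h3
    refine tendsto_of_tendsto_of_tendsto_of_le_of_le tendsto_const_nhds h3
      (fun _ => zero_le) fun n => ?_
    have := lintegral_enorm_sub_le_add (f := fun x => p n x - u x) (g := fun x => p' n x - u' x)
      ((hp n).aestronglyMeasurable.sub hu.aestronglyMeasurable)
    refine le_trans (le_of_eq (lintegral_congr fun x => ?_)) this
    congr 1
    ring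
  refine ⟨fun n x => φ n x - φ' n x, fun n => ⟨(hφ n).smooth.sub (hφ' n).smooth, ?_, ?_⟩, ?_, ?_⟩
  · exact (hφ n).compact.sub (hφ' n).compact
  · exact (tsupport_sub (φ n) (φ' n)).trans (Set.union_subset (hφ n).supp (hφ' n).supp)
  · exact key (fun n => (hφ n).smooth.continuous) h.weakGrad.locInt h0 h0'
  · intro j
    have e : ∀ n x, partialD j (fun x => φ n x - φ' n x) x
        = partialD j (φ n) x - partialD j (φ' n) x := by
      intro n x
      simp only [partialD]
      rw [fderiv_fun_sub (((hφ n).smooth.differentiable (by simp)) x)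
        (((hφ' n).smooth.differentiable (by simp)) x)]
      rfl
    simp only [e]
    exact key (fun n => ((hφ n).partialD j).smooth.continuous) (h.weakGrad.locInt_grad j)
      (hj j) (hj' j)

theorem MemSobolevZeroOne.congr_grad {b : ℂ → ℝ} {vb vb' : Fin 2 → ℂ → ℝ}
    (h : MemSobolevZeroOne b vb) (h' : WeakGradOn unitDisc b vb') : MemSobolevZeroOne b vb' := by
  refine ⟨h', ?_⟩
  obtain ⟨φ, hφ, h0, hj⟩ := h.approx
  refine ⟨φ, hφ, h0, fun j => ?_⟩
  have e := h.weakGrad.unique isOpen_unitDisc h' (ae_eq_refl _) j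
  refine (hj j).congr fun n => lintegral_congr_ae ?_
  filter_upwards [e] with x hx
  rw [hx]

/-- The space of square integrable vector fields on the disc. -/
abbrev DiscL2 : Type := PiLp 2 fun _ : Fin 2 => Lp ℝ 2 discMeasure

/-- A square integrable vector field as an element of the Hilbert space. -/
noncomputable def toDiscL2 (Y : Fin 2 → ℂ → ℝ) (hY : ∀ j, MemLp (Y j) 2 discMeasure) : DiscL2 :=
  WithLp.toLp 2 fun j => (hY j).toLp (Y j)

theorem integrable_mul_discMeasure {f g : ℂ → ℝ} (hf : MemLp f 2 discMeasure)
    (hg : MemLp g 2 discMeasure) : Integrable (fun x => f x * g x) discMeasure :=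
  hf.integrable_mul hg

theorem inner_toDiscL2 {Y Z : Fin 2 → ℂ → ℝ} (hY : ∀ j, MemLp (Y j) 2 discMeasure)
    (hZ : ∀ j, MemLp (Z j) 2 discMeasure) :
    inner ℝ (toDiscL2 Y hY) (toDiscL2 Z hZ) = ∫ x, ∑ j, Y j x * Z j x ∂discMeasure := by
  rw [PiLp.inner_apply, integral_finsetSum _ fun j _ => integrable_mul_discMeasure (hY j) (hZ j)]
  refine Finset.sum_congr rfl fun j _ => ?_
  rw [L2.inner_def]
  refine integral_congr_ae ?_
  filter_upwards [(hY j).coeFn_toLp, (hZ j).coeFn_toLp] with x h1 h2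
  simp only [toDiscL2]
  rw [h1, h2]
  exact mul_comm _ _

theorem IsTest.memLp_partialD {φ : ℂ → ℝ} (hφ : IsTest unitDisc φ) (j : Fin 2) (p : ℝ≥0∞) :
    MemLp (_root_.partialD j φ) p discMeasure :=
  ((hφ.partialD j).smooth.continuous.memLp_of_hasCompactSupport (hφ.partialD j).compact).restrict _

/-- The gradients of test functions. -/
noncomputable def testGradients : Submodule ℝ DiscL2 where
  carrier := {w | ∃ (φ : ℂ → ℝ) (hφ : IsTest unitDisc φ),
    w = toDiscL2 (fun j => partialD j φ) fun j => hφ.memLp_partialD j 2}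
  zero_mem' := by
    refine ⟨fun _ => 0, ⟨contDiff_const, HasCompactSupport.zero, by simp⟩, ?_⟩
    ext j : 1
    simp only [toDiscL2, PiLp.zero_apply]
    symm
    rw [Lp.ext_iff]
    refine (MemLp.coeFn_toLp _).trans ?_
    filter_upwards [Lp.coeFn_zero ℝ 2 discMeasure] with x hx
    rw [hx]
    simp [partialD]
  add_mem' := by
    rintro _ _ ⟨φ, hφ, rfl⟩ ⟨ψ, hψ, rfl⟩
    refine ⟨fun x => φ x + ψ x, ⟨hφ.smooth.add hψ.smooth, hφ.compact.add hψ.compact,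
      (tsupport_add φ ψ).trans (Set.union_subset hφ.supp hψ.supp)⟩, ?_⟩
    ext j : 1
    simp only [toDiscL2, PiLp.add_apply]
    rw [← MemLp.toLp_add]
    congr 1
    ext x
    simp only [partialD]
    rw [fderiv_fun_add ((hφ.smooth.differentiable (by simp)) x)
        ((hψ.smooth.differentiable (by simp)) x)]
    rfl
  smul_mem' := by
    rintro c _ ⟨φ, hφ, rfl⟩
    refine ⟨fun x => c * φ x, ⟨contDiff_const.mul hφ.smooth, hφ.compact.mul_left,
      tsupport_mul_subset_right.trans hφ.supp⟩, ?_⟩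
    ext j : 1
    simp only [toDiscL2, PiLp.smul_apply]
    rw [← MemLp.toLp_const_smul]
    congr 1
    ext x
    simp only [partialD]
    rw [fderiv_const_mul ((hφ.smooth.differentiable (by simp)) x)]
    rfl

/-- An `L¹` limit of gradients of test functions is the gradient of an element of `W^{1,1}_0`. -/
theorem exists_memSobolevZeroOne_of_tendsto {φ : ℕ → ℂ → ℝ} (hφ : ∀ n, IsTest unitDisc (φ n))
    {P : Fin 2 → ℂ → ℝ} (hP : ∀ j, Integrable (P j) discMeasure)
    (hlim : ∀ j, Tendsto (fun n => ∫⁻ x in unitDisc, ‖partialD j (φ n) x - P j x‖ₑ) atTop (𝓝 0)) :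
    ∃ w : ℂ → ℝ, MemSobolevZeroOne w P := by
  have hi : ∀ n, MemLp (φ n) 1 discMeasure := fun n =>
    ((hφ n).smooth.continuous.memLp_of_hasCompactSupport (hφ n).compact).restrict _
  set ε := fun n => (∫⁻ x in unitDisc, ‖partialD 0 (φ n) x - P 0 x‖ₑ)
    + ∫⁻ x in unitDisc, ‖partialD 1 (φ n) x - P 1 x‖ₑ with hε
  have hε0 : Tendsto ε atTop (𝓝 0) := by simpa using (hlim 0).add (hlim 1)
  have hcd : ∀ n j, Continuous (partialD j (φ n)) := fun n j =>
    ((hφ n).partialD j).smooth.continuous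
  -- By Poincaré on the disc, L¹ convergence of the gradients makes the functions themselves Cauchy
  -- in L¹.
  have hd : ∀ n m, edist ((hi n).toLp (φ n)) ((hi m).toLp (φ m)) ≤ ε n + ε m := by
    intro n m
    rw [Lp.edist_toLp_toLp, eLpNorm_one_eq_lintegral_enorm]
    have ht : IsTest unitDisc (fun x => φ n x - φ m x) :=
      ⟨(hφ n).smooth.sub (hφ m).smooth, (hφ n).compact.sub (hφ m).compact,
        (tsupport_sub (φ n) (φ m)).trans (Set.union_subset (hφ n).supp (hφ m).supp)⟩
    refine (lintegral_enorm_disc_le ht).trans ?_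
    have e : ∀ j x, partialD j (fun x => φ n x - φ m x) x
        = partialD j (φ n) x - partialD j (φ m) x := by
      intro j x
      simp only [partialD]
      rw [fderiv_fun_sub (((hφ n).smooth.differentiable (by simp)) x)
        (((hφ m).smooth.differentiable (by simp)) x)]
      rfl
    have hs : ∀ j, ∫⁻ x in unitDisc, ‖partialD j (φ n) x - partialD j (φ m) x‖ₑ
        ≤ (∫⁻ x in unitDisc, ‖partialD j (φ n) x - P j x‖ₑ)
          + ∫⁻ x in unitDisc, ‖partialD j (φ m) x - P j x‖ₑ := by
      intro j
      have := lintegral_enorm_sub_le_add (f := fun x => partialD j (φ n) x - P j x)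
        (g := fun x => partialD j (φ m) x - P j x)
        ((hcd n j).aestronglyMeasurable.sub (hP j).aestronglyMeasurable)
      refine le_trans (le_of_eq (lintegral_congr fun x => ?_)) this
      congr 1
      ring
    simp only [e]
    rw [lintegral_add_left (f := fun z => ‖partialD 0 (φ n) z - partialD 0 (φ m) z‖ₑ)
      (((hcd n 0).sub (hcd m 0)).enorm.measurable)]
    refine (add_le_add (hs 0) (hs 1)).trans_eq ?_
    simp only [hε]
    ring
  have hcau : CauchySeq fun n => (hi n).toLp (φ n) := by
    rw [EMetric.cauchySeq_iff]
    intro δ hδ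
    have hδ2 : (0 : ℝ≥0∞) < δ / 2 := ENNReal.half_pos hδ.ne'
    obtain ⟨N, hN⟩ := eventually_atTop.1 (hε0.eventually (gt_mem_nhds hδ2))
    refine ⟨N, fun m hm n hn => (hd m n).trans_lt ?_⟩
    calc ε m + ε n < δ / 2 + δ / 2 := ENNReal.add_lt_add (hN m hm) (hN n hn)
      _ = δ := ENNReal.add_halves δ
  obtain ⟨w, hw⟩ := cauchySeq_tendsto_of_complete hcau
  have hw0 : Tendsto (fun n => ∫⁻ x in unitDisc, ‖φ n x - w x‖ₑ) atTop (𝓝 0) := by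
    rw [tendsto_iff_edist_tendsto_0] at hw
    refine hw.congr fun n => ?_
    have : edist ((hi n).toLp (φ n)) w = eLpNorm (φ n - ⇑w) 1 discMeasure := by
      rw [Lp.edist_def]
      refine eLpNorm_congr_ae ?_
      filter_upwards [(hi n).coeFn_toLp] with x hx
      simp [hx]
    rw [this, eLpNorm_one_eq_lintegral_enorm]
    rfl
  have hwi : Integrable (⇑w) discMeasure := L1.integrable_coeFn w
  have key : ∀ {ψ : ℂ → ℝ} {f : ℂ → ℝ} {p : ℕ → ℂ → ℝ}, IsTest unitDisc ψ →
      Integrable f discMeasure → (∀ n, IsTest unitDisc (p n)) →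
      Tendsto (fun n => ∫⁻ x in unitDisc, ‖p n x - f x‖ₑ) atTop (𝓝 0) →
      Tendsto (fun n => ∫ x, ψ x • p n x) atTop (𝓝 (∫ x, ψ x • f x)) := by
    intro ψ f p hψ hf hp hl
    obtain ⟨B, hB⟩ := hψ.exists_bound
    simp only [← hψ.integral_smul]
    have hψm := hψ.smooth.continuous.aestronglyMeasurable (μ := discMeasure)
    refine tendsto_integral_of_L1 (fun x => ψ x • f x)
      (hf.bdd_smul B hψm (Eventually.of_forall hB)).aestronglyMeasurable
      (Eventually.of_forall fun n => (((hp n).smooth.continuous.integrable_of_hasCompactSupport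
        (hp n).compact).restrict).bdd_smul B hψm (Eventually.of_forall hB)) ?_
    have hl2 := ENNReal.Tendsto.const_mul (a := ENNReal.ofReal B) hl
      (Or.inr ENNReal.ofReal_ne_top)
    rw [mul_zero] at hl2
    refine tendsto_of_tendsto_of_tendsto_of_le_of_le tendsto_const_nhds hl2
      (fun _ => zero_le) fun n => ?_
    simp only
    rw [← lintegral_const_mul' _ _ ENNReal.ofReal_ne_top]
    refine lintegral_mono fun x => ?_
    rw [← smul_sub, enorm_smul]
    gcongr
    rw [← ofReal_norm]
    exact ENNReal.ofReal_le_ofReal (hB x)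
  refine ⟨w, ⟨?_, fun j => ?_, fun ψ hψ j => ?_⟩, φ, hφ, hw0, hlim⟩
  · exact (show IntegrableOn w unitDisc volume from hwi).locallyIntegrableOn
  · exact (show IntegrableOn (P j) unitDisc volume from hP j).locallyIntegrableOn
  · refine tendsto_nhds_unique (key (hψ.partialD j) hwi hφ hw0) ?_
    have h2 := (key hψ (hP j) (fun n => (hφ n).partialD j) (hlim j)).neg
    refine h2.congr fun n => ?_
    exact (((hφ n).weakGradOn isOpen_unitDisc).eqn ψ hψ j).symm

theorem integral_disc_sum {X : Fin 2 → ℂ → ℝ} {φ : ℂ → ℝ} (hφ : IsTest unitDisc φ) :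
    ∫ x, ∑ j, X j x * partialD j φ x ∂discMeasure = ∫ x, ∑ j, partialD j φ x • X j x := by
  rw [discMeasure, setIntegral_eq_integral_of_forall_compl_eq_zero]
  · simp only [smul_eq_mul, mul_comm]
  · intro x hx
    simp [(hφ.partialD _).eq_zero hx]

/-- An `L²` vector field which is weakly divergence free is orthogonal to the gradients of
functions vanishing on the boundary. -/
theorem MemSobolevZeroOne.integral_eq_zero {b : ℂ → ℝ} {vb X : Fin 2 → ℂ → ℝ}
    (h : MemSobolevZeroOne b vb) (hv : ∀ j, MemLp (vb j) 2 discMeasure)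
    (hX : ∀ j, MemLp (X j) 2 discMeasure)
    (h0 : ∀ φ, IsTest unitDisc φ → ∫ x, ∑ j, X j x * partialD j φ x ∂discMeasure = 0) :
    ∫ x, ∑ j, X j x * vb j x ∂discMeasure = 0 := by
  set K := testGradients.topologicalClosure with hK
  have hKc : IsClosed (K : Set DiscL2) := Submodule.isClosed_topologicalClosure _
  have : CompleteSpace K := hKc.completeSpace_coe
  set v := toDiscL2 vb hv with hv'
  -- The aim is P = ∇b. As a limit of test gradients, P is the gradient of some w in W^{1,1}_0, and
  -- ∇b - P is orthogonal to all test gradients.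
  set P := K.starProjection v with hP
  have hPK : P ∈ K := K.starProjection_apply_mem v
  have hPv : ∀ k ∈ K, inner ℝ k (v - P) = 0 := fun k hk =>
    (Submodule.mem_orthogonal K _).1 (K.sub_starProjection_mem_orthogonal v) k hk
  have hPm : ∀ j, MemLp (P j : ℂ → ℝ) 2 discMeasure := fun j => Lp.memLp _
  have hPe : P = toDiscL2 (fun j => (P j : ℂ → ℝ)) hPm := by
    ext j : 1
    simp [toDiscL2]
  obtain ⟨s, hs, hslim⟩ := mem_closure_iff_seq_limit.1
    (show P ∈ closure (testGradients : Set DiscL2) from hPK)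
  choose φ hφ hsφ using hs
  have hL1 : ∀ j, Tendsto (fun n => ∫⁻ x in unitDisc, ‖partialD j (φ n) x - P j x‖ₑ)
      atTop (𝓝 0) := by
    intro j
    have h1 : Tendsto (fun n => s n j) atTop (𝓝 (P j)) :=
      ((PiLp.continuous_apply 2 (fun _ : Fin 2 => Lp ℝ 2 discMeasure) j).tendsto P).comp hslim
    rw [tendsto_iff_edist_tendsto_0] at h1
    have h2 := ENNReal.Tendsto.mul_const (b := discMeasure Set.univ ^ ((1 : ℝ) - 1 / 2)) h1
      (Or.inr (ENNReal.rpow_ne_top_of_nonneg (by norm_num) (measure_ne_top _ _)))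
    rw [zero_mul] at h2
    refine tendsto_of_tendsto_of_tendsto_of_le_of_le tendsto_const_nhds h2
      (fun _ => zero_le) fun n => ?_
    have e1 : edist (s n j) (P j)
        = eLpNorm (fun x => partialD j (φ n) x - P j x) 2 discMeasure := by
      rw [Lp.edist_def]
      refine eLpNorm_congr_ae ?_
      rw [hsφ n]
      filter_upwards [((hφ n).memLp_partialD j 2).coeFn_toLp] with x hx
      simp [toDiscL2, hx]
    have e2 := eLpNorm_le_eLpNorm_mul_rpow_measure_univ (p := 1) (q := 2) (by norm_num)
      (((hφ n).memLp_partialD j 2).sub (hPm j)).aestronglyMeasurable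
    rw [eLpNorm_one_eq_lintegral_enorm] at e2
    simp only [e1]
    refine le_trans (le_of_eq ?_) (e2.trans_eq ?_)
    · rfl
    · simp
      rfl
  obtain ⟨w, hw⟩ := exists_memSobolevZeroOne_of_tendsto hφ
    (fun j => (hPm j).integrable (by norm_num)) hL1
  have hbw := h.sub hw
  have hvP : ∀ j, MemLp (fun x => vb j x - P j x) 2 discMeasure := fun j => (hv j).sub (hPm j)
  have hveq : v - P = toDiscL2 (fun j x => vb j x - P j x) hvP := by
    ext j : 1
    simp only [hv', toDiscL2, PiLp.sub_apply]
    rw [Lp.ext_iff]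
    refine (Lp.coeFn_sub _ _).trans ?_
    filter_upwards [(hv j).coeFn_toLp, (hvP j).coeFn_toLp] with x h1 h2
    rw [h2, Pi.sub_apply, h1]
  -- Orthogonality says that b - w is weakly harmonic; lying in W^{1,1}_0, it vanishes.
  have hz := hbw.ae_eq_zero fun ψ hψ => by
    rw [← integral_disc_sum hψ, ← inner_toDiscL2 hvP (fun j => hψ.memLp_partialD j 2),
      real_inner_comm, ← hveq]
    exact hPv _ (Submodule.le_topologicalClosure _ ⟨ψ, hψ, rfl⟩)
  have hgrad : ∀ j, (fun x => vb j x - P j x) =ᵐ[volume.restrict unitDisc] fun _ => 0 := by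
    intro j
    have hzero := weakGradOn_const isOpen_unitDisc (0 : ℝ)
    exact hbw.weakGrad.unique isOpen_unitDisc hzero hz j
  have hvPe : v = P := by
    rw [← sub_eq_zero, hveq]
    ext j : 1
    simp only [toDiscL2, PiLp.zero_apply]
    rw [Lp.ext_iff]
    refine (MemLp.coeFn_toLp _).trans ((hgrad j).trans (Lp.coeFn_zero ℝ 2 discMeasure).symm)
  rw [← inner_toDiscL2 hX hv, ← hv', hvPe]
  -- X annihilates test gradients, hence their closure, which is now known to contain ∇b.
  have hle : K ≤ (ℝ ∙ toDiscL2 X hX)ᗮ := by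
    refine Submodule.topologicalClosure_minimal _ ?_ (Submodule.isClosed_orthogonal _)
    rintro _ ⟨φ, hφ, rfl⟩
    rw [Submodule.mem_orthogonal_singleton_iff_inner_right, inner_toDiscL2]
    exact h0 φ hφ
  exact Submodule.mem_orthogonal_singleton_iff_inner_right.1 (hle hPK)

end Density

/-! ### Hodge decompositions -/

section Hodge

/-- The field `∇^⊥ a + ∇b` built from the weak gradients `va` of `a` and `vb` of `b`. -/
def hodgeField (va vb : Fin 2 → ℂ → ℝ) : Fin 2 → ℂ → ℝ :=
  ![fun x => vb 0 x - va 1 x, fun x => vb 1 x + va 0 x]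

@[simp] theorem hodgeField_zero (va vb : Fin 2 → ℂ → ℝ) (x : ℂ) :
    hodgeField va vb 0 x = vb 0 x - va 1 x := rfl

@[simp] theorem hodgeField_one (va vb : Fin 2 → ℂ → ℝ) (x : ℂ) :
    hodgeField va vb 1 x = vb 1 x + va 0 x := rfl

/-- The content of a Hodge decomposition `-i g⁻¹ ∇g = ∇^⊥ a + ∇b` with chosen weak gradients. -/
structure HodgeData (g : ℂ → ℂ) (a b : ℂ → ℝ) (vg : Fin 2 → ℂ → ℂ) (va vb : Fin 2 → ℂ → ℝ) :
    Prop where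
  norm_eq : ∀ᵐ x ∂discMeasure, ‖g x‖ = 1
  gradG : WeakGradOn unitDisc g vg
  gradA : WeakGradOn unitDisc a va
  zeroB : MemSobolevZeroOne b vb
  rel : ∀ᵐ x ∂discMeasure, ∀ j, vg j x = hodgeField va vb j x • (Complex.I * g x)
  intA : Integrable a discMeasure
  mean : ∫ x, a x ∂discMeasure = 0

/-- Hölder on a set of finite measure. It allows the exponent q to be forgotten and everything to be
done in W^{1,1}_0. -/
theorem tendsto_lintegral_of_tendsto_eLpNorm {q : ℝ≥0∞} (hq : 1 ≤ q) {f : ℕ → ℂ → ℝ}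
    (hf : ∀ n, AEStronglyMeasurable (f n) discMeasure)
    (h : Tendsto (fun n => eLpNorm (f n) q discMeasure) atTop (𝓝 0)) :
    Tendsto (fun n => ∫⁻ x in unitDisc, ‖f n x‖ₑ) atTop (𝓝 0) := by
  set c := discMeasure Set.univ ^ (1 / (1 : ℝ≥0∞).toReal - 1 / q.toReal) with hc
  have hc' : c ≠ ∞ := by
    refine ENNReal.rpow_ne_top_of_nonneg ?_ (measure_ne_top _ _)
    by_cases hq' : q = ∞
    · simp [hq']
    · have : 1 ≤ q.toReal := by
        rw [← ENNReal.toReal_one]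
        exact ENNReal.toReal_mono hq' hq
      simp only [ENNReal.toReal_one, div_one, sub_nonneg]
      exact div_le_one_of_le₀ this (by positivity)
  have h2 := ENNReal.Tendsto.mul_const (b := c) h (Or.inr hc')
  rw [zero_mul] at h2
  refine tendsto_of_tendsto_of_tendsto_of_le_of_le tendsto_const_nhds h2
    (fun _ => zero_le) fun n => ?_
  have := eLpNorm_le_eLpNorm_mul_rpow_measure_univ hq (hf n)
  rw [eLpNorm_one_eq_lintegral_enorm] at this
  exact this

theorem MemSobolevZero.exists_zeroOne {q : ℝ≥0∞} (hq : 1 ≤ q) {b : ℂ → ℝ}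
    (h : MemSobolevZero q b) : ∃ v, MemSobolevZeroOne b v := by
  obtain ⟨hb, v, hv, hvq, φ, hφ, h0, hj⟩ := h
  have hφ' : ∀ n, IsTest unitDisc (φ n) := fun n => isDiscTest_iff.1 (hφ n)
  refine ⟨v, hasWeakGrad_iff.1 hv, φ, hφ', ?_, fun j => ?_⟩
  · exact tendsto_lintegral_of_tendsto_eLpNorm hq
      (fun n => (hφ' n).smooth.continuous.aestronglyMeasurable.sub hb.aestronglyMeasurable) h0
  · exact tendsto_lintegral_of_tendsto_eLpNorm hq
      (fun n => ((hφ' n).partialD j).smooth.continuous.aestronglyMeasurable.sub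
        (hvq j).aestronglyMeasurable) (hj j)

/-- Multiplying -i g⁻¹∇g = ∇^⊥a + ∇b by i g removes the inverse; |g| = 1 guarantees that g does not
vanish. -/
theorem IsHodgePair.exists_hodgeData {g : ℂ → ℂ} {a b : ℂ → ℝ}
    (hg : ∀ᵐ x ∂discMeasure, ‖g x‖ = 1) (h : IsHodgePair g a b) :
    ∃ vg va vb, HodgeData g a b vg va vb := by
  obtain ⟨q, hq, -, ⟨hb, -⟩, ha, hmean, vg, va, vb, hvg, hva, hvb, hrel⟩ := h
  obtain ⟨v, hv⟩ := hb.exists_zeroOne hq.le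
  refine ⟨vg, va, vb, hg, hasWeakGrad_iff.1 hvg, hasWeakGrad_iff.1 hva,
    hv.congr_grad (hasWeakGrad_iff.1 hvb), ?_, ha.1.integrable hq.le, hmean⟩
  filter_upwards [hg, hrel] with x h1 ⟨h2, h3⟩ j
  have hg0 : g x ≠ 0 := by
    intro h0
    simp [h0] at h1
  have hgi := mul_inv_cancel₀ hg0
  have hI := Complex.I_mul_I
  rw [Complex.ofReal_neg] at h2
  fin_cases j
  · simp only [Fin.zero_eta, hodgeField_zero, Complex.real_smul,
      Complex.ofReal_sub]
    linear_combination (-(Complex.I * g x)) * h2 + vg 0 x * (g x * (g x)⁻¹) * hI - vg 0 x * hgi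
  · simp only [Fin.mk_one, hodgeField_one, Complex.real_smul,
      Complex.ofReal_add]
    linear_combination (-(Complex.I * g x)) * h3 + vg 1 x * (g x * (g x)⁻¹) * hI - vg 1 x * hgi

/-- The rotated gradient is divergence free. -/
theorem WeakGradOn.integral_perp {Ω : Set ℂ} {a : ℂ → ℝ} {va : Fin 2 → ℂ → ℝ}
    (h : WeakGradOn Ω a va) {φ : ℂ → ℝ} (hφ : IsTest Ω φ) :
    ∫ x, (partialD 1 φ x * va 0 x - partialD 0 φ x * va 1 x) = 0 := by
  have e0 := h.eqn _ (hφ.partialD 1) 0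
  have e1 := h.eqn _ (hφ.partialD 0) 1
  have ec : ∀ x, partialD 0 (partialD 1 φ) x = partialD 1 (partialD 0 φ) x := fun x =>
    partialD_comm hφ.smooth.contDiffAt 0 1
  simp only [ec] at e0
  rw [e1] at e0
  have := integral_sub ((hφ.partialD 1).integrable_smul (h.locInt_grad 0))
    ((hφ.partialD 0).integrable_smul (h.locInt_grad 1))
  simp only [smul_eq_mul] at e0 this
  rw [this]
  linarith

theorem WeakGradOn.integral_disc_perp {a : ℂ → ℝ} {va : Fin 2 → ℂ → ℝ}
    (h : WeakGradOn unitDisc a va) {φ : ℂ → ℝ} (hφ : IsTest unitDisc φ) :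
    ∫ x, (partialD 1 φ x * va 0 x - partialD 0 φ x * va 1 x) ∂discMeasure = 0 := by
  rw [← h.integral_perp hφ]
  refine setIntegral_eq_integral_of_forall_compl_eq_zero fun x hx => ?_
  simp [(hφ.partialD _).eq_zero hx]

theorem isPreconnected_unitDisc : IsPreconnected unitDisc :=
  (convex_ball (0 : ℂ) 1).isPreconnected

namespace HodgeData

variable {g : ℂ → ℂ} {a b a' b' : ℂ → ℝ} {vg vg' : Fin 2 → ℂ → ℂ} {va vb va' vb' : Fin 2 → ℂ → ℝ}

theorem field_eq (h : HodgeData g a b vg va vb) (h' : HodgeData g a' b' vg' va' vb') :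
    ∀ᵐ x ∂discMeasure, ∀ j, hodgeField va vb j x = hodgeField va' vb' j x := by
  have e : ∀ j, vg j =ᵐ[discMeasure] vg' j := h.gradG.unique isOpen_unitDisc h'.gradG (ae_eq_refl _)
  filter_upwards [e 0, e 1, h.rel, h'.rel, h.norm_eq] with x e0 e1 r r' hn j
  have hg0 : Complex.I * g x ≠ 0 := by
    refine mul_ne_zero Complex.I_ne_zero fun h0 => ?_
    simp [h0] at hn
  have e2 : vg j x = vg' j x := by
    fin_cases j
    · exact e0
    · exact e1
  rw [r j, r' j] at e2
  exact smul_left_injective ℝ hg0 e2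

/-- Uniqueness of the Hodge decomposition. -/
theorem unique (h : HodgeData g a b vg va vb) (h' : HodgeData g a' b' vg' va' vb') :
    a =ᵐ[discMeasure] a' ∧ b =ᵐ[discMeasure] b' := by
  have hf := h.field_eq h'
  have hA := h.gradA.sub isOpen_unitDisc h'.gradA
  have hB := h.zeroB.sub h'.zeroB
  -- Equality of the fields gives ∇(b - b') = -∇^⊥(a - a'), which is divergence free.
  have hB0 := hB.ae_eq_zero fun φ hφ => by
    rw [← integral_disc_sum hφ, ← neg_eq_zero, ← integral_neg, ← hA.integral_disc_perp hφ]
    refine integral_congr_ae ?_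
    filter_upwards [hf] with x hx
    have h0 := hx 0
    have h1 := hx 1
    simp only [hodgeField_zero, hodgeField_one] at h0 h1
    simp only [Fin.sum_univ_two]
    linear_combination (-partialD 0 φ x) * h0 - (partialD 1 φ x) * h1
  have hvB : ∀ j, (fun x => vb j x - vb' j x) =ᵐ[volume.restrict unitDisc] fun _ => 0 := fun j =>
    hB.weakGrad.unique isOpen_unitDisc (weakGradOn_const isOpen_unitDisc 0) hB0 j
  have hvA : ∀ j, (fun x => va j x - va' j x) =ᵐ[volume.restrict unitDisc] 0 := by
    intro j
    filter_upwards [hf, hvB 0, hvB 1] with x hx b0 b1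
    have h0 := hx 0
    have h1 := hx 1
    simp only [hodgeField_zero, hodgeField_one] at h0 h1
    fin_cases j
    · simp only [Fin.zero_eta, Pi.zero_apply]
      linarith
    · simp only [Fin.mk_one, Pi.zero_apply]
      linarith
  obtain ⟨c, hc⟩ := hA.ae_const isOpen_unitDisc isPreconnected_unitDisc hvA
  -- The normalization to mean zero removes the remaining constant in a.
  have hc0 : c = 0 := by
    have e1 : ∫ x, (a x - a' x) ∂discMeasure = 0 := by
      have := integral_sub h.intA h'.intA
      rw [this, h.mean, h'.mean, sub_zero]
    rw [integral_congr_ae (μ := discMeasure) hc, integral_const, smul_eq_mul, mul_eq_zero] at e1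
    refine e1.resolve_left ?_
    rw [measureReal_def, discMeasure, Measure.restrict_apply_univ]
    exact (ENNReal.toReal_pos (Metric.measure_ball_pos volume (0 : ℂ) one_pos).ne'
      measure_ball_lt_top.ne).ne'
  constructor
  · filter_upwards [hc] with x hx
    rw [hc0] at hx
    exact sub_eq_zero.1 hx
  · filter_upwards [hB0] with x hx
    exact sub_eq_zero.1 hx

theorem grad_eq_zero_of_ae_eq_zero (h : HodgeData g a b vg va vb) (hb : b =ᵐ[discMeasure] 0)
    (j : Fin 2) : vb j =ᵐ[discMeasure] fun _ => 0 :=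
  h.zeroB.weakGrad.unique isOpen_unitDisc (weakGradOn_const isOpen_unitDisc 0) hb j

theorem ae_eq_zero_of_grad (h : HodgeData g a b vg va vb)
    (hvb : ∀ j, vb j =ᵐ[discMeasure] fun _ => 0) : b =ᵐ[discMeasure] 0 :=
  h.zeroB.ae_eq_zero fun φ hφ => by
    rw [← integral_disc_sum hφ]
    refine integral_eq_zero_of_ae ?_
    filter_upwards [hvb 0, hvb 1] with x h0 h1
    simp [h0, h1]

theorem integrable_smul_partialD {v : Fin 2 → ℂ → ℝ}
    (hv : ∀ j, LocallyIntegrableOn (v j) unitDisc volume) {φ : ℂ → ℝ} (hφ : IsTest unitDisc φ)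
    (j : Fin 2) : Integrable (fun x => v j x * partialD j φ x) discMeasure := by
  have := ((hφ.partialD j).integrable_smul (hv j)).restrict (s := unitDisc)
  simp only [smul_eq_mul, mul_comm] at this
  exact this

/-- Test functions do not see ∇^⊥a, since mixed second derivatives commute. -/
theorem integral_hodgeField (h : HodgeData g a b vg va vb) {φ : ℂ → ℝ} (hφ : IsTest unitDisc φ) :
    ∫ x, ∑ j, hodgeField va vb j x * partialD j φ x ∂discMeasure
      = ∫ x, ∑ j, vb j x * partialD j φ x ∂discMeasure := by
  have e := h.gradA.integral_disc_perp hφ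
  have i1 : Integrable (fun x => ∑ j, vb j x * partialD j φ x) discMeasure :=
    integrable_finsetSum _ fun j _ => integrable_smul_partialD h.zeroB.weakGrad.locInt_grad hφ j
  have i2 : Integrable (fun x => partialD 1 φ x * va 0 x - partialD 0 φ x * va 1 x)
      discMeasure :=
    ((hφ.partialD 1).integrable_smul (h.gradA.locInt_grad 0)).restrict.sub
      ((hφ.partialD 0).integrable_smul (h.gradA.locInt_grad 1)).restrict
  have := integral_add i1 i2
  rw [e, add_zero] at this
  rw [← this]
  refine integral_congr_ae (Eventually.of_forall fun x => ?_)
  simp only [Fin.sum_univ_two, hodgeField_zero, hodgeField_one]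
  ring

/-- Here g⁻¹∇g = i(∇^⊥a + ∇b), whose divergence is iΔb; then the uniqueness in W^{1,1}_0 applies. -/
theorem isWeaklyCircleHarmonic_iff (h : HodgeData g a b vg va vb) :
    IsWeaklyCircleHarmonic g ↔ b =ᵐ[discMeasure] 0 := by
  have key : ∀ v, WeakGradOn unitDisc g v → ∀ φ, IsTest unitDisc φ →
      ∫ x, ∑ j, ((g x)⁻¹ * v j x) * ((partialD j φ x : ℝ) : ℂ) ∂discMeasure
        = Complex.I * ((∫ x, ∑ j, vb j x * partialD j φ x ∂discMeasure : ℝ) : ℂ) := by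
    intro v hv φ hφ
    rw [← h.integral_hodgeField hφ, ← integral_complex_ofReal, ← integral_const_mul]
    have e : ∀ j, v j =ᵐ[discMeasure] vg j :=
      hv.unique isOpen_unitDisc h.gradG (ae_eq_refl _)
    refine integral_congr_ae ?_
    filter_upwards [e 0, e 1, h.rel, h.norm_eq] with x e0 e1 r hn
    have hg0 : g x ≠ 0 := fun h0 => by simp [h0] at hn
    have hgi := mul_inv_cancel₀ hg0
    simp only [Fin.sum_univ_two, e0, e1, r, Complex.real_smul, Complex.ofReal_add,
      Complex.ofReal_mul]
    linear_combination (Complex.I * (hodgeField va vb 0 x * (partialD 0 φ x : ℝ) +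
      hodgeField va vb 1 x * (partialD 1 φ x : ℝ))) * hgi
  constructor
  · rintro ⟨v, hv, hφ⟩
    refine h.zeroB.ae_eq_zero fun φ ht => ?_
    have := key v (hasWeakGrad_iff.1 hv) φ ht
    rw [hφ φ (isDiscTest_iff.2 ht)] at this
    rw [← integral_disc_sum ht]
    have h2 := mul_eq_zero.1 this.symm
    exact_mod_cast h2.resolve_left Complex.I_ne_zero
  · intro hb
    refine ⟨vg, hasWeakGrad_iff.2 h.gradG, fun φ hφ => ?_⟩
    have ht := isDiscTest_iff.1 hφ
    rw [key vg h.gradG φ ht]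
    have : ∫ x, ∑ j, vb j x * partialD j φ x ∂discMeasure = 0 := by
      refine integral_eq_zero_of_ae ?_
      filter_upwards [h.grad_eq_zero_of_ae_eq_zero hb 0,
        h.grad_eq_zero_of_ae_eq_zero hb 1] with x h0 h1
      simp [h0, h1]
    rw [this]
    simp

end HodgeData

end Hodge

/-! ### The Dirichlet integral of the sphere lift -/

section Lift

/-- For smooth m the product φ m is itself a test function, so no approximation is needed and u need
not be bounded. -/
theorem WeakGradOn.contDiffOn_smul {F : Type*} [NormedAddCommGroup F] [NormedSpace ℝ F]
    {Ω : Set ℂ} (hΩ : IsOpen Ω) {m : ℂ → ℝ} (hm : ContDiffOn ℝ (⊤ : ℕ∞) m Ω) {u : ℂ → F}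
    {v : Fin 2 → ℂ → F} (h : WeakGradOn Ω u v) :
    WeakGradOn Ω (fun x => m x • u x) (fun j x => m x • v j x + partialD j m x • u x) := by
  have hpm : ∀ j, ContinuousOn (partialD j m) Ω := fun j =>
    (contDiffOn_partialD hΩ hm j).continuousOn
  have i0 := h.locInt.continuousOn_smul hΩ.isLocallyClosed hm.continuousOn
  have i1 : ∀ j, LocallyIntegrableOn (fun x => m x • v j x) Ω volume := fun j =>
    (h.locInt_grad j).continuousOn_smul hΩ.isLocallyClosed hm.continuousOn
  have i2 : ∀ j, LocallyIntegrableOn (fun x => partialD j m x • u x) Ω volume := fun j =>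
    h.locInt.continuousOn_smul hΩ.isLocallyClosed (hpm j)
  refine ⟨i0, fun j => (i1 j).add (i2 j), fun φ hφ j => ?_⟩
  have e := h.eqn _ (hφ.mul_smooth hΩ hm) j
  have e2 : ∀ x, partialD j (fun x => φ x * m x) x • u x
      = partialD j φ x • m x • u x + φ x • partialD j m x • u x := by
    intro x
    by_cases hx : x ∈ Ω
    · rw [partialD_mul_real ((hφ.smooth.differentiable (by simp)) x)
        ((hm.contDiffAt (hΩ.mem_nhds hx)).differentiableAt (by simp))]
      module
    · rw [(hφ.partialD j).eq_zero hx, hφ.eq_zero hx, ((hφ.mul_smooth hΩ hm).partialD j).eq_zero hx]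
      simp
  simp only [e2] at e
  rw [integral_add ((hφ.partialD j).integrable_smul i0) (hφ.integrable_smul (i2 j))] at e
  simp only [smul_add]
  rw [integral_add (hφ.integrable_smul (i1 j)) (hφ.integrable_smul (i2 j))]
  simp only [← smul_eq_mul, smul_assoc] at e
  rw [eq_sub_of_add_eq e]
  abel

theorem partialD_clm_comp {F G : Type*} [NormedAddCommGroup F] [NormedSpace ℝ F]
    [NormedAddCommGroup G] [NormedSpace ℝ G] (L : F →L[ℝ] G) {f : ℂ → F} {x : ℂ}
    (hf : DifferentiableAt ℝ f x) (j : Fin 2) :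
    partialD j (fun y => L (f y)) x = L (partialD j f x) := by
  simp only [partialD]
  rw [show (fun y => L (f y)) = L ∘ f from rfl, (L.hasFDerivAt.comp x hf.hasFDerivAt).fderiv]
  rfl

/-- Multiplication of a weakly differentiable function by a smooth complex function. -/
theorem WeakGradOn.contDiffOn_mul {Ω : Set ℂ} (hΩ : IsOpen Ω) {m : ℂ → ℂ}
    (hm : ContDiffOn ℝ (⊤ : ℕ∞) m Ω) {u : ℂ → ℂ} {v : Fin 2 → ℂ → ℂ} (h : WeakGradOn Ω u v) :
    WeakGradOn Ω (fun x => m x * u x) (fun j x => m x * v j x + partialD j m x * u x) := by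
  have hr : ContDiffOn ℝ (⊤ : ℕ∞) (fun x => (m x).re) Ω := Complex.reCLM.contDiff.comp_contDiffOn hm
  have hi : ContDiffOn ℝ (⊤ : ℕ∞) (fun x => (m x).im) Ω := Complex.imCLM.contDiff.comp_contDiffOn hm
  have hI := h.clm_comp hΩ (ContinuousLinearMap.mul ℝ ℂ Complex.I)
  have key := (h.contDiffOn_smul hΩ hr).add (hI.contDiffOn_smul hΩ hi)
  refine key.congr hΩ (Eventually.of_forall fun x => ?_) fun j => ?_
  · simp only [ContinuousLinearMap.mul_apply', Complex.real_smul]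
    conv_rhs => rw [← Complex.re_add_im (m x)]
    ring
  · rw [EventuallyEq, ae_restrict_iff' hΩ.measurableSet]
    refine Eventually.of_forall fun x hx => ?_
    have hd := (hm.contDiffAt (hΩ.mem_nhds hx)).differentiableAt (by simp)
    have e1 : partialD j (fun x => (m x).re) x = (partialD j m x).re :=
      partialD_clm_comp Complex.reCLM hd j
    have e2 : partialD j (fun x => (m x).im) x = (partialD j m x).im :=
      partialD_clm_comp Complex.imCLM hd j
    simp only [ContinuousLinearMap.mul_apply', Complex.real_smul, e1, e2]
    conv_rhs => rw [← Complex.re_add_im (m x), ← Complex.re_add_im (partialD j m x)]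
    ring

/-- Weak gradients are unique almost everywhere, so the infimum runs over a single value. -/
theorem dirichletIntegral_eq {F : Type*} [NormedAddCommGroup F] [NormedSpace ℝ F]
    [CompleteSpace F] {u : ℂ → F} {v : Fin 2 → ℂ → F} (h : WeakGradOn unitDisc u v) :
    dirichletIntegral u = ∫⁻ x, ∑ j, ‖v j x‖ₑ ^ 2 ∂discMeasure := by
  refine le_antisymm (iInf₂_le v (hasWeakGrad_iff.2 h)) (le_iInf₂ fun v' h' => le_of_eq ?_)
  have e : ∀ j, v j =ᵐ[discMeasure] v' j :=
    h.unique isOpen_unitDisc (hasWeakGrad_iff.1 h') (ae_eq_refl _)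
  refine lintegral_congr_ae ?_
  filter_upwards [e 0, e 1] with x h0 h1
  simp only [Fin.sum_univ_two, h0, h1]

theorem dirichletIntegral_congr {F : Type*} [NormedAddCommGroup F] [NormedSpace ℝ F]
    {u u' : ℂ → F} (h : u =ᵐ[discMeasure] u') :
    dirichletIntegral u = dirichletIntegral u' := by
  have : ∀ v, HasWeakGrad u v ↔ HasWeakGrad u' v := fun v => by
    rw [hasWeakGrad_iff, hasWeakGrad_iff]
    exact ⟨fun k => k.congr isOpen_unitDisc h fun _ => ae_eq_refl _,
      fun k => k.congr isOpen_unitDisc h.symm fun _ => ae_eq_refl _⟩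
  simp only [dirichletIntegral, this]

/-- The hyperbolic secant. -/
noncomputable def sech (t : ℝ) : ℝ := (Real.cosh t)⁻¹

theorem sech_pos (t : ℝ) : 0 < sech t := inv_pos.2 (Real.cosh_pos t)

theorem sech_le_one (t : ℝ) : sech t ≤ 1 := inv_le_one_of_one_le₀ (Real.one_le_cosh t)

theorem tanh_sq_add_sech_sq (t : ℝ) : Real.tanh t ^ 2 + sech t ^ 2 = 1 := by
  rw [Real.tanh_eq_sinh_div_cosh, sech]
  have := (Real.cosh_pos t).ne'
  have h2 := Real.cosh_sq t
  field_simp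
  linarith

theorem contDiff_sech : ContDiff ℝ (⊤ : ℕ∞) sech :=
  Real.contDiff_cosh.inv fun t => (Real.cosh_pos t).ne'

theorem contDiff_tanh : ContDiff ℝ (⊤ : ℕ∞) Real.tanh := by
  have : Real.tanh = fun t => Real.sinh t / Real.cosh t := funext Real.tanh_eq_sinh_div_cosh
  rw [this]
  exact Real.contDiff_sinh.div Real.contDiff_cosh fun t => (Real.cosh_pos t).ne'

theorem deriv_sech (t : ℝ) : deriv sech t = -(Real.tanh t * sech t) := by
  have h := ((Real.hasDerivAt_cosh t).inv (Real.cosh_pos t).ne').deriv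
  rw [show sech = Real.cosh⁻¹ from rfl, h, Real.tanh_eq_sinh_div_cosh, Pi.inv_apply]
  have := (Real.cosh_pos t).ne'
  field_simp

theorem deriv_tanh (t : ℝ) : deriv Real.tanh t = sech t ^ 2 := by
  have h := ((Real.hasDerivAt_sinh t).div (Real.hasDerivAt_cosh t) (Real.cosh_pos t).ne').deriv
  have h1 : Real.tanh = Real.sinh / Real.cosh := funext Real.tanh_eq_sinh_div_cosh
  rw [h1, h, sech]
  have := (Real.cosh_pos t).ne'
  have h2 := Real.cosh_sq t
  field_simp
  linarith

theorem continuous_sech : Continuous sech := contDiff_sech.continuous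

theorem norm_sech_le (t : ℝ) : ‖sech t‖ ≤ 1 := by
  rw [Real.norm_of_nonneg (sech_pos t).le]
  exact sech_le_one t

theorem norm_tanh_le (t : ℝ) : ‖Real.tanh t‖ ≤ 1 := (Real.abs_tanh_lt_one t).le

/-- The embedding of `ℂ × ℝ` as `ℝ³`. -/
noncomputable def ofPlaneAxis (z : ℂ) (t : ℝ) : EuclideanSpace ℝ (Fin 3) := !₂[z.re, z.im, t]

/-- The equatorial plane in `ℝ³`. -/
noncomputable def planeCLM : ℂ →L[ℝ] EuclideanSpace ℝ (Fin 3) :=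
  LinearMap.toContinuousLinearMap
    { toFun := fun z => ofPlaneAxis z 0
      map_add' := fun z w => by
        ext i
        fin_cases i <;> simp [ofPlaneAxis]
      map_smul' := fun c z => by
        ext i
        fin_cases i <;> simp [ofPlaneAxis] }

/-- The vertical axis in `ℝ³`. -/
noncomputable def axisCLM : ℝ →L[ℝ] EuclideanSpace ℝ (Fin 3) :=
  LinearMap.toContinuousLinearMap
    { toFun := fun t => ofPlaneAxis 0 t
      map_add' := fun z w => by
        ext i
        fin_cases i <;> simp [ofPlaneAxis]
      map_smul' := fun c z => by
        ext i
        fin_cases i <;> simp [ofPlaneAxis] }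

theorem planeCLM_sub_axisCLM (z : ℂ) (t : ℝ) :
    planeCLM z - axisCLM t = ofPlaneAxis z (-t) := by
  ext i
  fin_cases i <;> simp [ofPlaneAxis, planeCLM, axisCLM]

theorem inner_ofPlaneAxis (z w : ℂ) (s t : ℝ) :
    inner ℝ (ofPlaneAxis z s) (ofPlaneAxis w t) = z.re * w.re + z.im * w.im + s * t := by
  simp only [ofPlaneAxis, PiLp.inner_apply, Fin.sum_univ_three]
  simp
  ring

theorem norm_sq_ofPlaneAxis (z : ℂ) (s : ℝ) :
    ‖ofPlaneAxis z s‖ ^ 2 = z.re ^ 2 + z.im ^ 2 + s ^ 2 := by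
  rw [← real_inner_self_eq_norm_sq, inner_ofPlaneAxis]
  ring

/-- On the circle of radius e^a, 2e^a/(1 + e^{2a}) = sech a and (1 - e^{2a})/(1 + e^{2a}) = -tanh a.
In this form only bounded functions of a with bounded derivatives occur, so e^a never has to be
differentiated weakly. -/
theorem invStereo_exp_mul (a : ℝ) {z : ℂ} (hz : ‖z‖ = 1) :
    invStereo ((Real.exp a : ℂ) * z) = ofPlaneAxis (sech a • z) (-Real.tanh a) := by
  have hn : ‖(Real.exp a : ℂ) * z‖ = Real.exp a := by
    rw [norm_mul, hz, mul_one, Complex.norm_real, Real.norm_of_nonneg (Real.exp_pos a).le]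
  have h0 : 0 < 1 + Real.exp a ^ 2 := by positivity
  have hc : Real.cosh a = (1 + Real.exp a ^ 2) / (2 * Real.exp a) := by
    rw [Real.cosh_eq, Real.exp_neg]
    field_simp
    ring
  have hs : Real.sinh a = (Real.exp a ^ 2 - 1) / (2 * Real.exp a) := by
    rw [Real.sinh_eq, Real.exp_neg]
    field_simp
  have e1 : sech a = 2 * Real.exp a / (1 + Real.exp a ^ 2) := by
    rw [sech, hc, inv_div]
  have e2 : Real.tanh a = (Real.exp a ^ 2 - 1) / (1 + Real.exp a ^ 2) := by
    rw [Real.tanh_eq_sinh_div_cosh, hc, hs]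
    field_simp
  rw [invStereo, ofPlaneAxis, hn, e1, e2, Complex.re_ofReal_mul, Complex.im_ofReal_mul,
    Complex.smul_re, Complex.smul_im, smul_eq_mul, smul_eq_mul]
  generalize Real.exp a = E
  congr 1
  ext i
  fin_cases i
  · simp
    ring
  · simp
    ring
  · simp
    ring

/-- The gradient of the sphere lift. -/
noncomputable def liftGrad (g : ℂ → ℂ) (a : ℂ → ℝ) (va vb : Fin 2 → ℂ → ℝ) (j : Fin 2) (x : ℂ) :
    EuclideanSpace ℝ (Fin 3) :=
  ofPlaneAxis ((sech (a x) : ℂ) * (((hodgeField va vb j x : ℝ) : ℂ) * Complex.I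
    - ((Real.tanh (a x) * va j x : ℝ) : ℂ)) * g x) (-(sech (a x) ^ 2 * va j x))

/-- The source of the crucial cancellation: sech²(a)∇^⊥a is the rotated gradient of tanh a, hence
divergence free. -/
theorem WeakGradOn.tanh_comp {Ω : Set ℂ} (hΩ : IsOpen Ω) {a : ℂ → ℝ} {va : Fin 2 → ℂ → ℝ}
    (h : WeakGradOn Ω a va) :
    WeakGradOn Ω (fun x => Real.tanh (a x)) (fun j x => sech (a x) ^ 2 * va j x) := by
  have := h.comp_smul hΩ (weakGradOn_const (F := ℝ) hΩ (1 : ℝ)) (M := 1)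
    (Eventually.of_forall fun x => by simp) contDiff_tanh (C := 1) norm_tanh_le (fun t => by
      rw [deriv_tanh, norm_pow]
      exact pow_le_one₀ (norm_nonneg _) (norm_sech_le t))
  simpa [deriv_tanh] using this

/-! ### The energy density in terms of a, b and ω. -/

namespace HodgeData

variable {g : ℂ → ℂ} {a b a' b' : ℂ → ℝ} {vg vg' : Fin 2 → ℂ → ℂ} {va vb va' vb' : Fin 2 → ℂ → ℝ}

theorem weakGradOn_sphereLift (h : HodgeData g a b vg va vb) :
    WeakGradOn unitDisc (sphereLift g a) (liftGrad g a va vb) := by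
  have h1 := h.gradA.comp_smul isOpen_unitDisc h.gradG (M := 1) (C := 1)
    (h.norm_eq.mono fun x hx => hx.le) contDiff_sech norm_sech_le (fun t => by
      rw [deriv_sech, norm_neg, norm_mul]
      exact mul_le_one₀ (norm_tanh_le t) (norm_nonneg _) (norm_sech_le t))
  have h2 := (h1.clm_comp isOpen_unitDisc planeCLM).sub isOpen_unitDisc
    ((h.gradA.tanh_comp isOpen_unitDisc).clm_comp isOpen_unitDisc axisCLM)
  refine h2.congr isOpen_unitDisc ?_ fun j => ?_
  · filter_upwards [h.norm_eq] with x hx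
    rw [planeCLM_sub_axisCLM, sphereLift, invStereo_exp_mul _ hx]
  · filter_upwards [h.rel] with x hx
    rw [planeCLM_sub_axisCLM, liftGrad, hx j, deriv_sech]
    congr 1
    simp only [Complex.real_smul, Complex.ofReal_neg, Complex.ofReal_mul]
    ring

/-- In the moving frame of g the derivative has angular part sech(a) ω, radial part -sech(a) tanh(a)
∂a and vertical part -sech²(a) ∂a. The last two combine through tanh² + sech² = 1. -/
theorem inner_liftGrad (h : HodgeData g a b vg va vb) : ∀ᵐ x ∂discMeasure, ∀ i j,
    inner ℝ (liftGrad g a va vb i x) (liftGrad g a va vb j x) =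
      sech (a x) ^ 2 * (va i x * va j x + hodgeField va vb i x * hodgeField va vb j x) := by
  filter_upwards [h.norm_eq] with x hx i j
  have hn : (g x).re ^ 2 + (g x).im ^ 2 = 1 := by
    have := Complex.sq_norm (g x)
    rw [hx, Complex.normSq_apply] at this
    linarith
  have ht := tanh_sq_add_sech_sq (a x)
  rw [liftGrad, liftGrad, inner_ofPlaneAxis]
  simp only [Complex.mul_re, Complex.mul_im, Complex.sub_re, Complex.sub_im, Complex.ofReal_re,
    Complex.ofReal_im, Complex.I_re, Complex.I_im]
  set A := hodgeField va vb i x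
  set B := hodgeField va vb j x
  set s := sech (a x)
  set t := Real.tanh (a x)
  linear_combination (s ^ 2 * (A * B + t ^ 2 * va i x * va j x)) * hn
    + (s ^ 2 * va i x * va j x) * ht

theorem dirichletIntegral_sphereLift (h : HodgeData g a b vg va vb) :
    dirichletIntegral (sphereLift g a) = ∫⁻ x, ENNReal.ofReal
      (∑ j, sech (a x) ^ 2 * (va j x ^ 2 + hodgeField va vb j x ^ 2)) ∂discMeasure := by
  rw [dirichletIntegral_eq h.weakGradOn_sphereLift]
  refine lintegral_congr_ae ?_
  filter_upwards [h.inner_liftGrad] with x hx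
  rw [ENNReal.ofReal_sum_of_nonneg fun j _ => by positivity]
  refine Finset.sum_congr rfl fun j _ => ?_
  rw [← ofReal_norm, ← ENNReal.ofReal_pow (norm_nonneg _), ← real_inner_self_eq_norm_sq, hx j j]
  congr 1
  ring

theorem dirichletIntegral_right (h : HodgeData g a b vg va vb) :
    dirichletIntegral b = ∫⁻ x, ENNReal.ofReal (∑ j, vb j x ^ 2) ∂discMeasure := by
  rw [dirichletIntegral_eq h.zeroB.weakGrad]
  refine lintegral_congr fun x => ?_
  rw [ENNReal.ofReal_sum_of_nonneg fun j _ => by positivity]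
  refine Finset.sum_congr rfl fun j _ => ?_
  rw [← ofReal_norm, ← ENNReal.ofReal_pow (norm_nonneg _), Real.norm_eq_abs, sq_abs]

/-- All pairs agree almost everywhere by `unique`, so the infimum is attained at any given one. -/
theorem renormEnergy_eq_dirichlet (h : HodgeData g a b vg va vb) (hp : IsHodgePair g a b) :
    renormEnergy g = (dirichletIntegral (sphereLift g a) + dirichletIntegral b) / 4 := by
  refine le_antisymm (iInf_le_of_le a (iInf₂_le b hp)) ?_
  refine le_iInf fun a' => le_iInf₂ fun b' hp' => le_of_eq ?_
  obtain ⟨vg', va', vb', h'⟩ := hp'.exists_hodgeData h.norm_eq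
  obtain ⟨ea, eb⟩ := h.unique h'
  rw [dirichletIntegral_congr eb, dirichletIntegral_congr (u' := sphereLift g a')]
  filter_upwards [ea] with x hx
  rw [sphereLift, sphereLift, hx]

/-- The density of the renormalized energy. -/
noncomputable def density (a : ℂ → ℝ) (va vb : Fin 2 → ℂ → ℝ) (x : ℂ) : ℝ :=
  ((∑ j, sech (a x) ^ 2 * (va j x ^ 2 + hodgeField va vb j x ^ 2)) + ∑ j, vb j x ^ 2) / 4

theorem aestronglyMeasurable_a (h : HodgeData g a b vg va vb) :
    AEStronglyMeasurable a discMeasure := h.gradA.locInt.aestronglyMeasurable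

theorem aestronglyMeasurable_va (h : HodgeData g a b vg va vb) (j : Fin 2) :
    AEStronglyMeasurable (va j) discMeasure := (h.gradA.locInt_grad j).aestronglyMeasurable

theorem aestronglyMeasurable_vb (h : HodgeData g a b vg va vb) (j : Fin 2) :
    AEStronglyMeasurable (vb j) discMeasure := (h.zeroB.weakGrad.locInt_grad j).aestronglyMeasurable

theorem aestronglyMeasurable_sech (h : HodgeData g a b vg va vb) :
    AEStronglyMeasurable (fun x => sech (a x)) discMeasure :=
  continuous_sech.comp_aestronglyMeasurable h.aestronglyMeasurable_a

theorem aestronglyMeasurable_field (h : HodgeData g a b vg va vb) (j : Fin 2) :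
    AEStronglyMeasurable (hodgeField va vb j) discMeasure := by
  fin_cases j
  · exact (h.aestronglyMeasurable_vb 0).sub (h.aestronglyMeasurable_va 1)
  · exact (h.aestronglyMeasurable_vb 1).add (h.aestronglyMeasurable_va 0)

theorem renormEnergy_eq (h : HodgeData g a b vg va vb) (hp : IsHodgePair g a b) :
    renormEnergy g = ∫⁻ x, ENNReal.ofReal (density a va vb x) ∂discMeasure := by
  rw [h.renormEnergy_eq_dirichlet hp, h.dirichletIntegral_sphereLift, h.dirichletIntegral_right,
    ← lintegral_add_right' (f := fun x => ENNReal.ofReal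
      (∑ j, sech (a x) ^ 2 * (va j x ^ 2 + hodgeField va vb j x ^ 2)))
      (g := fun x => ENNReal.ofReal (∑ j, vb j x ^ 2)), ENNReal.div_eq_inv_mul,
    ← lintegral_const_mul' _ _ (by simp)]
  · refine lintegral_congr fun x => ?_
    rw [← ENNReal.ofReal_add (Finset.sum_nonneg fun j _ => by positivity)
      (Finset.sum_nonneg fun j _ => by positivity), ← ENNReal.div_eq_inv_mul, density,
      ENNReal.ofReal_div_of_pos (by norm_num)]
    norm_num
  · refine AEMeasurable.ennreal_ofReal (Finset.aemeasurable_fun_sum _ fun j _ => ?_)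
    exact (h.aestronglyMeasurable_vb j).aemeasurable.pow_const 2

end HodgeData

end Lift

/-! ### Variations in the target -/

section Variation

theorem IsTest.add {Ω : Set ℂ} {φ ψ : ℂ → ℝ} (hφ : IsTest Ω φ) (hψ : IsTest Ω ψ) :
    IsTest Ω (fun x => φ x + ψ x) :=
  ⟨hφ.smooth.add hψ.smooth, hφ.compact.add hψ.compact,
    (tsupport_add φ ψ).trans (Set.union_subset hφ.supp hψ.supp)⟩

theorem IsTest.const_mul {Ω : Set ℂ} {φ : ℂ → ℝ} (hφ : IsTest Ω φ) (c : ℝ) :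
    IsTest Ω (fun x => c * φ x) :=
  ⟨contDiff_const.mul hφ.smooth, hφ.compact.mul_left, tsupport_mul_subset_right.trans hφ.supp⟩

theorem partialD_const_mul {φ : ℂ → ℝ} {x : ℂ} (h : DifferentiableAt ℝ φ x) (c : ℝ)
    (j : Fin 2) : partialD j (fun y => c * φ y) x = c * partialD j φ x := by
  simp only [partialD]
  rw [fderiv_const_mul h]
  rfl

theorem partialD_add {φ ψ : ℂ → ℝ} {x : ℂ} (h : DifferentiableAt ℝ φ x)
    (h' : DifferentiableAt ℝ ψ x) (j : Fin 2) :
    partialD j (fun y => φ y + ψ y) x = partialD j φ x + partialD j ψ x := by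
  simp only [partialD]
  rw [fderiv_fun_add h h']
  rfl

theorem IsTest.differentiableAt {Ω : Set ℂ} {φ : ℂ → ℝ} (hφ : IsTest Ω φ) (x : ℂ) :
    DifferentiableAt ℝ φ x := hφ.smooth.differentiable (by simp) x

theorem IsTest.memLp {φ : ℂ → ℝ} (hφ : IsTest unitDisc φ) (q : ℝ≥0∞) : MemLp φ q discMeasure := by
  obtain ⟨C, hC⟩ := hφ.exists_bound
  exact MemLp.of_bound hφ.smooth.continuous.aestronglyMeasurable C (Eventually.of_forall hC)

theorem MemSobolevZero.add_test {q : ℝ≥0∞} {b ψ : ℂ → ℝ} (h : MemSobolevZero q b)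
    (hψ : IsTest unitDisc ψ) : MemSobolevZero q (fun x => b x + ψ x) := by
  obtain ⟨hb, v, hv, hvq, φ, hφ, h0, hj⟩ := h
  have hφ' : ∀ n, IsTest unitDisc (φ n) := fun n => isDiscTest_iff.1 (hφ n)
  refine ⟨hb.add (hψ.memLp q), _, hasWeakGrad_iff.2
    ((hasWeakGrad_iff.1 hv).add (hψ.weakGradOn isOpen_unitDisc)),
    fun j => (hvq j).add (hψ.memLp_partialD j q), fun n x => φ n x + ψ x,
    fun n => isDiscTest_iff.2 ((hφ' n).add hψ), ?_, fun j => ?_⟩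
  · simpa only [add_sub_add_right_eq_sub] using h0
  · simp only [partialD_add ((hφ' _).differentiableAt _) (hψ.differentiableAt _),
      add_sub_add_right_eq_sub]
    exact hj j

theorem MemSobolevZeroOne.add_test {b ψ : ℂ → ℝ} {vb : Fin 2 → ℂ → ℝ} (h : MemSobolevZeroOne b vb)
    (hψ : IsTest unitDisc ψ) :
    MemSobolevZeroOne (fun x => b x + ψ x) (fun j x => vb j x + partialD j ψ x) := by
  obtain ⟨hv, φ, hφ, h0, hj⟩ := h
  refine ⟨hv.add (hψ.weakGradOn isOpen_unitDisc), fun n x => φ n x + ψ x,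
    fun n => (hφ n).add hψ, ?_, fun j => ?_⟩
  · simpa only [add_sub_add_right_eq_sub] using h0
  · simp only [partialD_add ((hφ _).differentiableAt _) (hψ.differentiableAt _),
      add_sub_add_right_eq_sub]
    exact hj j

theorem partialD_exp_I_mul {ψ : ℂ → ℝ} {x : ℂ} (h : DifferentiableAt ℝ ψ x) (j : Fin 2) :
    partialD j (fun y => Complex.exp (Complex.I * ψ y)) x
      = Complex.exp (Complex.I * ψ x) * (Complex.I * (partialD j ψ x : ℝ)) := by
  have h1 : HasFDerivAt (fun y => (ψ y : ℂ)) (Complex.ofRealCLM.comp (fderiv ℝ ψ x)) x :=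
    Complex.ofRealCLM.hasFDerivAt.comp x h.hasFDerivAt
  have h2 := (h1.const_mul Complex.I).cexp
  simp only [partialD]
  rw [h2.fderiv]
  simp

namespace HodgeData

variable {g : ℂ → ℂ} {a b : ℂ → ℝ} {vg : Fin 2 → ℂ → ℂ} {va vb : Fin 2 → ℂ → ℝ}

/-- The way back from `HodgeData`, needed because the energy of a variation is defined through Hodge
pairs. -/
theorem isHodgePair (h : HodgeData g a b vg va vb) {q : ℝ≥0∞} (hq : 1 < q) (hq' : q ≠ ∞)
    (hb : MemSobolevZero q b) (ha : MemSobolev q a) : IsHodgePair g a b := by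
  have hgi : ∀ᵐ x ∂discMeasure, ∀ j,
      -Complex.I * (g x)⁻¹ * vg j x = (hodgeField va vb j x : ℝ) := by
    filter_upwards [h.rel, h.norm_eq] with x hx hn j
    have hg0 : g x ≠ 0 := fun h0 => by simp [h0] at hn
    have hgi := mul_inv_cancel₀ hg0
    rw [hx j, Complex.real_smul]
    linear_combination (hodgeField va vb j x : ℂ) * hgi
      - (hodgeField va vb j x : ℂ) * (g x * (g x)⁻¹) * Complex.I_mul_I
  refine ⟨q, hq, hq', ⟨hb, vg, vb, hasWeakGrad_iff.2 h.gradG, hasWeakGrad_iff.2 h.zeroB.weakGrad,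
    fun φ hφ => ?_⟩, ha, h.mean, vg, va, vb, hasWeakGrad_iff.2 h.gradG,
    hasWeakGrad_iff.2 h.gradA, hasWeakGrad_iff.2 h.zeroB.weakGrad, ?_⟩
  · have e := h.integral_hodgeField (isDiscTest_iff.1 hφ)
    have e2 := congrArg Complex.ofReal e
    rw [← integral_complex_ofReal, ← integral_complex_ofReal] at e2
    simp only [Complex.ofReal_sum, Complex.ofReal_mul] at e2
    rw [← e2]
    refine integral_congr_ae ?_
    filter_upwards [hgi] with x hx
    simp only [hx]
  · filter_upwards [hgi] with x hx
    rw [hx 0, hx 1, hodgeField_zero, hodgeField_one]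
    constructor
    · simp
    · simp

/-- The factor e^{itψ} adds the pure gradient t∇ψ to ω. Since ψ vanishes near the boundary, this is
absorbed by b, and a stays the same. -/
theorem phaseVariation (h : HodgeData g a b vg va vb) {ψ : ℂ → ℝ} (hψ : IsTest unitDisc ψ)
    (t : ℝ) : ∃ vg', HodgeData (phaseVariation g ψ t) a (fun x => b x + t * ψ x) vg' va
      (fun j x => vb j x + t * partialD j ψ x) := by
  have hm : ContDiff ℝ (⊤ : ℕ∞) (fun x => Complex.exp (Complex.I * ((t * ψ x : ℝ) : ℂ))) :=
    (contDiff_const.mul (Complex.ofRealCLM.contDiff.comp (contDiff_const.mul hψ.smooth))).cexp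
  have hg := h.gradG.contDiffOn_mul isOpen_unitDisc hm.contDiffOn
  have hgt : ∀ x, Complex.exp (Complex.I * ((t * ψ x : ℝ) : ℂ)) * g x
      = _root_.phaseVariation g ψ t x := fun x => by
    rw [_root_.phaseVariation, mul_comm, Complex.ofReal_mul, mul_assoc]
  have hd : ∀ x j, partialD j (fun y => t * ψ y) x = t * partialD j ψ x := fun x j =>
    partialD_const_mul (hψ.differentiableAt x) t j
  have hb := h.zeroB.add_test (hψ.const_mul t)
  simp only [hd] at hb
  have hg' : WeakGradOn unitDisc (_root_.phaseVariation g ψ t) _ :=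
    hg.congr isOpen_unitDisc (Eventually.of_forall hgt) fun _ => ae_eq_refl _
  refine ⟨_, ?_, hg', h.gradA, hb, ?_, h.intA, h.mean⟩
  · filter_upwards [h.norm_eq] with x hx
    rw [← hgt, norm_mul, hx, mul_one, mul_comm, Complex.norm_exp_ofReal_mul_I]
  · filter_upwards [h.rel] with x hx j
    have e := partialD_exp_I_mul ((hψ.const_mul t).differentiableAt x) j
    have hf : hodgeField va (fun j x => vb j x + t * partialD j ψ x) j x
        = hodgeField va vb j x + t * partialD j ψ x := by
      fin_cases j
      · simp
        ring
      · simp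
        ring
    rw [hd] at e
    simp only [e, hx j, hf, ← hgt, Complex.real_smul]
    simp only [Complex.ofReal_add, Complex.ofReal_mul]
    ring

theorem isHodgePair_phaseVariation (h : HodgeData g a b vg va vb) (hp : IsHodgePair g a b)
    {ψ : ℂ → ℝ} (hψ : IsTest unitDisc ψ) (t : ℝ) :
    IsHodgePair (_root_.phaseVariation g ψ t) a (fun x => b x + t * ψ x) := by
  obtain ⟨q, hq, hq', ⟨hb, -⟩, ha, -⟩ := hp
  obtain ⟨vg', h'⟩ := h.phaseVariation hψ t
  exact h'.isHodgePair hq hq' (hb.add_test (hψ.const_mul t)) ha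

theorem hodgeField_add (va vb w : Fin 2 → ℂ → ℝ) (t : ℝ) (j : Fin 2) (x : ℂ) :
    hodgeField va (fun j x => vb j x + t * w j x) j x = hodgeField va vb j x + t * w j x := by
  fin_cases j
  · simp
    ring
  · simp
    ring

theorem density_add (a : ℂ → ℝ) (va vb w : Fin 2 → ℂ → ℝ) (t : ℝ) (x : ℂ) :
    density a va (fun j x => vb j x + t * w j x) x = density a va vb x
      + t * (∑ j, (sech (a x) ^ 2 * hodgeField va vb j x + vb j x) * w j x) / 2
      + t ^ 2 * (∑ j, (sech (a x) ^ 2 + 1) * w j x ^ 2) / 4 := by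
  simp only [density, hodgeField_add, Fin.sum_univ_two]
  ring

theorem density_nonneg (a : ℂ → ℝ) (va vb : Fin 2 → ℂ → ℝ) (x : ℂ) : 0 ≤ density a va vb x := by
  refine div_nonneg (add_nonneg (Finset.sum_nonneg fun j _ => ?_)
    (Finset.sum_nonneg fun j _ => ?_)) (by norm_num)
  · positivity
  · positivity

theorem integrable_density (h : HodgeData g a b vg va vb) (hp : IsHodgePair g a b)
    (hE : renormEnergy g < ∞) : Integrable (density a va vb) discMeasure := by
  rw [h.renormEnergy_eq hp] at hE
  have hm : AEStronglyMeasurable (density a va vb) discMeasure := by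
    refine AEMeasurable.aestronglyMeasurable ?_
    unfold density
    refine AEMeasurable.div_const (AEMeasurable.add ?_ ?_) 4
    · refine Finset.aemeasurable_fun_sum _ fun j _ => ?_
      exact (h.aestronglyMeasurable_sech.aemeasurable.pow_const 2).mul
        (((h.aestronglyMeasurable_va j).aemeasurable.pow_const 2).add
          ((h.aestronglyMeasurable_field j).aemeasurable.pow_const 2))
    · exact Finset.aemeasurable_fun_sum _ fun j _ =>
        (h.aestronglyMeasurable_vb j).aemeasurable.pow_const 2
  refine ⟨hm, ?_⟩
  rwa [hasFiniteIntegral_iff_ofReal (Eventually.of_forall fun x => density_nonneg _ _ _ x)]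

theorem memLp_two_of_sq_le {f d : ℂ → ℝ} (hf : AEStronglyMeasurable f discMeasure)
    (hd : Integrable d discMeasure) (h : ∀ x, f x ^ 2 ≤ 4 * d x) : MemLp f 2 discMeasure := by
  rw [memLp_two_iff_integrable_sq hf]
  refine (hd.const_mul 4).mono' (hf.pow 2) (Eventually.of_forall fun x => ?_)
  rw [Real.norm_of_nonneg (sq_nonneg _)]
  exact h x

/-- Finite energy controls sech(a)∇a, sech(a) ω and ∇b in L². At a vortex ∇a and ω themselves are
not square integrable, so the weights must be carried along. -/
theorem le_density (a : ℂ → ℝ) (va vb : Fin 2 → ℂ → ℝ) (j : Fin 2) (x : ℂ) :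
    (sech (a x) * va j x) ^ 2 ≤ 4 * density a va vb x ∧
    (sech (a x) * hodgeField va vb j x) ^ 2 ≤ 4 * density a va vb x ∧
    vb j x ^ 2 ≤ 4 * density a va vb x := by
  simp only [density, Fin.sum_univ_two]
  have h1 := fun i => mul_nonneg (sq_nonneg (sech (a x))) (sq_nonneg (va i x))
  have h2 := fun i => mul_nonneg (sq_nonneg (sech (a x))) (sq_nonneg (hodgeField va vb i x))
  have h3 := fun i => sq_nonneg (vb i x)
  have a0 := h1 0
  have a1 := h1 1
  have b0 := h2 0
  have b1 := h2 1
  have c0 := h3 0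
  have c1 := h3 1
  fin_cases j
  · simp only [Fin.zero_eta]
    refine ⟨?_, ?_, ?_⟩ <;> linarith
  · simp only [Fin.mk_one]
    refine ⟨?_, ?_, ?_⟩ <;> linarith

theorem memLp_sech_mul_va (h : HodgeData g a b vg va vb)
    (hd : Integrable (density a va vb) discMeasure) (j : Fin 2) :
    MemLp (fun x => sech (a x) * va j x) 2 discMeasure :=
  memLp_two_of_sq_le (h.aestronglyMeasurable_sech.mul (h.aestronglyMeasurable_va j)) hd
    fun x => (le_density a va vb j x).1

theorem memLp_sech_mul_field (h : HodgeData g a b vg va vb)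
    (hd : Integrable (density a va vb) discMeasure) (j : Fin 2) :
    MemLp (fun x => sech (a x) * hodgeField va vb j x) 2 discMeasure :=
  memLp_two_of_sq_le (h.aestronglyMeasurable_sech.mul (h.aestronglyMeasurable_field j)) hd
    fun x => (le_density a va vb j x).2.1

theorem memLp_vb (h : HodgeData g a b vg va vb)
    (hd : Integrable (density a va vb) discMeasure) (j : Fin 2) : MemLp (vb j) 2 discMeasure :=
  memLp_two_of_sq_le (h.aestronglyMeasurable_vb j) hd fun x => (le_density a va vb j x).2.2

theorem memLp_sech_mul (h : HodgeData g a b vg va vb) {f : ℂ → ℝ} (hf : MemLp f 2 discMeasure) :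
    MemLp (fun x => sech (a x) * f x) 2 discMeasure := by
  refine hf.mono (h.aestronglyMeasurable_sech.mul hf.aestronglyMeasurable)
    (Eventually.of_forall fun x => ?_)
  rw [norm_mul]
  exact mul_le_of_le_one_left (norm_nonneg _) (norm_sech_le _)

theorem memLp_firstVariation (h : HodgeData g a b vg va vb)
    (hd : Integrable (density a va vb) discMeasure) (j : Fin 2) :
    MemLp (fun x => (sech (a x) ^ 2 + 1) * vb j x) 2 discMeasure := by
  have := (h.memLp_sech_mul (h.memLp_sech_mul (h.memLp_vb hd j))).add (h.memLp_vb hd j)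
  refine this.ae_eq (Eventually.of_forall fun x => ?_)
  simp only [Pi.add_apply]
  ring

/-- The two integrands differ by sech²(a)∇^⊥a·∇ψ = ∇^⊥(tanh a)·∇ψ, whose integral is 0. -/
theorem integral_firstVariation (h : HodgeData g a b vg va vb)
    (hd : Integrable (density a va vb) discMeasure) {ψ : ℂ → ℝ} (hψ : IsTest unitDisc ψ) :
    ∫ x, ∑ j, (sech (a x) ^ 2 * hodgeField va vb j x + vb j x) * partialD j ψ x ∂discMeasure
      = ∫ x, ∑ j, ((sech (a x) ^ 2 + 1) * vb j x) * partialD j ψ x ∂discMeasure := by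
  have e := (h.gradA.tanh_comp isOpen_unitDisc).integral_disc_perp hψ
  have i1 : Integrable (fun x => ∑ j, ((sech (a x) ^ 2 + 1) * vb j x) * partialD j ψ x)
      discMeasure := integrable_finsetSum _ fun j _ =>
    integrable_mul_discMeasure (h.memLp_firstVariation hd j) (hψ.memLp_partialD j 2)
  have i0 : ∀ i j, Integrable (fun x => partialD i ψ x * (sech (a x) ^ 2 * va j x))
      discMeasure := fun i j =>
    (((hψ.partialD i).integrable_smul
      ((h.gradA.tanh_comp isOpen_unitDisc).locInt_grad j)).restrict :)
  have := integral_add i1 ((i0 1 0).sub (i0 0 1))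
  simp only [Pi.sub_apply] at this
  rw [e, add_zero] at this
  rw [← this]
  refine integral_congr_ae (Eventually.of_forall fun x => ?_)
  simp only [Fin.sum_univ_two, hodgeField_zero, hodgeField_one]
  ring

/-- As a is frozen, the density is quadratic in t, with every coefficient integrable. -/
theorem renormEnergy_phaseVariation (h : HodgeData g a b vg va vb) (hp : IsHodgePair g a b)
    (hd : Integrable (density a va vb) discMeasure) {ψ : ℂ → ℝ} (hψ : IsTest unitDisc ψ) :
    ∃ c d : ℝ, ∀ t : ℝ, renormEnergy (_root_.phaseVariation g ψ t) ≠ ∞ ∧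
      (renormEnergy (_root_.phaseVariation g ψ t)).toReal = c + t *
        ((∫ x, ∑ j, ((sech (a x) ^ 2 + 1) * vb j x) * partialD j ψ x ∂discMeasure) / 2)
        + t ^ 2 * d := by
  refine ⟨∫ x, density a va vb x ∂discMeasure,
    ∫ x, (∑ j, (sech (a x) ^ 2 + 1) * partialD j ψ x ^ 2) / 4 ∂discMeasure, fun t => ?_⟩
  obtain ⟨vg', h'⟩ := h.phaseVariation hψ t
  have hp' := h.isHodgePair_phaseVariation hp hψ t
  rw [h'.renormEnergy_eq hp', ← h.integral_firstVariation hd hψ]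
  have i1 : Integrable (fun x => t * ((∑ j, (sech (a x) ^ 2 * hodgeField va vb j x + vb j x) *
      partialD j ψ x) / 2)) discMeasure := by
    refine Integrable.const_mul (Integrable.div_const (integrable_finsetSum _ fun j _ => ?_) 2) t
    refine integrable_mul_discMeasure ?_ (hψ.memLp_partialD j 2)
    refine ((h.memLp_sech_mul (h.memLp_sech_mul_field hd j)).add (h.memLp_vb hd j)).ae_eq
      (Eventually.of_forall fun x => ?_)
    simp only [Pi.add_apply]
    ring
  have i2 : Integrable (fun x => t ^ 2 * ((∑ j, (sech (a x) ^ 2 + 1) * partialD j ψ x ^ 2) / 4))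
      discMeasure := by
    refine Integrable.const_mul (Integrable.div_const (integrable_finsetSum _ fun j _ => ?_) 4) _
    have m := hψ.memLp_partialD j 2
    refine (integrable_mul_discMeasure ((h.memLp_sech_mul (h.memLp_sech_mul m)).add m) m).congr
      (Eventually.of_forall fun x => ?_)
    simp only [Pi.add_apply]
    ring
  have i12 : Integrable (fun x => density a va vb x + t * ((∑ j, (sech (a x) ^ 2 *
      hodgeField va vb j x + vb j x) * partialD j ψ x) / 2)) discMeasure := hd.add i1
  have e : ∀ x, density a va (fun j x => vb j x + t * partialD j ψ x) x = density a va vb x + t *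
      ((∑ j, (sech (a x) ^ 2 * hodgeField va vb j x + vb j x) * partialD j ψ x) / 2)
      + t ^ 2 * ((∑ j, (sech (a x) ^ 2 + 1) * partialD j ψ x ^ 2) / 4) := fun x => by
    rw [density_add, mul_div_assoc, mul_div_assoc]
  have hi : Integrable (density a va (fun j x => vb j x + t * partialD j ψ x)) discMeasure :=
    (i12.add i2).congr (Eventually.of_forall fun x => (e x).symm)
  rw [← ofReal_integral_eq_lintegral_ofReal hi
    (Eventually.of_forall fun x => density_nonneg _ _ _ x), ENNReal.toReal_ofReal
    (integral_nonneg fun x => density_nonneg _ _ _ x)]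
  refine ⟨ENNReal.ofReal_ne_top, ?_⟩
  rw [integral_congr_ae (Eventually.of_forall e), integral_add i12 i2, integral_add hd i1,
    integral_const_mul, integral_const_mul, integral_div]

theorem isCritical_iff_integral (h : HodgeData g a b vg va vb) (hp : IsHodgePair g a b)
    (hd : Integrable (density a va vb) discMeasure) :
    IsCriticalForRenormEnergy g ↔ ∀ ψ, IsTest unitDisc ψ →
      ∫ x, ∑ j, ((sech (a x) ^ 2 + 1) * vb j x) * partialD j ψ x ∂discMeasure = 0 := by
  simp only [IsCriticalForRenormEnergy, isDiscTest_iff]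
  refine forall₂_congr fun ψ hψ => ?_
  obtain ⟨c, d, hcd⟩ := h.renormEnergy_phaseVariation hp hd hψ
  set e := ∫ x, ∑ j, ((sech (a x) ^ 2 + 1) * vb j x) * partialD j ψ x ∂discMeasure
  have hder : HasDerivAt (fun t : ℝ => (renormEnergy (_root_.phaseVariation g ψ t)).toReal)
      (e / 2) 0 := by
    simp only [fun t => (hcd t).2]
    have h1 : HasDerivAt (fun t : ℝ => c + t * (e / 2) + t ^ 2 * d) _ 0 :=
      (((hasDerivAt_id (0 : ℝ)).mul_const (e / 2)).const_add c).add
        (((hasDerivAt_id (0 : ℝ)).pow 2).mul_const d)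
    simpa using h1
  constructor
  · rintro ⟨-, h0⟩
    have := hder.unique h0
    linarith
  · intro h0
    refine ⟨Eventually.of_forall fun t => (hcd t).1, ?_⟩
    rw [h0, zero_div] at hder
    exact hder

theorem isCritical_iff (h : HodgeData g a b vg va vb) (hp : IsHodgePair g a b)
    (hd : Integrable (density a va vb) discMeasure) :
    IsCriticalForRenormEnergy g ↔ b =ᵐ[discMeasure] 0 := by
  rw [h.isCritical_iff_integral hp hd]
  constructor
  · intro h0
    -- Criticality is tested with b itself; the result is the integral of (sech²(a) + 1)|∇b|².
    have e := h.zeroB.integral_eq_zero (h.memLp_vb hd) (h.memLp_firstVariation hd) h0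
    have hnn : ∀ x, 0 ≤ ∑ j, (sech (a x) ^ 2 + 1) * vb j x * vb j x := fun x =>
      Finset.sum_nonneg fun j _ => by
        rw [mul_assoc]
        exact mul_nonneg (by positivity) (mul_self_nonneg _)
    rw [integral_eq_zero_iff_of_nonneg hnn (integrable_finsetSum _ fun j _ =>
      integrable_mul_discMeasure (h.memLp_firstVariation hd j) (h.memLp_vb hd j))] at e
    refine h.ae_eq_zero_of_grad fun j => ?_
    filter_upwards [e] with x hx
    rw [Pi.zero_apply, Finset.sum_eq_zero_iff_of_nonneg fun j _ => by
      rw [mul_assoc]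
      exact mul_nonneg (by positivity) (mul_self_nonneg _)] at hx
    have := hx j (Finset.mem_univ j)
    rw [mul_assoc, mul_eq_zero] at this
    rcases this with h1 | h1
    · have : 0 < sech (a x) ^ 2 + 1 := by positivity
      exact absurd h1 this.ne'
    · exact mul_self_eq_zero.1 h1
  · intro hb ψ hψ
    refine integral_eq_zero_of_ae ?_
    filter_upwards [h.grad_eq_zero_of_ae_eq_zero hb 0,
      h.grad_eq_zero_of_ae_eq_zero hb 1] with x h0 h1
    simp [h0, h1]

end HodgeData

end Variation

/-! ### Conformal harmonic lifts -/

section Conformal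

/-- Conformality yields |∇b|² = -2∇^⊥a·∇b pointwise. After multiplication by sech²(a) the right side
is a divergence free field against ∇b, so ∫sech²(a)|∇b|² = 0. -/
theorem HodgeData.ae_eq_zero_of_conformal {g : ℂ → ℂ} {a b : ℂ → ℝ} {vg : Fin 2 → ℂ → ℂ}
    {va vb : Fin 2 → ℂ → ℝ} (h : HodgeData g a b vg va vb)
    (hd : Integrable (HodgeData.density a va vb) discMeasure)
    (hc : IsConformalHarmonicToSphere (sphereLift g a)) : b =ᵐ[discMeasure] 0 := by
  obtain ⟨U, hU, hUs, hUc⟩ := hc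
  have hgrad : ∀ j, liftGrad g a va vb j =ᵐ[discMeasure] partialD j U :=
    h.weakGradOn_sphereLift.unique isOpen_unitDisc
      (WeakGradOn.of_contDiffOn isOpen_unitDisc hUs) hU
  have hpt : ∀ᵐ x ∂discMeasure, ∑ j, vb j x * vb j x
      = -2 * (-va 1 x * vb 0 x + va 0 x * vb 1 x) := by
    filter_upwards [hgrad 0, hgrad 1, h.inner_liftGrad, ae_restrict_mem measurableSet_unitDisc]
      with x h0 h1 hi hx
    obtain ⟨-, -, hn, hin⟩ := hUc x hx
    rw [← h0, ← h1] at hn hin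
    have e := congrArg (· ^ 2) hn
    simp only [← real_inner_self_eq_norm_sq] at e
    rw [hi 0 0, hi 1 1] at e
    rw [hi 0 1] at hin
    have hs : sech (a x) ^ 2 ≠ 0 := (pow_pos (sech_pos _) 2).ne'
    have e1 := mul_left_cancel₀ hs e
    have e2 := (mul_eq_zero.1 hin).resolve_left hs
    simp only [hodgeField_zero, hodgeField_one] at e1 e2
    simp only [Fin.sum_univ_two]
    set p := vb 0 x
    set q := vb 1 x
    set s := va 0 x
    set t := va 1 x
    -- The two conformality equations are the real and imaginary parts of (p + iq)((p - 2t) + i(q +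
    -- 2s)) = 0; this is the squared modulus.
    have key : (p * p + q * q) * ((p - 2 * t) ^ 2 + (q + 2 * s) ^ 2) = 0 := by
      have k1 : p * (p - 2 * t) - q * (q + 2 * s) = 0 := by linarith
      have k2 : p * (q + 2 * s) + q * (p - 2 * t) = 0 := by linarith
      linear_combination (p * (p - 2 * t) - q * (q + 2 * s)) * k1
        + (p * (q + 2 * s) + q * (p - 2 * t)) * k2
    rcases mul_eq_zero.1 key with k | k
    · have hp : p = 0 := by nlinarith [mul_self_nonneg p, mul_self_nonneg q]
      have hq : q = 0 := by nlinarith [mul_self_nonneg p, mul_self_nonneg q]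
      simp [hp, hq]
    · have hp : p - 2 * t = 0 := by nlinarith [sq_nonneg (p - 2 * t), sq_nonneg (q + 2 * s)]
      have hq : q + 2 * s = 0 := by nlinarith [sq_nonneg (p - 2 * t), sq_nonneg (q + 2 * s)]
      linear_combination p * hp + q * hq
  -- This is ∇^⊥ tanh a; the two factors sech are kept apart so that the L² bound for sech(a)∇a
  -- applies.
  set X : Fin 2 → ℂ → ℝ :=
    ![fun x => sech (a x) * (sech (a x) * -va 1 x), fun x => sech (a x) * (sech (a x) * va 0 x)]
    with hX
  have hXm : ∀ j, MemLp (X j) 2 discMeasure := by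
    intro j
    fin_cases j
    · refine h.memLp_sech_mul ((h.memLp_sech_mul_va hd 1).neg.ae_eq
        (Eventually.of_forall fun x => ?_))
      simp
    · exact h.memLp_sech_mul (h.memLp_sech_mul_va hd 0)
  have e := h.zeroB.integral_eq_zero (h.memLp_vb hd) hXm fun φ hφ => by
    rw [← (h.gradA.tanh_comp isOpen_unitDisc).integral_disc_perp hφ]
    refine integral_congr_ae (Eventually.of_forall fun x => ?_)
    simp only [hX, Fin.sum_univ_two, Matrix.cons_val_zero, Matrix.cons_val_one]
    ring
  have e2 : ∫ x, ∑ j, (sech (a x) * vb j x) ^ 2 ∂discMeasure = 0 := by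
    have : ∫ x, ∑ j, (sech (a x) * vb j x) ^ 2 ∂discMeasure
        = -2 * ∫ x, ∑ j, X j x * vb j x ∂discMeasure := by
      rw [← integral_const_mul]
      refine integral_congr_ae ?_
      filter_upwards [hpt] with x hx
      simp only [hX, Fin.sum_univ_two, Matrix.cons_val_zero, Matrix.cons_val_one] at hx ⊢
      linear_combination sech (a x) ^ 2 * hx
    rw [this, e, mul_zero]
  rw [integral_eq_zero_iff_of_nonneg (fun x => Finset.sum_nonneg fun j _ => sq_nonneg _)
    (integrable_finsetSum _ fun j _ => (h.memLp_sech_mul (h.memLp_vb hd j)).integrable_sq)] at e2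
  refine h.ae_eq_zero_of_grad fun j => ?_
  filter_upwards [e2] with x hx
  rw [Pi.zero_apply, Finset.sum_eq_zero_iff_of_nonneg fun j _ => sq_nonneg _] at hx
  exact (mul_eq_zero.1 (pow_eq_zero_iff two_ne_zero |>.1 (hx j (Finset.mem_univ j)))).resolve_left
    (sech_pos _).ne'

/-- `U` is smooth at `x` and satisfies at `x` the equations of a conformal harmonic map into the
sphere. -/
structure ConformalHarmonicAt (U : ℂ → EuclideanSpace ℝ (Fin 3)) (x : ℂ) : Prop where
  smooth : ContDiffAt ℝ (⊤ : ℕ∞) U x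
  norm_eq : ‖U x‖ = 1
  harmonic : -(Laplacian.laplacian U x) = (∑ j, ‖partialD j U x‖ ^ 2) • U x
  norm_partialD : ‖partialD 0 U x‖ = ‖partialD 1 U x‖
  inner_partialD : inner ℝ (partialD 0 U x) (partialD 1 U x) = 0

theorem partialD_congr {F : Type*} [NormedAddCommGroup F] [NormedSpace ℝ F] {f k : ℂ → F} {x : ℂ}
    (h : f =ᶠ[𝓝 x] k) (j : Fin 2) : partialD j f x = partialD j k x := by
  simp only [partialD, h.fderiv_eq]

theorem ConformalHarmonicAt.congr {U V : ℂ → EuclideanSpace ℝ (Fin 3)} {x : ℂ}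
    (h : ConformalHarmonicAt U x) (e : V =ᶠ[𝓝 x] U) : ConformalHarmonicAt V x := by
  refine ⟨h.smooth.congr_of_eventuallyEq e, ?_, ?_, ?_, ?_⟩
  · rw [e.self_of_nhds, h.norm_eq]
  · rw [(InnerProductSpace.laplacian_congr_nhds e).self_of_nhds, e.self_of_nhds, h.harmonic]
    simp only [partialD_congr e]
  · simp only [partialD_congr e, h.norm_partialD]
  · simp only [partialD_congr e, h.inner_partialD]

/-- Linear isometries preserve every equation involved. At a pole this permits passing from f to
1/f. -/
theorem ConformalHarmonicAt.comp_isometry {U : ℂ → EuclideanSpace ℝ (Fin 3)} {x : ℂ}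
    (h : ConformalHarmonicAt U x)
    (R : EuclideanSpace ℝ (Fin 3) →ₗᵢ[ℝ] EuclideanSpace ℝ (Fin 3)) :
    ConformalHarmonicAt (fun y => R (U y)) x := by
  have hd : ∀ j, partialD j (fun y => R (U y)) x = R (partialD j U x) := fun j =>
    partialD_clm_comp R.toContinuousLinearMap (h.smooth.differentiableAt (by simp)) j
  refine ⟨R.toContinuousLinearMap.contDiff.contDiffAt.comp x h.smooth, ?_, ?_, ?_, ?_⟩
  · rw [R.norm_map, h.norm_eq]
  · have := (h.smooth.of_le two_le_smooth).laplacian_CLM_comp_left (l := R.toContinuousLinearMap)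
    have e : Laplacian.laplacian (fun y => R (U y)) x = R (Laplacian.laplacian U x) := this
    simp only [e, hd, R.norm_map]
    rw [← map_neg, h.harmonic, map_smul]
  · rw [hd, hd, R.norm_map, R.norm_map, h.norm_partialD]
  · rw [hd, hd, R.inner_map_map, h.inner_partialD]

/-! ### Inverse stereographic projection along curves and holomorphic maps. -/

theorem hasDerivAt_line {F : Type*} [NormedAddCommGroup F] [NormedSpace ℝ F] {f : ℂ → F} {x : ℂ}
    (h : DifferentiableAt ℝ f x) (j : Fin 2) :
    HasDerivAt (fun t : ℝ => f (x + t • coordDir j)) (partialD j f x) 0 := by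
  have h1 : HasDerivAt (fun t : ℝ => x + t • coordDir j) (coordDir j) 0 := by
    simpa using ((hasDerivAt_id (0 : ℝ)).smul_const (coordDir j)).const_add x
  have h2 : HasFDerivAt f (fderiv ℝ f x) (x + (0 : ℝ) • coordDir j) := by
    simpa using h.hasFDerivAt
  exact h2.comp_hasDerivAt (0 : ℝ) h1

theorem HasDerivAt.ofPlaneAxis {Z : ℝ → ℂ} {s : ℝ → ℝ} {Z' : ℂ} {s' t : ℝ}
    (hZ : HasDerivAt Z Z' t) (hs : HasDerivAt s s' t) :
    HasDerivAt (fun t => ofPlaneAxis (Z t) (s t)) (ofPlaneAxis Z' s') t := by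
  have h := (planeCLM.hasFDerivAt.comp_hasDerivAt t hZ).sub
    (axisCLM.hasFDerivAt.comp_hasDerivAt t hs.neg)
  have e : ∀ z r, _root_.ofPlaneAxis z r = planeCLM z - axisCLM (-r) := fun z r => by
    rw [planeCLM_sub_axisCLM, neg_neg]
  simp only [e]
  exact h

/-- In terms of r = (1 + |w|²)⁻¹ all components are polynomial, and the later identities reduce to
r(1 + |w|²) = 1. -/
theorem invStereo_eq (w : ℂ) :
    invStereo w = ofPlaneAxis ((2 * (1 + ‖w‖ ^ 2)⁻¹) • w) (2 * (1 + ‖w‖ ^ 2)⁻¹ - 1) := by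
  have h0 : 1 + ‖w‖ ^ 2 ≠ 0 := by positivity
  rw [invStereo, ofPlaneAxis, Complex.smul_re, Complex.smul_im, smul_eq_mul, smul_eq_mul]
  congr 1
  ext i
  fin_cases i
  · simp
    ring
  · simp
    ring
  · simp
    field_simp
    ring

/-- The derivative of the inverse stereographic projection at `w` in direction `p`. -/
noncomputable def invStereoDeriv (w p : ℂ) : EuclideanSpace ℝ (Fin 3) :=
  ofPlaneAxis ((2 * (1 + ‖w‖ ^ 2)⁻¹) • p - (4 * inner ℝ w p * ((1 + ‖w‖ ^ 2)⁻¹) ^ 2) • w)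
    (-(4 * inner ℝ w p * ((1 + ‖w‖ ^ 2)⁻¹) ^ 2))

/-- The second derivative of the inverse stereographic projection along a curve with position `w`,
velocity `p` and acceleration `q`. -/
noncomputable def invStereoDerivTwo (w p q : ℂ) : EuclideanSpace ℝ (Fin 3) :=
  ofPlaneAxis ((2 * (1 + ‖w‖ ^ 2)⁻¹) • q - (8 * inner ℝ w p * ((1 + ‖w‖ ^ 2)⁻¹) ^ 2) • p
      - (4 * (‖p‖ ^ 2 + inner ℝ w q) * ((1 + ‖w‖ ^ 2)⁻¹) ^ 2
        - 16 * inner ℝ w p ^ 2 * ((1 + ‖w‖ ^ 2)⁻¹) ^ 3) • w)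
    (-(4 * (‖p‖ ^ 2 + inner ℝ w q) * ((1 + ‖w‖ ^ 2)⁻¹) ^ 2
        - 16 * inner ℝ w p ^ 2 * ((1 + ‖w‖ ^ 2)⁻¹) ^ 3))

theorem hasDerivAt_inv_one_add_norm_sq {w : ℝ → ℂ} {p : ℂ} {t : ℝ} (hw : HasDerivAt w p t) :
    HasDerivAt (fun t => (1 + ‖w t‖ ^ 2)⁻¹) (-(2 * inner ℝ (w t) p) * ((1 + ‖w t‖ ^ 2)⁻¹) ^ 2)
      t := by
  have h0 : 1 + ‖w t‖ ^ 2 ≠ 0 := by positivity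
  refine ((hw.norm_sq.const_add 1).inv h0).congr_deriv ?_
  field_simp

theorem HasDerivAt.invStereo {w : ℝ → ℂ} {p : ℂ} {t : ℝ} (hw : HasDerivAt w p t) :
    HasDerivAt (fun t => invStereo (w t)) (invStereoDeriv (w t) p) t := by
  have h1 := (hasDerivAt_inv_one_add_norm_sq hw).const_mul 2
  have h2 := (h1.smul hw).ofPlaneAxis (h1.sub_const 1)
  simp only [invStereo_eq]
  refine h2.congr_deriv ?_
  rw [invStereoDeriv]
  congr 1
  · module
  · ring

theorem HasDerivAt.invStereoDeriv {w p : ℝ → ℂ} {q : ℂ} {t : ℝ} (hw : HasDerivAt w (p t) t)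
    (hp : HasDerivAt p q t) :
    HasDerivAt (fun t => invStereoDeriv (w t) (p t)) (invStereoDerivTwo (w t) (p t) q) t := by
  have h1 := hasDerivAt_inv_one_add_norm_sq hw
  have h3 : HasDerivAt (fun t => 4 * Inner.inner ℝ (w t) (p t) * ((1 + ‖w t‖ ^ 2)⁻¹) ^ 2) _ t :=
    ((hw.inner ℝ hp).const_mul 4).mul (h1.pow 2)
  have h2 := (((h1.const_mul 2).smul hp).sub (h3.smul hw)).ofPlaneAxis h3.neg
  refine h2.congr_deriv ?_
  rw [invStereoDerivTwo, real_inner_self_eq_norm_sq]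
  congr 1
  · push_cast
    module
  · push_cast
    ring

theorem real_inner_complex (w z : ℂ) : inner ℝ w z = w.re * z.re + w.im * z.im := by
  rw [Complex.inner]
  simp
  ring

theorem inner_invStereoDeriv (w p q : ℂ) :
    inner ℝ (invStereoDeriv w p) (invStereoDeriv w q)
      = 4 * ((1 + ‖w‖ ^ 2)⁻¹) ^ 2 * inner ℝ p q := by
  have h0 : 1 + ‖w‖ ^ 2 ≠ 0 := by positivity
  have hr : (1 + ‖w‖ ^ 2)⁻¹ * (1 + (w.re ^ 2 + w.im ^ 2)) = 1 := by
    have : ‖w‖ ^ 2 = w.re ^ 2 + w.im ^ 2 := by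
      rw [Complex.sq_norm, Complex.normSq_apply]
      ring
    rw [← this, inv_mul_cancel₀ h0]
  rw [invStereoDeriv, invStereoDeriv, inner_ofPlaneAxis]
  simp only [real_inner_complex, Complex.sub_re, Complex.sub_im, Complex.smul_re, Complex.smul_im,
    smul_eq_mul]
  set r := (1 + ‖w‖ ^ 2)⁻¹
  linear_combination (16 * r ^ 3 * (w.re * p.re + w.im * p.im) * (w.re * q.re + w.im * q.im)) * hr

theorem norm_invStereo (w : ℂ) : ‖invStereo w‖ = 1 := by
  have h0 : 1 + ‖w‖ ^ 2 ≠ 0 := by positivity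
  have hw : ‖w‖ ^ 2 = w.re ^ 2 + w.im ^ 2 := by
    rw [Complex.sq_norm, Complex.normSq_apply]
    ring
  have hr : (1 + ‖w‖ ^ 2)⁻¹ * (1 + (w.re ^ 2 + w.im ^ 2)) = 1 := by
    rw [← hw, inv_mul_cancel₀ h0]
  have : ‖invStereo w‖ ^ 2 = 1 := by
    rw [invStereo_eq, norm_sq_ofPlaneAxis]
    simp only [Complex.smul_re, Complex.smul_im, smul_eq_mul]
    set r := (1 + ‖w‖ ^ 2)⁻¹
    linear_combination 4 * r * hr
  exact (pow_eq_one_iff_of_nonneg (norm_nonneg _) two_ne_zero).1 this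

theorem contDiff_invStereo : ContDiff ℝ (⊤ : ℕ∞) invStereo := by
  have h1 : ContDiff ℝ (⊤ : ℕ∞) fun w : ℂ => 2 * (1 + ‖w‖ ^ 2)⁻¹ :=
    contDiff_const.mul ((contDiff_const.add (contDiff_norm_sq ℝ)).inv fun w => by positivity)
  have e : invStereo = fun w : ℂ => planeCLM ((2 * (1 + ‖w‖ ^ 2)⁻¹) • w)
      - axisCLM (-(2 * (1 + ‖w‖ ^ 2)⁻¹ - 1)) := by
    funext w
    rw [invStereo_eq, planeCLM_sub_axisCLM, neg_neg]
  rw [e]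
  exact (planeCLM.contDiff.comp (h1.smul contDiff_id)).sub
    (axisCLM.contDiff.comp (h1.sub contDiff_const).neg)

theorem partialD_of_differentiableAt {F : ℂ → ℂ} {x : ℂ} (h : DifferentiableAt ℂ F x)
    (j : Fin 2) : partialD j F x = deriv F x * coordDir j := by
  rw [partialD, (h.hasDerivAt.hasFDerivAt.restrictScalars ℝ).fderiv]
  simp [mul_comm]

theorem partialD_invStereo_comp {F : ℂ → ℂ} {x : ℂ} (h : DifferentiableAt ℂ F x) (j : Fin 2) :
    partialD j (fun y => invStereo (F y)) x = invStereoDeriv (F x) (deriv F x * coordDir j) := by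
  have hR : DifferentiableAt ℝ F x := h.restrictScalars ℝ
  have h1 := (hasDerivAt_line hR j).invStereo
  have h2 := hasDerivAt_line (f := fun y => invStereo (F y))
    ((contDiff_invStereo.differentiable (by simp) _).comp x hR) j
  have := h2.unique h1
  simpa [partialD_of_differentiableAt h] using this

theorem ofPlaneAxis_add (z w : ℂ) (s t : ℝ) :
    ofPlaneAxis (z + w) (s + t) = ofPlaneAxis z s + ofPlaneAxis w t := by
  ext i
  fin_cases i <;> simp [ofPlaneAxis]

theorem ofPlaneAxis_neg (z : ℂ) (s : ℝ) : ofPlaneAxis (-z) (-s) = -ofPlaneAxis z s := by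
  ext i
  fin_cases i <;> simp [ofPlaneAxis]

theorem ofPlaneAxis_smul (c : ℝ) (z : ℂ) (s : ℝ) :
    ofPlaneAxis (c • z) (c * s) = c • ofPlaneAxis z s := by
  ext i
  fin_cases i <;> simp [ofPlaneAxis]

/-- For holomorphic F the velocities in directions 1 and i are p and ip and the accelerations are q
and -q. In the sum the q terms cancel, leaving |∇u|² u. -/
theorem neg_invStereoDerivTwo_add (w p q : ℂ) :
    -(invStereoDerivTwo w p q + invStereoDerivTwo w (p * Complex.I) (-q))
      = (8 * ((1 + ‖w‖ ^ 2)⁻¹) ^ 2 * ‖p‖ ^ 2) • invStereo w := by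
  have h0 : 1 + ‖w‖ ^ 2 ≠ 0 := by positivity
  have hw : ∀ z : ℂ, ‖z‖ ^ 2 = z.re ^ 2 + z.im ^ 2 := fun z => by
    rw [Complex.sq_norm, Complex.normSq_apply]
    ring
  have hr : (1 + ‖w‖ ^ 2)⁻¹ * (1 + (w.re ^ 2 + w.im ^ 2)) = 1 := by
    rw [← hw, inv_mul_cancel₀ h0]
  have hpI : ‖p * Complex.I‖ = ‖p‖ := by simp
  rw [invStereoDerivTwo, invStereoDerivTwo, invStereo_eq, hpI]
  set r := (1 + ‖w‖ ^ 2)⁻¹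
  simp only [real_inner_complex, hw p, Complex.mul_re, Complex.mul_im, Complex.I_re, Complex.I_im,
    Complex.neg_re, Complex.neg_im]
  rw [← ofPlaneAxis_add, ← ofPlaneAxis_neg, ← ofPlaneAxis_smul]
  congr 1
  · apply Complex.ext
    · simp only [Complex.neg_re, Complex.add_re, Complex.sub_re, Complex.smul_re, smul_eq_mul,
        Complex.mul_re, Complex.I_re, Complex.I_im]
      linear_combination (-16 * r ^ 2 * (p.re ^ 2 + p.im ^ 2) * w.re) * hr
    · simp only [Complex.neg_im, Complex.add_im, Complex.sub_im, Complex.smul_im, smul_eq_mul,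
        Complex.mul_im, Complex.I_re, Complex.I_im]
      linear_combination (-16 * r ^ 2 * (p.re ^ 2 + p.im ^ 2) * w.im) * hr
  · linear_combination (-16 * r ^ 2 * (p.re ^ 2 + p.im ^ 2)) * hr

/-- The partial derivatives of F are F' and iF', orthogonal and of equal length, and the projection
is conformal (`inner_invStereoDeriv`). The Laplacian is the sum of the second derivatives along the
two coordinate lines. -/
theorem conformalHarmonicAt_invStereo_comp {F : ℂ → ℂ} {x : ℂ} (h : AnalyticAt ℂ F x) :
    ConformalHarmonicAt (fun y => invStereo (F y)) x := by
  have hev : ∀ᶠ y in 𝓝 x, DifferentiableAt ℂ F y :=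
    h.eventually_analyticAt.mono fun y hy => hy.differentiableAt
  have hsm : ContDiffAt ℝ (⊤ : ℕ∞) (fun y => invStereo (F y)) x :=
    contDiff_invStereo.contDiffAt.comp x (h.contDiffAt.restrict_scalars ℝ)
  have hd := partialD_invStereo_comp h.differentiableAt
  have hd1 : DifferentiableAt ℂ (deriv F) x := h.deriv.differentiableAt
  have hdd : ∀ j, partialD j (partialD j fun y => invStereo (F y)) x
      = invStereoDerivTwo (F x) (deriv F x * coordDir j)
        (deriv (deriv F) x * coordDir j * coordDir j) := by
    intro j
    have e : partialD j (fun y => invStereo (F y)) =ᶠ[𝓝 x]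
        fun y => invStereoDeriv (F y) (deriv F y * coordDir j) :=
      hev.mono fun y hy => partialD_invStereo_comp hy j
    have hp := ((hasDerivAt_line (hd1.restrictScalars ℝ) j).mul_const (coordDir j))
    have hw := hasDerivAt_line (h.differentiableAt.restrictScalars ℝ) j
    rw [partialD_of_differentiableAt h.differentiableAt] at hw
    rw [partialD_of_differentiableAt hd1] at hp
    have h1 := HasDerivAt.invStereoDeriv (w := fun t : ℝ => F (x + t • coordDir j))
      (p := fun t : ℝ => deriv F (x + t • coordDir j) * coordDir j) (t := 0) (by simpa using hw) hp
    have hds : DifferentiableAt ℝ (partialD j fun y => invStereo (F y)) x :=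
      (hsm.fderiv_right (m := 1) two_le_smooth).differentiableAt one_ne_zero |>.clm_apply
        (differentiableAt_const _)
    rw [partialD_congr e]
    have h2 := hasDerivAt_line (hds.congr_of_eventuallyEq e.symm) j
    simpa using h2.unique h1
  have hc0 : coordDir 0 = 1 := rfl
  have hc1 : coordDir 1 = Complex.I := rfl
  have hnorm : ∀ j, ‖partialD j (fun y => invStereo (F y)) x‖ ^ 2
      = 4 * ((1 + ‖F x‖ ^ 2)⁻¹) ^ 2 * ‖deriv F x‖ ^ 2 := fun j => by
    rw [hd, ← real_inner_self_eq_norm_sq, inner_invStereoDeriv, real_inner_self_eq_norm_sq,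
      norm_mul, norm_coordDir, mul_one]
  refine ⟨hsm, norm_invStereo _, ?_, ?_, ?_⟩
  · rw [laplacian_eq_partialD (hsm.of_le two_le_smooth)]
    simp only [Fin.sum_univ_two, hdd, hc0, hc1, hnorm, mul_one]
    rw [mul_assoc (deriv (deriv F) x), Complex.I_mul_I, mul_neg_one, neg_invStereoDerivTwo_add]
    congr 1
    ring
  · have := (hnorm 0).trans (hnorm 1).symm
    exact (sq_eq_sq₀ (norm_nonneg _) (norm_nonneg _)).1 this
  · rw [hd, hd, inner_invStereoDeriv, hc0, hc1, real_inner_complex]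
    simp
    ring_nf
    simp

/-- The rotation of `ℝ³` which corresponds to the inversion of `ℂ`. -/
noncomputable def axisFlip : EuclideanSpace ℝ (Fin 3) →ₗᵢ[ℝ] EuclideanSpace ℝ (Fin 3) where
  toFun v := !₂[v 0, -v 1, -v 2]
  map_add' v w := by
    ext i
    fin_cases i <;> simp <;> ring
  map_smul' c v := by
    ext i
    fin_cases i <;> simp
  norm_map' v := by
    simp [EuclideanSpace.norm_eq, Fin.sum_univ_three]

theorem axisFlip_invStereo_inv {w : ℂ} (hw : w ≠ 0) :
    axisFlip (invStereo w⁻¹) = invStereo w := by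
  have hn : Complex.normSq w ≠ 0 := fun h => hw (Complex.normSq_eq_zero.1 h)
  have h1 : ‖w⁻¹‖ ^ 2 = (Complex.normSq w)⁻¹ := by
    rw [norm_inv, inv_pow, Complex.sq_norm]
  have h2 : 0 ≤ Complex.normSq w := Complex.normSq_nonneg w
  have h3 : 1 + Complex.normSq w ≠ 0 := by positivity
  have h4 : 1 + (Complex.normSq w)⁻¹ ≠ 0 := by positivity
  ext i
  simp only [axisFlip, invStereo, h1, Complex.sq_norm, Complex.inv_re, Complex.inv_im]
  fin_cases i
  · simp
    field_simp
    ring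
  · simp
    field_simp
    ring
  · simp
    field_simp
    ring

end Conformal

/-! ### The logarithm as a fundamental solution -/

section Logarithm

/-- In polar coordinates the integrand becomes r log r, which is continuous at 0. -/
theorem locallyIntegrable_log_norm : LocallyIntegrable (fun x : ℂ => Real.log ‖x‖) volume := by
  rw [locallyIntegrable_iff]
  intro K hK
  obtain ⟨R, hR⟩ := hK.isBounded.subset_ball (0 : ℂ)
  refine IntegrableOn.mono_set ?_ hR
  rw [integrableOn_fun_norm_addHaar volume (f := Real.log)]
  have h1 : IntegrableOn (fun y : ℝ => y * Real.log y) (Set.Icc 0 R) :=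
    Real.continuous_mul_log.continuousOn.integrableOn_compact isCompact_Icc
  simpa using h1.mono_set Set.Ioo_subset_Icc_self

/-- The radial derivative in polar coordinates. -/
noncomputable def radialDeriv (φ : ℂ → ℝ) (p : ℝ × ℝ) : ℝ :=
  fderiv ℝ φ (Complex.polarCoord.symm p) (Complex.polarCoord.symm (1, p.2))

theorem Complex.continuous_polarCoord_symm : Continuous fun p : ℝ × ℝ => Complex.polarCoord.symm p := by
  simp only [Complex.polarCoord_symm_apply]
  fun_prop

theorem polarCoord_symm_eq_smul (r θ : ℝ) :
    Complex.polarCoord.symm (r, θ) = r • Complex.polarCoord.symm (1, θ) := by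
  simp [Complex.polarCoord_symm_apply]
  ring

theorem norm_polarCoord_symm_one (θ : ℝ) : ‖Complex.polarCoord.symm (1, θ)‖ = 1 := by
  simp

theorem continuous_radialDeriv {Ω : Set ℂ} {φ : ℂ → ℝ} (hφ : IsTest Ω φ) :
    Continuous (radialDeriv φ) := by
  have h1 : Continuous fun p : ℝ × ℝ => fderiv ℝ φ (Complex.polarCoord.symm p) :=
    (hφ.smooth.continuous_fderiv (by simp)).comp Complex.continuous_polarCoord_symm
  have h2 : Continuous fun p : ℝ × ℝ => ((1 : ℝ), p.2) := continuous_const.prodMk continuous_snd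
  exact h1.clm_apply (Complex.continuous_polarCoord_symm.comp h2)

theorem integrableOn_radialDeriv {Ω : Set ℂ} {φ : ℂ → ℝ} (hφ : IsTest Ω φ) :
    IntegrableOn (radialDeriv φ) (Set.Ioi 0 ×ˢ Set.Ioo (-Real.pi) Real.pi) := by
  obtain ⟨R, hR⟩ := (hφ.compact.fderiv ℝ).isCompact.isBounded.subset_closedBall (0 : ℂ)
  have h1 : IntegrableOn (radialDeriv φ) (Set.Icc 0 R ×ˢ Set.Icc (-Real.pi) Real.pi) :=
    (continuous_radialDeriv hφ).continuousOn.integrableOn_compact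
      (isCompact_Icc.prod isCompact_Icc)
  refine h1.of_forall_sdiff_eq_zero (measurableSet_Ioi.prod measurableSet_Ioo) ?_
  rintro ⟨r, θ⟩ ⟨⟨hr, hθ⟩, hn⟩
  have hr' : R < r := by
    by_contra hc
    exact hn ⟨⟨le_of_lt hr, not_lt.1 hc⟩, Set.Ioo_subset_Icc_self hθ⟩
  have : Complex.polarCoord.symm (r, θ) ∉ tsupport (fderiv ℝ φ) := fun hm => by
    have := hR hm
    rw [mem_closedBall_zero_iff, polarCoord_symm_eq_smul, norm_smul, norm_polarCoord_symm_one,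
      mul_one, Real.norm_of_nonneg (le_of_lt hr)] at this
    linarith
  rw [radialDeriv, image_eq_zero_of_notMem_tsupport this, _root_.zero_apply]

/-- Each ray contributes -φ(0) by the fundamental theorem of calculus, and the angles have total
length 2π. -/
theorem integral_radialDeriv {Ω : Set ℂ} {φ : ℂ → ℝ} (hφ : IsTest Ω φ) :
    ∫ p in Set.Ioi 0 ×ˢ Set.Ioo (-Real.pi) Real.pi, radialDeriv φ p = -(2 * Real.pi * φ 0) := by
  have hi := integrableOn_radialDeriv hφ
  rw [Measure.volume_eq_prod] at hi ⊢
  rw [IntegrableOn, ← Measure.prod_restrict] at hi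
  rw [← Measure.prod_restrict, integral_prod_symm _ hi]
  have key : ∀ θ : ℝ, ∫ r in Set.Ioi (0 : ℝ), radialDeriv φ (r, θ) = -φ 0 := by
    intro θ
    set e := Complex.polarCoord.symm (1, θ) with he
    have he0 : e ≠ 0 := norm_ne_zero_iff.1 (by rw [norm_polarCoord_symm_one]; exact one_ne_zero)
    have hcd : ContDiff ℝ 1 fun r : ℝ => φ (r • e) :=
      (hφ.smooth.of_le (by simp)).comp (contDiff_id.smul contDiff_const)
    have hcs : HasCompactSupport fun r : ℝ => φ (r • e) :=
      hφ.compact.comp_isClosedEmbedding (isClosedEmbedding_smul_left he0)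
    have h := hcs.integral_Ioi_deriv_eq hcd 0
    rw [zero_smul] at h
    rw [← h]
    refine integral_congr_ae (Eventually.of_forall fun r => ?_)
    have hd := (hφ.differentiableAt (r • e)).hasFDerivAt.comp_hasDerivAt r
      ((hasDerivAt_id r).smul_const e)
    have := hd.deriv
    simp only [id_eq, one_smul] at this
    have e1 : radialDeriv φ (r, θ) = fderiv ℝ φ (r • e) e := by
      rw [he, ← polarCoord_symm_eq_smul]
      rfl
    exact e1.trans this.symm
  simp only [key]
  rw [integral_const, measureReal_restrict_apply_univ, Real.volume_real_Ioo_of_le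
    (by linarith [Real.pi_pos])]
  simp only [smul_eq_mul]
  ring

theorem norm_sq_add_pos {ε : ℝ} (hε : 0 < ε) (x : ℂ) : 0 < ‖x‖ ^ 2 + ε := by positivity

theorem contDiff_log_norm_sq_add {ε : ℝ} (hε : 0 < ε) :
    ContDiff ℝ (⊤ : ℕ∞) fun x : ℂ => Real.log (‖x‖ ^ 2 + ε) / 2 :=
  (((contDiff_norm_sq ℝ).add contDiff_const).log fun x =>
    (norm_sq_add_pos hε x).ne').div_const 2

theorem partialD_log_norm_sq_add {ε : ℝ} (hε : 0 < ε) (x : ℂ) (j : Fin 2) :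
    partialD j (fun x : ℂ => Real.log (‖x‖ ^ 2 + ε) / 2) x
      = inner ℝ x (coordDir j) / (‖x‖ ^ 2 + ε) := by
  have h0 := (norm_sq_add_pos hε x).ne'
  have h1 := hasDerivAt_line ((contDiff_log_norm_sq_add hε).differentiable (by simp) x) j
  have h2 : HasDerivAt (fun t : ℝ => x + t • coordDir j) (coordDir j) 0 := by
    simpa using ((hasDerivAt_id (0 : ℝ)).smul_const (coordDir j)).const_add x
  have h3 := ((h2.norm_sq.add_const ε).log (by simpa using h0)).div_const 2
  rw [h1.unique h3]
  simp only [zero_smul, add_zero]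
  field_simp

/-- The gradient of ½ log(|x|² + ε) is x/(|x|² + ε). Against ∇φ it is a radial derivative, and the
polar Jacobian supplies the second power of r. -/
theorem integral_radial_regularized {Ω : Set ℂ} {φ : ℂ → ℝ} (hφ : IsTest Ω φ) {ε : ℝ}
    (hε : 0 < ε) :
    ∫ x, (∑ j, partialD j (partialD j φ) x) • (Real.log (‖x‖ ^ 2 + ε) / 2)
      = -∫ p in Set.Ioi 0 ×ˢ Set.Ioo (-Real.pi) Real.pi,
          p.1 ^ 2 / (p.1 ^ 2 + ε) * radialDeriv φ p := by
  have h := (WeakGradOn.of_contDiffOn isOpen_univ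
    (contDiff_log_norm_sq_add hε).contDiffOn).integral_laplacian (hφ.mono (Set.subset_univ _))
  rw [h, ← Complex.integral_comp_polarCoord_symm, polarCoord_target]
  congr 1
  refine setIntegral_congr_fun (measurableSet_Ioi.prod measurableSet_Ioo) fun p hp => ?_
  have hr : 0 < p.1 := hp.1
  have hn : ‖Complex.polarCoord.symm p‖ = p.1 := by
    rw [← Prod.mk.eta (p := p), polarCoord_symm_eq_smul, norm_smul, norm_polarCoord_symm_one,
      mul_one, Real.norm_of_nonneg hr.le]
  have h0 := (norm_sq_add_pos hε (Complex.polarCoord.symm p)).ne'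
  simp only [partialD_log_norm_sq_add hε, Fin.sum_univ_two, hn] at h0 ⊢
  rw [radialDeriv, fderiv_apply_eq]
  have e1 : inner ℝ (Complex.polarCoord.symm p) (coordDir 0)
      = p.1 * (Complex.polarCoord.symm (1, p.2)).re := by
    rw [← Prod.mk.eta (p := p), polarCoord_symm_eq_smul, real_inner_complex]
    simp [coordDir]
  have e2 : inner ℝ (Complex.polarCoord.symm p) (coordDir 1)
      = p.1 * (Complex.polarCoord.symm (1, p.2)).im := by
    rw [← Prod.mk.eta (p := p), polarCoord_symm_eq_smul, real_inner_complex]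
    simp [coordDir]
  rw [e1, e2]
  simp only [smul_eq_mul]
  field_simp

theorem tendsto_integral_radial {Ω : Set ℂ} {φ : ℂ → ℝ} (hφ : IsTest Ω φ) :
    Tendsto (fun n : ℕ => ∫ p in Set.Ioi 0 ×ˢ Set.Ioo (-Real.pi) Real.pi,
      p.1 ^ 2 / (p.1 ^ 2 + 1 / ((n : ℝ) + 1)) * radialDeriv φ p) atTop
      (𝓝 (-(2 * Real.pi * φ 0))) := by
  rw [← integral_radialDeriv hφ]
  have hpos : ∀ n : ℕ, 0 < 1 / ((n : ℝ) + 1) := fun n => Nat.one_div_pos_of_nat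
  have hne : ∀ (n : ℕ) (p : ℝ × ℝ), p.1 ^ 2 + 1 / ((n : ℝ) + 1) ≠ 0 := fun n p =>
    (add_pos_of_nonneg_of_pos (sq_nonneg _) (hpos n)).ne'
  refine tendsto_integral_of_dominated_convergence (fun p => ‖radialDeriv φ p‖) (fun n => ?_)
    (integrableOn_radialDeriv hφ).norm (fun n => Eventually.of_forall fun p => ?_) ?_
  · refine Continuous.aestronglyMeasurable (Continuous.mul ?_ (continuous_radialDeriv hφ))
    exact (continuous_fst.pow 2).div ((continuous_fst.pow 2).add continuous_const) (hne n)
  · rw [norm_mul]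
    refine mul_le_of_le_one_left (norm_nonneg _) ?_
    rw [Real.norm_of_nonneg (div_nonneg (sq_nonneg _)
      (add_nonneg (sq_nonneg _) (hpos n).le))]
    exact div_le_one_of_le₀ (le_add_of_nonneg_right (hpos n).le)
      (add_nonneg (sq_nonneg _) (hpos n).le)
  · filter_upwards [ae_restrict_mem (measurableSet_Ioi.prod measurableSet_Ioo)] with p hp
    have hr : (p.1 : ℝ) ^ 2 ≠ 0 := (pow_pos (show 0 < p.1 from hp.1) 2).ne'
    have h1 : Tendsto (fun n : ℕ => p.1 ^ 2 + 1 / ((n : ℝ) + 1)) atTop (𝓝 (p.1 ^ 2)) := by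
      simpa using tendsto_one_div_add_atTop_nhds_zero_nat.const_add (p.1 ^ 2)
    have h2 := ((tendsto_const_nhds (x := p.1 ^ 2)).div h1 hr).mul_const (radialDeriv φ p)
    rwa [div_self hr, one_mul] at h2

/-- The regularized logarithm increases with ε, so it lies between its values at 0 and at 1; this
gives an integrable majorant independent of ε. -/
theorem abs_log_norm_sq_add_le {ε : ℝ} (hε : 0 < ε) (hε1 : ε ≤ 1) {x : ℂ} (hx : x ≠ 0) :
    |Real.log (‖x‖ ^ 2 + ε) / 2| ≤ |Real.log ‖x‖| + |Real.log (‖x‖ ^ 2 + 1) / 2| := by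
  have hn : 0 < ‖x‖ := norm_pos_iff.2 hx
  have h1 : Real.log ‖x‖ ≤ Real.log (‖x‖ ^ 2 + ε) / 2 := by
    have : Real.log (‖x‖ ^ 2) ≤ Real.log (‖x‖ ^ 2 + ε) :=
      Real.log_le_log (by positivity) (by linarith)
    rw [Real.log_pow] at this
    push_cast at this
    linarith
  have h2 : Real.log (‖x‖ ^ 2 + ε) / 2 ≤ Real.log (‖x‖ ^ 2 + 1) / 2 := by
    have : Real.log (‖x‖ ^ 2 + ε) ≤ Real.log (‖x‖ ^ 2 + 1) :=
      Real.log_le_log (by positivity) (by linarith)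
    linarith
  have := abs_nonneg (Real.log ‖x‖)
  have := abs_nonneg (Real.log (‖x‖ ^ 2 + 1) / 2)
  rw [abs_le]
  constructor
  · linarith [neg_abs_le (Real.log ‖x‖)]
  · linarith [le_abs_self (Real.log (‖x‖ ^ 2 + 1) / 2)]

/-- Let ε → 0 in the regularized identity, by dominated convergence on both sides. -/
theorem integral_laplacian_log_norm {Ω : Set ℂ} {φ : ℂ → ℝ} (hφ : IsTest Ω φ) :
    ∫ x, (∑ j, partialD j (partialD j φ) x) • Real.log ‖x‖ = 2 * Real.pi * φ 0 := by
  set D : ℂ → ℝ := fun x => ∑ j, partialD j (partialD j φ) x with hD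
  have hpos : ∀ n : ℕ, 0 < 1 / ((n : ℝ) + 1) := fun n => Nat.one_div_pos_of_nat
  have hle : ∀ n : ℕ, 1 / ((n : ℝ) + 1) ≤ 1 := fun n => by
    rw [div_le_one (by positivity)]
    linarith [n.cast_nonneg (α := ℝ)]
  have hDt : IsTest Ω D := by
    simp only [hD, Fin.sum_univ_two]
    exact ((hφ.partialD 0).partialD 0).add ((hφ.partialD 1).partialD 1)
  have l1 : Tendsto (fun n : ℕ => ∫ x, D x • (Real.log (‖x‖ ^ 2 + 1 / ((n : ℝ) + 1)) / 2)) atTop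
      (𝓝 (∫ x, D x • Real.log ‖x‖)) := by
    refine tendsto_integral_of_dominated_convergence
      (fun x => ‖D x • (|Real.log ‖x‖| + |Real.log (‖x‖ ^ 2 + 1) / 2|)‖) (fun n => ?_) ?_
      (fun n => ?_) ?_
    · exact (hDt.smooth.continuous.smul
        (contDiff_log_norm_sq_add (hpos n)).continuous).aestronglyMeasurable
    · refine (IsTest.integrable_smul (hDt.mono (Set.subset_univ _)) ?_).norm
      rw [locallyIntegrableOn_univ]
      exact LocallyIntegrable.add (fun x => (locallyIntegrable_log_norm x).norm)
        (contDiff_log_norm_sq_add one_pos).continuous.norm.locallyIntegrable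
    · filter_upwards [compl_mem_ae_iff.2 (measure_singleton (0 : ℂ))] with x hx
      rw [norm_smul, norm_smul]
      refine mul_le_mul_of_nonneg_left ?_ (norm_nonneg _)
      refine (abs_log_norm_sq_add_le (hpos n) (hle n) hx).trans (le_abs_self _)
    · filter_upwards [compl_mem_ae_iff.2 (measure_singleton (0 : ℂ))] with x hx
      have hn : 0 < ‖x‖ := norm_pos_iff.2 hx
      have h1 : Tendsto (fun n : ℕ => ‖x‖ ^ 2 + 1 / ((n : ℝ) + 1)) atTop (𝓝 (‖x‖ ^ 2)) := by
        simpa using tendsto_one_div_add_atTop_nhds_zero_nat.const_add (‖x‖ ^ 2)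
      have h2 := ((h1.log (by positivity)).div_const 2).const_smul (D x)
      have h3 : Real.log (‖x‖ ^ 2) / 2 = Real.log ‖x‖ := by
        rw [Real.log_pow]
        push_cast
        ring
      rwa [h3] at h2
  have l2 := (tendsto_integral_radial hφ).neg
  simp only [← integral_radial_regularized hφ (hpos _), neg_neg] at l2
  exact tendsto_nhds_unique l1 l2

theorem integral_laplacian_log_norm_sub {Ω : Set ℂ} {φ : ℂ → ℝ} (hφ : IsTest Ω φ) (x₀ : ℂ) :
    ∫ x, (∑ j, partialD j (partialD j φ) x) • Real.log ‖x - x₀‖ = 2 * Real.pi * φ x₀ := by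
  have hψ : IsTest Set.univ (fun x => φ (x + x₀)) :=
    ⟨hφ.smooth.comp (contDiff_id.add contDiff_const),
      hφ.compact.comp_homeomorph (Homeomorph.addRight x₀), Set.subset_univ _⟩
  have h := integral_laplacian_log_norm hψ
  rw [zero_add] at h
  rw [← h, ← integral_add_right_eq_self _ x₀]
  have hp : ∀ (f : ℂ → ℝ) j, partialD j (fun x => f (x + x₀)) = fun x => partialD j f (x + x₀) :=
    fun f j => funext fun x => by simp only [partialD, fderiv_comp_add_right]
  simp only [hp, add_sub_cancel_right]

end Logarithm

/-! ### Isolated singularities -/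

section Singularities

theorem locallyIntegrable_log_norm_sub (x₀ : ℂ) :
    LocallyIntegrable (fun x : ℂ => Real.log ‖x - x₀‖) volume := by
  rw [locallyIntegrable_iff]
  intro K hK
  have h1 : IntegrableOn (fun x : ℂ => Real.log ‖x‖) ((fun x => x - x₀) '' K) :=
    locallyIntegrable_log_norm.integrableOn_isCompact (hK.image (continuous_id.sub continuous_const))
  have h2 := ((measurePreserving_sub_right volume x₀).integrableOn_comp_preimage
    (Homeomorph.subRight x₀).measurableEmbedding).2 h1
  exact h2.mono_set fun x hx => ⟨x, hx, rfl⟩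

/-- Polar coordinates present the punctured ball as a continuous image of a strip. -/
theorem isPreconnected_punctured_ball (x₀ : ℂ) (r : ℝ) :
    IsPreconnected (Metric.ball x₀ r \ {x₀}) := by
  have h1 : IsPreconnected ((fun p : ℝ × ℝ => x₀ + (p.1 : ℂ) * Complex.exp (p.2 * Complex.I)) ''
      (Set.Ioo 0 r ×ˢ Set.univ)) := by
    refine (isPreconnected_Ioo.prod isPreconnected_univ).image _ (Continuous.continuousOn ?_)
    fun_prop
  convert h1 using 1
  ext x
  constructor
  · rintro ⟨hx, hne⟩
    have h0 : 0 < ‖x - x₀‖ := norm_pos_iff.2 (sub_ne_zero.2 hne)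
    refine ⟨(‖x - x₀‖, (x - x₀).arg), ⟨⟨h0, by rwa [← dist_eq_norm]⟩, trivial⟩, ?_⟩
    simp only [Complex.norm_mul_exp_arg_mul_I, add_sub_cancel]
  · rintro ⟨⟨s, θ⟩, ⟨⟨hs, hsr⟩, -⟩, rfl⟩
    have hn : ‖(s : ℂ) * Complex.exp (θ * Complex.I)‖ = s := by
      rw [norm_mul, Complex.norm_exp_ofReal_mul_I, mul_one, Complex.norm_real,
        Real.norm_of_nonneg (le_of_lt hs)]
    constructor
    · rw [Metric.mem_ball, dist_eq_norm, add_sub_cancel_left, hn]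
      exact hsr
    · intro h
      have : (s : ℂ) * Complex.exp (θ * Complex.I) = 0 := by simpa using h
      rw [this, norm_zero] at hn
      exact (ne_of_gt hs) hn.symm

/-- The hypothesis is Δa = 2πd δ at x₀, and d log|x - x₀| has the same Laplacian. -/
theorem weaklyHarmonicOn_sub_log {x₀ : ℂ} {r : ℝ} {a : ℂ → ℝ} {va : Fin 2 → ℂ → ℝ}
    (h : WeakGradOn (Metric.ball x₀ r) a va) {d : ℝ}
    (hd : ∀ φ, IsTest (Metric.ball x₀ r) φ →
      ∫ x, ∑ j, partialD j φ x • va j x = -(2 * Real.pi * d * φ x₀)) :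
    WeaklyHarmonicOn (Metric.ball x₀ r) (fun x => a x - d * Real.log ‖x - x₀‖) := by
  have hl : LocallyIntegrableOn (fun x => Real.log ‖x - x₀‖) (Metric.ball x₀ r) volume :=
    (locallyIntegrable_log_norm_sub x₀).locallyIntegrableOn _
  have hl' : LocallyIntegrableOn (fun x => d * Real.log ‖x - x₀‖) (Metric.ball x₀ r) volume := by
    have := hl.continuousOn_smul (Metric.isOpen_ball.isLocallyClosed) (continuousOn_const (c := d))
    exact this
  refine ⟨h.locInt.sub hl', fun φ hφ => ?_⟩
  set D : ℂ → ℝ := fun x => ∑ j, partialD j (partialD j φ) x with hD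
  have hDt : IsTest (Metric.ball x₀ r) D := by
    simp only [hD, Fin.sum_univ_two]
    exact ((hφ.partialD 0).partialD 0).add ((hφ.partialD 1).partialD 1)
  have e1 := integral_sub (hDt.integrable_smul h.locInt) ((hDt.integrable_smul hl).const_mul d)
  have e2 : ∫ x, D x • a x = 2 * Real.pi * d * φ x₀ := by
    rw [h.integral_laplacian hφ, hd φ hφ, neg_neg]
  have e3 : ∫ x, D x • Real.log ‖x - x₀‖ = 2 * Real.pi * φ x₀ :=
    integral_laplacian_log_norm_sub hφ x₀
  rw [integral_const_mul, e2, e3] at e1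
  have e4 : ∫ x, D x • (a x - d * Real.log ‖x - x₀‖)
      = ∫ x, (D x • a x - d * D x • Real.log ‖x - x₀‖) := by
    refine integral_congr_ae (Eventually.of_forall fun x => ?_)
    simp only [smul_eq_mul]
    ring
  rw [e4, e1]
  ring

namespace HodgeData

variable {g : ℂ → ℂ} {a b : ℂ → ℝ} {vg : Fin 2 → ℂ → ℂ} {va vb : Fin 2 → ℂ → ℝ}

/-- When b = 0, ω = ∇^⊥a and i g⁻¹∇^⊥g = ∇a, so the singularity equation becomes Δa = 2π∑ d_p δ_p.
-/
theorem hasSum_singularities (h : HodgeData g a b vg va vb) (hb : b =ᵐ[discMeasure] 0)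
    (hs : HasIsolatedSingularities g) : ∃ (S : Set ℂ) (d : S → ℤ), ∀ φ, IsTest unitDisc φ →
      HasSum (fun p : S => 2 * Real.pi * (d p : ℝ) * φ p)
        (-∫ x, ∑ j, partialD j φ x • va j x) := by
  obtain ⟨v, S, d, hv, -, -, -, hS⟩ := hs
  refine ⟨S, d, fun φ hφ => ?_⟩
  have h1 := hS φ (isDiscTest_iff.2 hφ)
  have e : ∀ j, v j =ᵐ[discMeasure] vg j :=
    (hasWeakGrad_iff.1 hv).unique isOpen_unitDisc h.gradG (ae_eq_refl _)
  have e2 : ∫ x, Complex.I * (g x)⁻¹ *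
      (-v 1 x * ((partialD 0 φ x : ℝ) : ℂ) + v 0 x * ((partialD 1 φ x : ℝ) : ℂ)) ∂discMeasure
      = ((∫ x, ∑ j, va j x * partialD j φ x ∂discMeasure : ℝ) : ℂ) := by
    rw [← integral_complex_ofReal]
    refine integral_congr_ae ?_
    filter_upwards [e 0, e 1, h.rel, h.norm_eq, h.grad_eq_zero_of_ae_eq_zero hb 0,
      h.grad_eq_zero_of_ae_eq_zero hb 1] with x e0 e1 r hn b0 b1
    have hg0 : g x ≠ 0 := fun h0 => by simp [h0] at hn
    have hgi := mul_inv_cancel₀ hg0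
    rw [e0, e1, r 0, r 1, hodgeField_zero, hodgeField_one, b0, b1, Fin.sum_univ_two]
    simp only [Complex.real_smul, zero_sub, zero_add, Complex.ofReal_neg, Complex.ofReal_add,
      Complex.ofReal_mul]
    linear_combination (-(Complex.I * Complex.I) * ((va 0 x : ℂ) * (partialD 0 φ x : ℝ)
      + (va 1 x : ℂ) * (partialD 1 φ x : ℝ))) * hgi
      - ((va 0 x : ℂ) * (partialD 0 φ x : ℝ) + (va 1 x : ℂ) * (partialD 1 φ x : ℝ))
        * Complex.I_mul_I
  rw [e2, integral_disc_sum hφ] at h1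
  have h2 := Complex.hasSum_re h1
  simp only [← Complex.ofReal_neg, Complex.ofReal_re] at h2
  refine h2.congr_fun ?_
  intro p
  rw [← Complex.ofReal_ofNat, ← Complex.ofReal_intCast, ← Complex.ofReal_mul, ← Complex.ofReal_mul,
    ← Complex.ofReal_mul, Complex.ofReal_re]

/-- Near each point of the disc there is at most one singularity. -/
theorem exists_local_degree (h : HodgeData g a b vg va vb) (hb : b =ᵐ[discMeasure] 0)
    (hs : HasIsolatedSingularities g) {x₀ : ℂ} (hx₀ : x₀ ∈ unitDisc) :
    ∃ (r : ℝ) (d : ℤ), 0 < r ∧ Metric.ball x₀ r ⊆ unitDisc ∧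
      ∀ φ, IsTest (Metric.ball x₀ r) φ →
        ∫ x, ∑ j, partialD j φ x • va j x = -(2 * Real.pi * (d : ℝ) * φ x₀) := by
  classical
  obtain ⟨S, d, hS⟩ := h.hasSum_singularities hb hs
  obtain ⟨R, hR, hRs⟩ := Metric.nhds_basis_closedBall.mem_iff.1 (isOpen_unitDisc.mem_nhds hx₀)
  -- Convergence against this one bump leaves only finitely many terms of size at least 1; outside
  -- those, a point where χ = 1 carries no charge.
  let χ : ContDiffBump x₀ := ⟨R / 2, R, by linarith, by linarith⟩
  have hχ : IsTest unitDisc χ := ⟨χ.contDiff, χ.hasCompactSupport, by rwa [χ.tsupport_eq]⟩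
  have h0 := (hS χ hχ).summable.tendsto_cofinite_zero
  have hfin : {p : S | ¬ |2 * Real.pi * (d p : ℝ) * χ p| < 1}.Finite := by
    have := h0.eventually (Metric.ball_mem_nhds (0 : ℝ) one_pos)
    simpa [Filter.eventually_cofinite] using this
  set T : Set ℂ := (Subtype.val '' {p : S | ¬ |2 * Real.pi * (d p : ℝ) * χ p| < 1}) \ {x₀}
  have hT : T.Finite := (hfin.image _).subset Set.sdiff_subset
  obtain ⟨ρ, hρ, hρT⟩ := Metric.mem_nhds_iff.1 (hT.isClosed.isOpen_compl.mem_nhds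
    (show x₀ ∈ Tᶜ from fun hx => hx.2 rfl))
  refine ⟨min ρ (R / 2), if hx : x₀ ∈ S then d ⟨x₀, hx⟩ else 0, lt_min hρ (by linarith), ?_, ?_⟩
  · refine (Metric.ball_subset_ball (min_le_right _ _)).trans
      ((Metric.ball_subset_closedBall.trans (Metric.closedBall_subset_closedBall ?_)).trans hRs)
    linarith
  intro φ hφ
  have hsub : Metric.ball x₀ (min ρ (R / 2)) ⊆ unitDisc :=
    (Metric.ball_subset_ball (min_le_right _ _)).trans
      ((Metric.ball_subset_closedBall.trans
        (Metric.closedBall_subset_closedBall (by linarith))).trans hRs)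
  have hsum := hS φ (hφ.mono hsub)
  have hzero : ∀ p : S, (p : ℂ) ≠ x₀ → 2 * Real.pi * (d p : ℝ) * φ p = 0 := by
    intro p hp
    by_cases hpb : (p : ℂ) ∈ Metric.ball x₀ (min ρ (R / 2))
    · have hpT : (p : ℂ) ∉ T := hρT (Metric.ball_subset_ball (min_le_left _ _) hpb)
      have hlt : |2 * Real.pi * (d p : ℝ) * χ p| < 1 := by
        by_contra hc
        exact hpT ⟨⟨p, hc, rfl⟩, hp⟩
      have h1 : χ (p : ℂ) = 1 := χ.one_of_mem_closedBall
        (Metric.ball_subset_closedBall (Metric.ball_subset_ball (min_le_right _ _) hpb))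
      rw [h1, mul_one, abs_mul, abs_of_pos Real.two_pi_pos] at hlt
      -- A nonzero integer would make the term at least 2π > 1.
      have hd0 : d p = 0 := by
        by_contra hc
        have : (1 : ℝ) ≤ |(d p : ℝ)| := by exact_mod_cast Int.one_le_abs hc
        nlinarith [Real.pi_gt_three]
      simp [hd0]
    · rw [hφ.eq_zero hpb, mul_zero]
  by_cases hx : x₀ ∈ S
  · have h1 := hasSum_single (⟨x₀, hx⟩ : S) (f := fun p : S => 2 * Real.pi * (d p : ℝ) * φ p)
      fun p hp => hzero p fun hc => hp (Subtype.ext hc)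
    rw [dif_pos hx, ← hsum.unique h1, neg_neg]
  · have h1 : HasSum (fun p : S => 2 * Real.pi * (d p : ℝ) * φ p) 0 := by
      convert hasSum_zero (α := ℝ) using 2 with p
      exact hzero p fun hc => hx (hc ▸ p.2)
    rw [dif_neg hx, ← neg_eq_iff_eq_neg.2 (hsum.unique h1).symm]
    simp

/-- Near each point, `a` is the logarithm of the modulus of a meromorphic function. -/
theorem exists_local_potential (h : HodgeData g a b vg va vb) (hb : b =ᵐ[discMeasure] 0)
    (hs : HasIsolatedSingularities g) {x₀ : ℂ} (hx₀ : x₀ ∈ unitDisc) :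
    ∃ (r : ℝ) (d : ℤ) (H : ℂ → ℂ), 0 < r ∧ Metric.ball x₀ r ⊆ unitDisc ∧
      AnalyticOnNhd ℂ H (Metric.ball x₀ r) ∧
      ∀ᵐ x ∂volume.restrict (Metric.ball x₀ r), a x = (H x).re + d * Real.log ‖x - x₀‖ := by
  obtain ⟨r, d, hr, hsub, hd⟩ := h.exists_local_degree hb hs hx₀
  obtain ⟨k, -, hk, hae⟩ := (weaklyHarmonicOn_sub_log (h.gradA.mono hsub) hd).exists_harmonic
    Metric.isOpen_ball
  obtain ⟨H, hH, hHk⟩ := hk.exists_analyticOnNhd_ball_re_eq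
  refine ⟨r, d, H, hr, hsub, hH, ?_⟩
  filter_upwards [hae, ae_restrict_mem Metric.isOpen_ball.measurableSet] with x hx hxb
  have e : (H x).re = k x := hHk hxb
  rw [e, ← hx]
  ring

end HodgeData

end Singularities

/-! ### Local meromorphic representation of the lift -/

section Representation

/-- A nonvanishing holomorphic function divided by its modulus solves the same first order system
as `g`. -/
theorem partialD_unimodular {f : ℂ → ℂ} {x : ℂ} (hf : DifferentiableAt ℂ f x) (hf0 : f x ≠ 0)
    (j : Fin 2) :
    partialD j (fun y => Real.log (‖f y‖ ^ 2) / 2) x = (deriv f x / f x * coordDir j).re ∧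
    partialD j (fun y => Complex.exp ((Real.log (‖f y‖ ^ 2) / 2 : ℝ) : ℂ) * (f y)⁻¹) x
      = -(Complex.I * ((deriv f x / f x * coordDir j).im : ℝ)) *
        (Complex.exp ((Real.log (‖f x‖ ^ 2) / 2 : ℝ) : ℂ) * (f x)⁻¹) := by
  have hR : DifferentiableAt ℝ f x := hf.restrictScalars ℝ
  have hn : ‖f x‖ ^ 2 ≠ 0 := pow_ne_zero 2 (norm_ne_zero_iff.2 hf0)
  have hq : DifferentiableAt ℝ (fun y => ‖f y‖ ^ 2) x := hR.norm_sq ℝ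
  have hl : DifferentiableAt ℝ (fun y => Real.log (‖f y‖ ^ 2) / 2) x := by
    simpa only [div_eq_mul_inv] using (hq.log hn).mul_const (2 : ℝ)⁻¹
  have hline := hasDerivAt_line hR j
  rw [partialD_of_differentiableAt hf] at hline
  set p := deriv f x * coordDir j with hp
  have hw : deriv f x / f x * coordDir j = p / f x := by
    rw [hp]
    ring
  have h1 : partialD j (fun y => Real.log (‖f y‖ ^ 2) / 2) x = (p / f x).re := by
    have h2 := (hline.norm_sq.log (by simpa using hn)).div_const 2
    rw [(hasDerivAt_line hl j).unique h2]
    simp only [zero_smul, add_zero]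
    rw [Complex.div_re, real_inner_complex, Complex.sq_norm]
    rw [Complex.sq_norm] at hn
    field_simp
  rw [hw]
  refine ⟨h1, ?_⟩
  have hE : DifferentiableAt ℝ (fun y => ((Real.log (‖f y‖ ^ 2) / 2 : ℝ) : ℂ)) x :=
    Complex.ofRealCLM.differentiableAt.comp x hl
  have hlc : HasDerivAt (fun t : ℝ => ((Real.log (‖f (x + t • coordDir j)‖ ^ 2) / 2 : ℝ) : ℂ))
      (((p / f x).re : ℝ) : ℂ) 0 := by
    rw [← h1]
    exact (hasDerivAt_line hl j).ofReal_comp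
  have h3 := hlc.cexp.mul (hline.inv (by simpa using hf0))
  have h4 := hasDerivAt_line (hE.cexp.mul (hR.inv hf0)) j
  have h5 := h4.unique h3
  simp only [zero_smul, add_zero, Pi.inv_apply] at h5
  rw [show (fun y => Complex.exp ((Real.log (‖f y‖ ^ 2) / 2 : ℝ) : ℂ) * (f y)⁻¹)
    = (fun y => Complex.exp ((Real.log (‖f y‖ ^ 2) / 2 : ℝ) : ℂ)) * f⁻¹ from rfl]
  refine h5.trans ?_
  have e : (((p / f x).re : ℝ) : ℂ) = p / f x - ((p / f x).im : ℝ) * Complex.I :=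
    eq_sub_of_add_eq (Complex.re_add_im _)
  rw [e]
  generalize (((p / f x).im : ℝ) : ℂ) = q
  field_simp
  ring

namespace HodgeData

variable {g : ℂ → ℂ} {a b : ℂ → ℝ} {vg : Fin 2 → ℂ → ℂ} {va vb : Fin 2 → ℂ → ℝ}

/-- If e^a = |f|, the Cauchy-Riemann equations turn ω = ∇^⊥ log|f| into ∇ arg f. Hence g|f|/f has
zero gradient and is a constant c. -/
theorem exists_const_mul (h : HodgeData g a b vg va vb) (hb : b =ᵐ[discMeasure] 0) {Ω : Set ℂ}
    (hΩ : IsOpen Ω) (hΩc : IsPreconnected Ω) (hΩs : Ω ⊆ unitDisc) {f : ℂ → ℂ}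
    (hf : DifferentiableOn ℂ f Ω) (hf0 : ∀ x ∈ Ω, f x ≠ 0)
    (ha : ∀ᵐ x ∂volume.restrict Ω, a x = Real.log (‖f x‖ ^ 2) / 2) :
    ∃ c : ℂ, ∀ᵐ x ∂volume.restrict Ω, (Real.exp (a x) : ℂ) * g x = c * f x := by
  have hfa : AnalyticOnNhd ℂ f Ω := hf.analyticOnNhd hΩ
  have hfs : ContDiffOn ℝ (⊤ : ℕ∞) f Ω := fun x hx =>
    ((hfa x hx).contDiffAt.restrict_scalars ℝ).contDiffWithinAt
  have hls : ContDiffOn ℝ (⊤ : ℕ∞) (fun y => Real.log (‖f y‖ ^ 2) / 2) Ω :=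
    ((hfs.norm_sq ℝ).log fun x hx => pow_ne_zero 2 (norm_ne_zero_iff.2 (hf0 x hx))).div_const 2
  have hms : ContDiffOn ℝ (⊤ : ℕ∞)
      (fun y => Complex.exp ((Real.log (‖f y‖ ^ 2) / 2 : ℝ) : ℂ) * (f y)⁻¹) Ω :=
    (Complex.ofRealCLM.contDiff.comp_contDiffOn hls).cexp.mul (hfs.inv hf0)
  have hva : ∀ j, va j =ᵐ[volume.restrict Ω] partialD j fun y => Real.log (‖f y‖ ^ 2) / 2 :=
    (h.gradA.mono hΩs).unique hΩ (WeakGradOn.of_contDiffOn hΩ hls) ha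
  have hr : ∀ {P : ℂ → Prop}, (∀ᵐ x ∂discMeasure, P x) → ∀ᵐ x ∂volume.restrict Ω, P x :=
    fun hP => ae_restrict_of_ae_restrict_of_subset hΩs hP
  obtain ⟨c, hc⟩ := ((h.gradG.mono hΩs).contDiffOn_mul hΩ hms).ae_const hΩ hΩc fun j => by
    filter_upwards [hva 0, hva 1, hr h.rel, hr (h.grad_eq_zero_of_ae_eq_zero hb 0),
      hr (h.grad_eq_zero_of_ae_eq_zero hb 1), ae_restrict_mem hΩ.measurableSet]
      with x v0 v1 rel b0 b1 hx
    have hd : DifferentiableAt ℂ f x := (hfa x hx).differentiableAt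
    rw [(partialD_unimodular hd (hf0 x hx) 0).1] at v0
    rw [(partialD_unimodular hd (hf0 x hx) 1).1] at v1
    have key : hodgeField va vb j x = (deriv f x / f x * coordDir j).im := by
      fin_cases j
      · simp [b0, v1, coordDir]
      · simp [b1, v0, coordDir]
    rw [(partialD_unimodular hd (hf0 x hx) j).2, rel j, key, Complex.real_smul, Pi.zero_apply]
    ring
  refine ⟨c, ?_⟩
  filter_upwards [hc, ha, ae_restrict_mem hΩ.measurableSet] with x hcx hax hx
  rw [← hcx, ← hax, Complex.ofReal_exp]
  have := hf0 x hx
  field_simp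

/-- If `b = 0` then the sphere lift is locally a conformal harmonic map. -/
theorem exists_local_conformal (h : HodgeData g a b vg va vb) (hb : b =ᵐ[discMeasure] 0)
    (hs : HasIsolatedSingularities g) {x₀ : ℂ} (hx₀ : x₀ ∈ unitDisc) :
    ∃ (r : ℝ) (V : ℂ → EuclideanSpace ℝ (Fin 3)), 0 < r ∧
      (∀ x ∈ Metric.ball x₀ r, ConformalHarmonicAt V x) ∧
      sphereLift g a =ᵐ[volume.restrict (Metric.ball x₀ r)] V := by
  obtain ⟨r, d, H, hr, hsub, hH, hae⟩ := h.exists_local_potential hb hs hx₀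
  set Ω := Metric.ball x₀ r \ {x₀} with hΩ
  have hΩo : IsOpen Ω := Metric.isOpen_ball.sdiff isClosed_singleton
  have hΩb : Ω ⊆ Metric.ball x₀ r := Set.sdiff_subset
  have hne : ∀ x ∈ Ω, x - x₀ ≠ 0 := fun x hx => sub_ne_zero.2 hx.2
  -- Chosen so that log|f| = Re H + d log|x - x₀| = a. Integrality of d makes f single valued on the
  -- punctured ball.
  set f : ℂ → ℂ := fun x => (x - x₀) ^ d * Complex.exp (H x) with hf
  have hfd : DifferentiableOn ℂ f Ω := fun x hx =>
    (((differentiableAt_id.sub_const x₀).zpow (Or.inl (hne x hx))).mul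
      (hH x (hΩb hx)).differentiableAt.cexp).differentiableWithinAt
  have hf0 : ∀ x ∈ Ω, f x ≠ 0 := fun x hx =>
    mul_ne_zero (zpow_ne_zero _ (hne x hx)) (Complex.exp_ne_zero _)
  have ha : ∀ᵐ x ∂volume.restrict Ω, a x = Real.log (‖f x‖ ^ 2) / 2 := by
    filter_upwards [ae_restrict_of_ae_restrict_of_subset hΩb hae,
      ae_restrict_mem hΩo.measurableSet] with x hx hxΩ
    rw [hx, Real.log_pow, hf]
    simp only [norm_mul, norm_zpow, Complex.norm_exp]
    rw [Real.log_mul (zpow_ne_zero _ (norm_ne_zero_iff.2 (hne x hxΩ))) (Real.exp_pos _).ne',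
      Real.log_zpow, Real.log_exp]
    push_cast
    ring
  obtain ⟨c, hc⟩ := h.exists_const_mul hb hΩo (isPreconnected_punctured_ball x₀ r)
    (hΩb.trans hsub) hfd hf0 ha
  have hae' : ∀ V : ℂ → EuclideanSpace ℝ (Fin 3), (∀ x ∈ Ω, invStereo (c * f x) = V x) →
      sphereLift g a =ᵐ[volume.restrict (Metric.ball x₀ r)] V := by
    intro V hV
    have hres : volume.restrict (Metric.ball x₀ r) = volume.restrict Ω :=
      (Measure.restrict_congr_set (sdiff_null_ae_eq_self (measure_singleton x₀))).symm
    rw [hres]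
    filter_upwards [hc, ae_restrict_mem hΩo.measurableSet] with x hx hxΩ
    rw [sphereLift, hx, hV x hxΩ]
  have hpow : ∀ (n : ℕ) (x : ℂ), AnalyticAt ℂ (fun y : ℂ => (y - x₀) ^ n) x := fun n x =>
    (analyticAt_id.sub analyticAt_const).pow n
  -- For d ≥ 0 the function f extends holomorphically across x₀. For d ≤ 0 its inverse does, and
  -- `axisFlip` undoes the inversion on the sphere.
  rcases d.eq_nat_or_neg with ⟨n, hn | hn⟩
  · refine ⟨r, fun x => invStereo (c * ((x - x₀) ^ n * Complex.exp (H x))), hr, fun x hx => ?_, ?_⟩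
    · exact conformalHarmonicAt_invStereo_comp
        (analyticAt_const.mul ((hpow n x).mul (hH x hx).cexp))
    · refine hae' _ fun x hx => ?_
      simp only [hf, hn, zpow_natCast]
  · have hc0 : c ≠ 0 := by
      intro hc0
      have hpos : volume Ω ≠ 0 := by
        rw [hΩ, measure_sdiff_null (measure_singleton x₀)]
        exact (Metric.measure_ball_pos volume x₀ hr).ne'
      have : (ae (volume.restrict Ω)).NeBot := by
        rw [ae_neBot, Ne, Measure.restrict_eq_zero]
        exact hpos
      obtain ⟨x, hx, hg⟩ := (hc.and
        (ae_restrict_of_ae_restrict_of_subset (hΩb.trans hsub) h.norm_eq)).exists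
      rw [hc0, zero_mul, mul_eq_zero] at hx
      rcases hx with hx | hx
      · exact (Real.exp_pos (a x)).ne' (by exact_mod_cast hx)
      · rw [hx, norm_zero] at hg
        exact zero_ne_one hg
    refine ⟨r, fun x => axisFlip (invStereo (c⁻¹ * ((x - x₀) ^ n * Complex.exp (-H x)))), hr,
      fun x hx => ?_, ?_⟩
    · exact (conformalHarmonicAt_invStereo_comp
        (analyticAt_const.mul ((hpow n x).mul (hH x hx).neg.cexp))).comp_isometry axisFlip
    · refine hae' _ fun x hx => ?_
      rw [← axisFlip_invStereo_inv (mul_ne_zero hc0 (hf0 x hx))]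
      simp only [hf, hn, zpow_neg, zpow_natCast, mul_inv, inv_inv, Complex.exp_neg]

theorem isConformalHarmonic (h : HodgeData g a b vg va vb) (hb : b =ᵐ[discMeasure] 0)
    (hs : HasIsolatedSingularities g) : IsConformalHarmonicToSphere (sphereLift g a) := by
  have := fun x₀ (hx₀ : x₀ ∈ unitDisc) => h.exists_local_conformal hb hs hx₀
  choose! r V hr hV hae using this
  obtain ⟨U, hU, hUV⟩ := exists_glue (Ω := unitDisc) (u := sphereLift g a) r V hr
    (fun x hx y hy => (hV x hx y hy).smooth.continuousAt.continuousWithinAt) hae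
  have hc : ∀ x ∈ unitDisc, ConformalHarmonicAt U x := fun x hx => by
    refine (hV x hx x (Metric.mem_ball_self (hr x hx))).congr ?_
    filter_upwards [Metric.ball_mem_nhds x (hr x hx), isOpen_unitDisc.mem_nhds hx] with y hy hy'
    exact hUV x hx y hy hy'
  refine ⟨U, ?_, fun x hx => (hc x hx).smooth.contDiffWithinAt, fun x hx => ?_⟩
  · rw [discMeasure, EventuallyEq, ae_restrict_iff' measurableSet_unitDisc]
    exact hU
  · exact ⟨(hc x hx).norm_eq, (hc x hx).harmonic, (hc x hx).norm_partialD,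
      (hc x hx).inner_partialD⟩

end HodgeData

/-- An infimum over no pairs would be ∞, so finite energy provides the decomposition without
elliptic existence theory. -/
theorem exists_isHodgePair_of_renormEnergy_lt_top {g : ℂ → ℂ} (hE : renormEnergy g < ∞) :
    ∃ a b : ℂ → ℝ, IsHodgePair g a b := by
  by_contra hc
  push Not at hc
  refine hE.ne ?_
  simp only [renormEnergy, hc, iInf_false, iInf_top]

end Representation

theorem theoremI3 (p : ℝ≥0∞) (hp : 1 < p) (g : ℂ → ℂ)
    (hg : MemSobolev p g) (hgS : ∀ᵐ x ∂discMeasure, ‖g x‖ = 1)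
    (hE : renormEnergy g < ∞) :
    (IsWeaklyCircleHarmonic g ↔ IsCriticalForRenormEnergy g) ∧
    (∃ a b : ℂ → ℝ, IsHodgePair g a b) ∧
    ∀ a b : ℂ → ℝ, IsHodgePair g a b →
      (IsWeaklyCircleHarmonic g ↔ b =ᵐ[discMeasure] 0) ∧
      (IsCriticalForRenormEnergy g ↔ b =ᵐ[discMeasure] 0) ∧
      (HasIsolatedSingularities g →
        (IsWeaklyCircleHarmonic g ↔ IsConformalHarmonicToSphere (sphereLift g a))) := by
  have key : ∀ a b : ℂ → ℝ, IsHodgePair g a b →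
      (IsWeaklyCircleHarmonic g ↔ b =ᵐ[discMeasure] 0) ∧
      (IsCriticalForRenormEnergy g ↔ b =ᵐ[discMeasure] 0) ∧
      (HasIsolatedSingularities g →
        (IsWeaklyCircleHarmonic g ↔ IsConformalHarmonicToSphere (sphereLift g a))) := by
    intro a b hp
    obtain ⟨vg, va, vb, h⟩ := hp.exists_hodgeData hgS
    have hd := h.integrable_density hp hE
    refine ⟨h.isWeaklyCircleHarmonic_iff, h.isCritical_iff hp hd, fun hs => ?_⟩
    rw [h.isWeaklyCircleHarmonic_iff]
    exact ⟨fun hb => h.isConformalHarmonic hb hs, h.ae_eq_zero_of_conformal hd⟩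
  have hex := exists_isHodgePair_of_renormEnergy_lt_top hE
  obtain ⟨a, b, hab⟩ := hex
  obtain ⟨h1, h2, -⟩ := key a b hab
  exact ⟨h1.trans h2.symm, ⟨a, b, hab⟩, key⟩
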